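/- **Conventions.** For an algebraic number $x$, its minimal polynomial over $\mathbb Z$ is the primitive polynomial in $\mathbb Z[t]$ with positive leading coefficient which has least degree among the non-zero integer polynomials vanishing at $x$. Let $\mathcal A$ be a unital C*-algebra and $T(\mathcal A)$ the complex vector space of bounded linear functionals $\tau$ on $\mathcal A$ with $\tau(xy)=\tau(yx)$ for all $x,y$; suppose that $\dim T(\mathcal A)=n$ and that the extremal tracial states are $\varphi_1,\dots,\varphi_n$. We say that $K_0(\mathcal A)$ embeds in $\mathbb R^n$ if the map $\Gamma:K_0(\mathcal A)\to\mathbb R^n$ induced by $\Gamma([p])=\big((\mathrm{Tr}\otimes\varphi_1)(p),\dots,(\mathrm{Tr}\otimes\varphi_n)(p)\big)$ is an injective unit preserving homomorphism of ordered abelian groups from $(K_0(\mathcal A),K_0(\mathcal A)^+,[1_{\mathcal A}])$ to $(\mathbb R^n,\mathbb R^n_+,(1,\dots,1))$. The fundamental group $F(\mathcal A)$ is the set of the matrices, in the basis $\varphi_1,\dots,\varphi_n$, of the linear maps $T_{(k,p,\Phi)}:T(\mathcal A)\to T(\mathcal A)$, $\tau\mapsto(\mathrm{Tr}_k\otimes\tau)\circ\Phi$,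 where $k\in\mathbb N$, $p\in M_k(\mathcal A)$ is a full projection and $\Phi:\mathcal A\to pM_k(\mathcal A)p$ is a $*$-isomorphism. **Proposition.** Let $a,b$ be positive algebraic numbers with $a\neq b$, $a\neq1$, $b\neq1$, whose minimal polynomials over $\mathbb Z$ are different, and such that the minimal polynomial of $b$ over $\mathbb Z$ is monic. Put $A=\mathrm{diag}(a,b)$. Then: 1. There is an integer $n\ge1$ such that every additive subgroup $G$ of $\mathbb R^2$ with $AG=G$ satisfies $\mathrm{diag}(1,b^{n})G=G$ and $\mathrm{diag}(1,b^{-n})G=G$. 2. There is no unital AF-algebra $\mathcal A$ with $2$-dimensional trace space such that $K_0(\mathcal A)$ embeds in $\mathbb R^2$ and $F(\mathcal A)=\{\mathrm{diag}(a^m,b^m):m\in\mathbb Z\}$. -/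

import Mathlib

open scoped Matrix ComplexOrder Polynomial

/-! ### The group `K₀` of a unital ⋆-ring, in its standard picture by projections in matrices -/

namespace AFFundamental

section KTheory

variable {A : Type*} [Ring A] [StarRing A]

/-- Murray–von Neumann equivalence of square matrices `p` and `q`, possibly of different sizes:
`p = v* v` and `q = v v*` for some rectangular matrix `v`. -/
def MvN {m n : Type*} [Fintype m] [Fintype n] (p : Matrix m m A) (q : Matrix n n A) : Prop :=
  ∃ v : Matrix n m A, vᴴ * v = p ∧ v * vᴴ = q

/-- A projection is Murray–von Neumann equivalent to the same projection with its rows and columns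
relabelled. -/
theorem MvN.reindex {m n : Type*} [Fintype m] [Fintype n] (e : m ≃ n) {p : Matrix m m A}
    (hp : IsStarProjection p) : MvN p (Matrix.reindex e e p) := by
  have h1 : p * p = p := hp.isIdempotentElem
  have h2 : pᴴ = p := hp.isSelfAdjoint
  refine ⟨p.submatrix e.symm id, ?_, ?_⟩
  · rw [Matrix.conjTranspose_submatrix, h2, Matrix.submatrix_mul_equiv, h1, Matrix.submatrix_id_id]
  · rw [Matrix.conjTranspose_submatrix, h2,
      ← Matrix.submatrix_mul p p e.symm id e.symm Function.bijective_id, h1]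
    rfl

theorem MvN.refl {m : Type*} [Fintype m] {p : Matrix m m A} (hp : IsStarProjection p) :
    MvN p p :=
  ⟨p, by
    have h1 : p * p = p := hp.isIdempotentElem
    have h2 : pᴴ = p := hp.isSelfAdjoint
    rw [h2, h1]; exact ⟨rfl, rfl⟩⟩

theorem MvN.symm {m n : Type*} [Fintype m] [Fintype n] {p : Matrix m m A} {q : Matrix n n A}
    (h : MvN p q) : MvN q p := by
  obtain ⟨v, h1, h2⟩ := h
  exact ⟨vᴴ, by rw [Matrix.conjTranspose_conjTranspose, h2],
    by rw [Matrix.conjTranspose_conjTranspose, h1]⟩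

theorem MvN.trans {l m n : Type*} [Fintype l] [Fintype m] [Fintype n] {p : Matrix l l A}
    {q : Matrix m m A} {r : Matrix n n A} (hp : IsStarProjection p) (hr : IsStarProjection r)
    (h : MvN p q) (h' : MvN q r) : MvN p r := by
  obtain ⟨v, h1, h2⟩ := h
  obtain ⟨w, h3, h4⟩ := h'
  refine ⟨w * v, ?_, ?_⟩
  · have : (w * v)ᴴ * (w * v) = (vᴴ * v) * (vᴴ * v) := by
      rw [Matrix.conjTranspose_mul,
        show vᴴ * wᴴ * (w * v) = vᴴ * (wᴴ * w) * v by simp only [Matrix.mul_assoc], h3, ← h2]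
      simp only [Matrix.mul_assoc]
    rw [this, h1]
    exact hp.isIdempotentElem
  · have : (w * v) * (w * v)ᴴ = (w * wᴴ) * (w * wᴴ) := by
      rw [Matrix.conjTranspose_mul,
        show w * v * (vᴴ * wᴴ) = w * (v * vᴴ) * wᴴ by simp only [Matrix.mul_assoc], h2, ← h3]
      simp only [Matrix.mul_assoc]
    rw [this, h4]
    exact hr.isIdempotentElem

theorem isStarProjection_fromBlocks {m n : Type*} [Fintype m] [Fintype n] {p : Matrix m m A}
    {q : Matrix n n A} (hp : IsStarProjection p) (hq : IsStarProjection q) :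
    IsStarProjection (Matrix.fromBlocks p 0 0 q) := by
  have h1 : p * p = p := hp.isIdempotentElem
  have h2 : pᴴ = p := hp.isSelfAdjoint
  have h3 : q * q = q := hq.isIdempotentElem
  have h4 : qᴴ = q := hq.isSelfAdjoint
  refine ⟨?_, ?_⟩
  · change Matrix.fromBlocks p 0 0 q * Matrix.fromBlocks p 0 0 q = _
    simp [Matrix.fromBlocks_multiply, h1, h3]
  · change (Matrix.fromBlocks p 0 0 q)ᴴ = _
    simp [Matrix.fromBlocks_conjTranspose, h2, h4]

theorem isStarProjection_reindex {m n : Type*} [Fintype m] [Fintype n] (e : m ≃ n)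
    {p : Matrix m m A} (hp : IsStarProjection p) : IsStarProjection (Matrix.reindex e e p) := by
  have h1 : p * p = p := hp.isIdempotentElem
  have h2 : pᴴ = p := hp.isSelfAdjoint
  refine ⟨?_, ?_⟩
  · change p.submatrix e.symm e.symm * p.submatrix e.symm e.symm = p.submatrix e.symm e.symm
    rw [Matrix.submatrix_mul_equiv, h1]
  · change (p.submatrix e.symm e.symm)ᴴ = p.submatrix e.symm e.symm
    rw [Matrix.conjTranspose_submatrix, h2]

theorem MvN.fromBlocks {m n m' n' : Type*} [Fintype m] [Fintype n] [Fintype m'] [Fintype n']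
    {p : Matrix m m A} {q : Matrix n n A} {p' : Matrix m' m' A} {q' : Matrix n' n' A}
    (h : MvN p p') (h' : MvN q q') :
    MvN (Matrix.fromBlocks p 0 0 q) (Matrix.fromBlocks p' 0 0 q') := by
  obtain ⟨v, h1, h2⟩ := h
  obtain ⟨w, h3, h4⟩ := h'
  refine ⟨Matrix.fromBlocks v 0 0 w, ?_, ?_⟩
  · simp [Matrix.fromBlocks_conjTranspose, Matrix.fromBlocks_multiply, h1, h3]
  · simp [Matrix.fromBlocks_conjTranspose, Matrix.fromBlocks_multiply, h2, h4]

variable (A) in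
/-- The projections in the matrix algebras `M_k(A)`, for all `k`. -/
abbrev MatProj : Type _ := Σ k : ℕ, {p : Matrix (Fin k) (Fin k) A // IsStarProjection p}

/-- The block diagonal sum `p ⊕ q` of two projections. -/
def MatProj.sum (p q : MatProj A) : MatProj A :=
  ⟨p.1 + q.1, Matrix.reindex finSumFinEquiv finSumFinEquiv (Matrix.fromBlocks p.2.1 0 0 q.2.1),
    isStarProjection_reindex _ (isStarProjection_fromBlocks p.2.2 q.2.2)⟩

theorem MatProj.mvN_sum (p q : MatProj A) :
    MvN (Matrix.fromBlocks p.2.1 0 0 q.2.1) (p.sum q).2.1 :=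
  MvN.reindex _ (isStarProjection_fromBlocks p.2.2 q.2.2)

variable (A) in
/-- Murray–von Neumann equivalence on the projections in the matrix algebras over `A`. -/
instance mvNSetoid : Setoid (MatProj A) where
  r p q := MvN p.2.1 q.2.1
  iseqv :=
    { refl := fun p => MvN.refl p.2.2
      symm := MvN.symm
      trans := fun {p _ r} h h' => MvN.trans p.2.2 r.2.2 h h' }

variable (A) in
/-- The set of Murray–von Neumann classes of projections in the matrix algebras over `A`. -/
def V : Type _ := Quotient (mvNSetoid A)

/-- The class in `V A` of a projection in a matrix algebra over `A`. -/
def V.mk (p : MatProj A) : V A := Quotient.mk (mvNSetoid A) p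

/-- Addition on `V A` is induced by the block diagonal sum. -/
instance V.instAdd : Add (V A) where
  add := Quotient.map₂ MatProj.sum fun p p' h q q' h' =>
    MvN.trans (p.sum q).2.2 (p'.sum q').2.2 (p.mvN_sum q).symm
      (MvN.trans (isStarProjection_fromBlocks p.2.2 q.2.2) (p'.sum q').2.2
        (MvN.fromBlocks h h') (p'.mvN_sum q'))

/-- The zero element of `V A` is the class of the zero projection. -/
instance V.instZero : Zero (V A) where
  zero := V.mk ⟨0, 0, IsStarProjection.zero _⟩

/-- `V A` is a commutative monoid. -/
instance V.instAddCommMonoid : AddCommMonoid (V A) where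
  add_assoc := by
    rintro ⟨p⟩ ⟨q⟩ ⟨r⟩
    apply Quotient.sound
    change MvN ((p.sum q).sum r).2.1 (p.sum (q.sum r)).2.1
    have hpq := isStarProjection_fromBlocks p.2.2 q.2.2
    have hqr := isStarProjection_fromBlocks q.2.2 r.2.2
    have h1 := isStarProjection_fromBlocks hpq r.2.2
    have h2 := isStarProjection_fromBlocks p.2.2 hqr
    refine MvN.trans ((p.sum q).sum r).2.2 (p.sum (q.sum r)).2.2 ((p.sum q).mvN_sum r).symm ?_
    refine MvN.trans (isStarProjection_fromBlocks (p.sum q).2.2 r.2.2) (p.sum (q.sum r)).2.2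
      (MvN.fromBlocks (p.mvN_sum q).symm (MvN.refl r.2.2)) ?_
    refine MvN.trans h1 (p.sum (q.sum r)).2.2 ?_ (p.mvN_sum (q.sum r))
    refine MvN.trans h1 (isStarProjection_fromBlocks p.2.2 (q.sum r).2.2) ?_
      (MvN.fromBlocks (MvN.refl p.2.2) (q.mvN_sum r))
    convert! MvN.reindex (Equiv.sumAssoc _ _ _) h1 using 1
    ext i j
    rcases i with i | i | i <;> rcases j with j | j | j <;> simp
  add_comm := by
    rintro ⟨p⟩ ⟨q⟩
    apply Quotient.sound
    change MvN (p.sum q).2.1 (q.sum p).2.1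
    have h1 := isStarProjection_fromBlocks p.2.2 q.2.2
    refine MvN.trans (p.sum q).2.2 (q.sum p).2.2 (p.mvN_sum q).symm ?_
    refine MvN.trans h1 (q.sum p).2.2 ?_ (q.mvN_sum p)
    convert! MvN.reindex (Equiv.sumComm _ _) h1 using 1
    ext i j
    rcases i with i | i <;> rcases j with j | j <;> simp
  zero_add := by
    rintro ⟨p⟩
    apply Quotient.sound
    refine MvN.trans (MatProj.sum ⟨0, 0, IsStarProjection.zero _⟩ p).2.2 p.2.2
      (MatProj.mvN_sum ⟨0, 0, IsStarProjection.zero _⟩ p).symm ?_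
    convert! MvN.reindex (Equiv.emptySum (Fin 0) (Fin p.1))
      (isStarProjection_fromBlocks (IsStarProjection.zero (Matrix (Fin 0) (Fin 0) A)) p.2.2)
      using 1
  add_zero := by
    rintro ⟨p⟩
    apply Quotient.sound
    refine MvN.trans (MatProj.sum p ⟨0, 0, IsStarProjection.zero _⟩).2.2 p.2.2
      (MatProj.mvN_sum p ⟨0, 0, IsStarProjection.zero _⟩).symm ?_
    convert! MvN.reindex (Equiv.sumEmpty (Fin p.1) (Fin 0))
      (isStarProjection_fromBlocks p.2.2 (IsStarProjection.zero (Matrix (Fin 0) (Fin 0) A)))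
      using 1
  nsmul := nsmulRec

variable (A) in
/-- The group `K₀(A)`: the Grothendieck group of the monoid `V A`. -/
abbrev K0 : Type _ := Algebra.GrothendieckAddGroup (V A)

/-- The class `[p]` in `K₀(A)` of a projection `p ∈ M_k(A)`. -/
noncomputable def K0.mk (p : MatProj A) : K0 A := Algebra.GrothendieckAddGroup.of (V.mk p)

variable (A) in
/-- The positive cone `K₀(A)⁺`: the classes of the projections. -/
def K0.pos : Set (K0 A) := Set.range K0.mk

variable (A) in
/-- The class `[1_A]` in `K₀(A)`. -/
noncomputable def K0.unit : K0 A := K0.mk ⟨1, 1, IsStarProjection.one _⟩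

end KTheory

/-! ### AF-algebras, traces, the map `Γ` and the fundamental group -/

section Algebras

variable (A : Type*) [CStarAlgebra A]

/-- A unital C⋆-algebra is an AF-algebra if it is the closure of the union of an increasing sequence
of finite-dimensional ⋆-subalgebras. -/
def IsAF : Prop :=
  ∃ F : ℕ → StarSubalgebra ℂ A, Monotone F ∧ (∀ n, FiniteDimensional ℂ (F n)) ∧
    Dense (⋃ n, (F n : Set A))

/-- The trace space `T(A)`: the bounded linear functionals `τ` on `A` with `τ(xy) = τ(yx)`. -/
noncomputable def traceSpace : Submodule ℂ (A →L[ℂ] ℂ) where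
  carrier := {τ | ∀ x y, τ (x * y) = τ (y * x)}
  add_mem' := fun hs ht x y => by simp [hs x y, ht x y]
  zero_mem' := fun _ _ => rfl
  smul_mem' := fun c _ ht x y => by simp [ht x y]

/-- The set `T(A)₁⁺` of tracial states of `A`. -/
def tracialStates : Set (traceSpace A) :=
  {τ | (∀ x : A, 0 ≤ τ.1 (star x * x)) ∧ τ.1 1 = 1}

variable {A}

/-- `Tr_k ⊗ τ`, on matrices over `A`. -/
noncomputable def matTrace (τ : traceSpace A) {k : Type*} [Fintype k] (x : Matrix k k A) : ℂ :=
  ∑ i, τ.1 (x i i)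

theorem MvN.matTrace_eq (τ : traceSpace A) {m n : Type*} [Fintype m] [Fintype n]
    {p : Matrix m m A} {q : Matrix n n A} (h : MvN p q) : matTrace τ p = matTrace τ q := by
  obtain ⟨v, rfl, rfl⟩ := h
  simp only [matTrace, Matrix.mul_apply, Matrix.conjTranspose_apply, map_sum]
  rw [Finset.sum_comm]
  exact Finset.sum_congr rfl fun i _ => Finset.sum_congr rfl fun j _ => τ.2 _ _

/-- The homomorphism `τ^* : K₀(A) → ℂ` induced by a trace `τ`, with `τ^*([p]) = (Tr_k ⊗ τ)(p)`. -/
noncomputable def traceK0 (τ : traceSpace A) : K0 A →+ ℂ :=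
  Algebra.GrothendieckAddGroup.lift
    { toFun := Quotient.lift (fun p : MatProj A => matTrace τ p.2.1)
        fun _ _ h => MvN.matTrace_eq τ h
      map_zero' := by
        change matTrace τ (0 : Matrix (Fin 0) (Fin 0) A) = 0
        simp [matTrace]
      map_add' := by
        rintro ⟨p⟩ ⟨q⟩
        change matTrace τ (p.sum q).2.1 = matTrace τ p.2.1 + matTrace τ q.2.1
        rw [← MvN.matTrace_eq τ (p.mvN_sum q)]
        simp [matTrace] }

theorem traceK0_mk (τ : traceSpace A) (p : MatProj A) : traceK0 τ (K0.mk p) = matTrace τ p.2.1 :=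
  DFunLike.congr_fun (Algebra.GrothendieckAddGroup.lift.symm_apply_apply _) (V.mk p)

/-- The map `Γ : K₀(A) → ℝⁿ`, `Γ(g) = (φ₁^*(g), …, φₙ^*(g))`, for tracial states `φ₁, …, φₙ`
(on which the values `φᵢ^*(g)` are real numbers). -/
noncomputable def Gam {n : ℕ} (φ : Fin n → traceSpace A) : K0 A →+ (Fin n → ℝ) where
  toFun g i := (traceK0 (φ i) g).re
  map_zero' := by ext; simp
  map_add' := by intros; ext; simp

/-- `φ₁, …, φₙ` is an enumeration without repetition of the extremal tracial states. -/
def EnumeratesExtremalTraces {n : ℕ} (φ : Fin n → traceSpace A) : Prop :=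
  Function.Injective φ ∧ Set.range φ = (tracialStates A).extremePoints ℝ

/-- `A` has `K₀(A)` embedding on `ℝⁿ`: the map `Γ` is an injective unit preserving homomorphism of
ordered abelian groups from `(K₀(A), K₀(A)⁺, [1_A])` to `(ℝⁿ, ℝⁿ₊, (1, …, 1))`. -/
def HasK0Embedding {n : ℕ} (φ : Fin n → traceSpace A) : Prop :=
  Function.Injective (Gam φ) ∧ (∀ g ∈ K0.pos A, 0 ≤ Gam φ g) ∧ Gam φ (K0.unit A) = 1

/-- `Φ` is an isomorphism of `A` onto the corner `p M_k(A) p`. -/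
def IsCornerIso {k : ℕ} (p : Matrix (Fin k) (Fin k) A) (Φ : A →⋆ₙₐ[ℂ] Matrix (Fin k) (Fin k) A) :
    Prop :=
  Function.Injective Φ ∧ Set.range Φ = {x | p * x * p = x}

/-- A projection `p ∈ M_k(A)` is full if the two-sided ideal which it generates is dense. -/
def IsFullProjection {k : ℕ} (p : Matrix (Fin k) (Fin k) A) : Prop :=
  IsStarProjection p ∧ Dense (TwoSidedIdeal.span {p} : Set (Matrix (Fin k) (Fin k) A))

/-- The fundamental group `F(A)`: the matrices, with respect to the basis `φ₁, …, φₙ` of `T(A)`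
consisting of the extremal tracial states, of the linear maps
`T_{(k,p,Φ)} : T(A) → T(A)`, `τ ↦ (Tr_k ⊗ τ) ∘ Φ`, where `p ∈ M_k(A)` is a full projection and
`Φ` is an isomorphism of `A` onto `p M_k(A) p`. -/
def fundamentalGroup {n : ℕ} (φ : Fin n → traceSpace A) : Set (Matrix (Fin n) (Fin n) ℂ) :=
  {M | ∃ (k : ℕ) (p : Matrix (Fin k) (Fin k) A) (Φ : A →⋆ₙₐ[ℂ] Matrix (Fin k) (Fin k) A),
    IsFullProjection p ∧ IsCornerIso p Φ ∧
      ∀ j : Fin n, ∀ x : A, matTrace (φ j) (Φ x) = ∑ i, M i j * (φ i).1 x}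

end Algebras

/-! ### Minimal integer polynomials and invariant subgroups -/

/-- `ψ` is the minimal polynomial with integer coefficients of the (algebraic) number `x`: the
primitive polynomial with positive leading coefficient, of least degree among the non-zero integer
polynomials which vanish at `x`. -/
structure IsMinIntPoly (ψ : ℤ[X]) (x : ℝ) : Prop where
  primitive : ψ.IsPrimitive
  leadingCoeff_pos : 0 < ψ.leadingCoeff
  root : Polynomial.aeval x ψ = 0
  minimal : ∀ q : ℤ[X], q ≠ 0 → Polynomial.aeval x q = 0 → ψ.natDegree ≤ q.natDegree

/-- The additive subgroup `G` of `ℝ²` is `M`-invariant: `MG = G`. -/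
def IsInvariant (M : Matrix (Fin 2) (Fin 2) ℝ) (G : AddSubgroup (Fin 2 → ℝ)) : Prop :=
  (fun v => M *ᵥ v) '' (G : Set (Fin 2 → ℝ)) = G

end AFFundamental

/-! Write A = diag(a, b). The two integer minimal polynomials ψ₁, ψ₂ are distinct, hence coprime
over ℚ, so the ideal (ψ₁, ψ₂) of ℤ[X] contains an integer d ≠ 0
(`IsMinIntPoly.exists_combination_eq_C`). Because ψ₂ is monic, ℤ[X]/(ψ₂, d) is finite and two powers
of X agree there: X^N (X^n - 1) = U ψ₁ + W ψ₂ (`exists_pow_mul_pow_sub_one_eq`). The polynomial U ψ₁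
takes the value 0 at a and b^N (b^n - 1) at b, so on an A-invariant group the operator A^(-N) (U
ψ₁)(A) = diag(0, b^n - 1) is available. Adding the identity gives diag(1, b^n); the inverse is
obtained in the same way (`exists_pow_isInvariant`).

For the second claim, let G be the range of Γ and S ⊆ G the set of trace vectors of projections. If
F(𝒜) were the set of powers of A, then S and G would be A-invariant, and G would also be invariant
under diag(1, b^n). In an AF-algebra comparison by traces shows that S contains every strictly
positive element of G, and vectors with a vanishing coordinate are moved by powers of A alone. So S
is invariant under diag(a^m, b^(m+nl)) for all integers m, l (`mul_mem_of_invariant`). Choose m and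
l ≠ 0 such that both entries are less than 1. Then these entries form the trace vector of a
projection p of 𝒜, and multiplication by them identifies the trace vectors of 𝒜 with those of p𝒜p.
Elliott's intertwining argument turns this into an isomorphism 𝒜 ≅ p𝒜p
(`exists_bijective_hom_corner`), so the matrix lies in F(𝒜) (`diagonal_mem_fundamentalGroup`). It is
not a power of A, since l ≠ 0 and neither a nor b is 1.

The AF theory rests on finite-dimensional algebras, where projections are compared by the ranks dim
qEg for minimal projections g. Perturbation carries equivalence between the algebra and its finite
stages; this yields cancellation (`IsAFChain.cancel`) and, through a limit of traces of the stages,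
comparison by tracial states (`IsAFChain.projLE_of_forall_lt`). -/

namespace AFFundamental

/-! ### Comparison of projections -/

section Comparison

variable {R : Type*} [Ring R] [StarRing R]

/-- Murray–von Neumann equivalence of elements of a ⋆-ring. -/
def ProjEquiv (p q : R) : Prop := ∃ v : R, star v * v = p ∧ v * star v = q

/-- `q` is Murray–von Neumann equivalent to a subprojection of `p`. -/
def ProjLE (q p : R) : Prop := ∃ v : R, star v * v = q ∧ p * v = v

theorem ProjEquiv.symm {p q : R} (h : ProjEquiv p q) : ProjEquiv q p := by
  obtain ⟨v, h1, h2⟩ := h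
  exact ⟨star v, by rwa [star_star], by rwa [star_star]⟩

theorem ProjEquiv.trans {p q r : R} (hp : IsStarProjection p) (hr : IsStarProjection r)
    (h : ProjEquiv p q) (h' : ProjEquiv q r) : ProjEquiv p r := by
  obtain ⟨v, h1, h2⟩ := h
  obtain ⟨w, h3, h4⟩ := h'
  have e1 : p * p = p := hp.isIdempotentElem
  have e2 : r * r = r := hr.isIdempotentElem
  refine ⟨w * v, ?_, ?_⟩
  · calc star (w * v) * (w * v) = star v * (star w * w) * v := by
          rw [star_mul]; simp only [mul_assoc]
      _ = (star v * v) * (star v * v) := by rw [h3, ← h2]; simp only [mul_assoc]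
      _ = p := by rw [h1, e1]
  · calc (w * v) * star (w * v) = w * (v * star v) * star w := by
          rw [star_mul]; simp only [mul_assoc]
      _ = (w * star w) * (w * star w) := by rw [h2, ← h3]; simp only [mul_assoc]
      _ = r := by rw [h4, e2]

theorem ProjEquiv.refl {p : R} (hp : IsStarProjection p) : ProjEquiv p p :=
  ⟨p, by rw [hp.isSelfAdjoint.star_eq]; exact ⟨hp.isIdempotentElem, hp.isIdempotentElem⟩⟩

theorem mul_comm_of_le {p q : R} (hp : IsStarProjection p)
    (hq : IsStarProjection q) (h : p * q = q) : q * p = q := by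
  have := congrArg star h
  rwa [star_mul, hp.isSelfAdjoint.star_eq, hq.isSelfAdjoint.star_eq] at this

theorem isStarProjection_sub_of_le {p q : R} (hp : IsStarProjection p)
    (hq : IsStarProjection q) (h : p * q = q) : IsStarProjection (p - q) :=
  IsStarProjection.sub_of_mul_eq_left hq hp (mul_comm_of_le hp hq h)

end Comparison

/-! ### Partial isometries and minimal projections in C⋆-algebras. -/

section CStar

variable {B : Type*} [CStarAlgebra B]

/-- The element (v - vq)*(v - vq) expands to zero, so the C⋆-identity gives v = vq. -/
theorem mul_eq_self_of_star_mul_self {v q : B} (hq : IsStarProjection q) (h : star v * v = q) :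
    v * q = v := by
  have e1 : q * q = q := hq.isIdempotentElem
  have e2 : star q = q := hq.isSelfAdjoint
  have : star (v - v * q) * (v - v * q) = 0 := by
    calc star (v - v * q) * (v - v * q) = star v * v - star v * v * q - star q * (star v * v)
          + star q * (star v * v) * q := by rw [star_sub, star_mul]; noncomm_ring
      _ = 0 := by rw [h, e2, e1, e1]; noncomm_ring
  rw [CStarRing.star_mul_self_eq_zero_iff] at this
  exact (sub_eq_zero.1 this).symm

theorem isStarProjection_mul_star {v q : B} (hq : IsStarProjection q) (h : star v * v = q) :
    IsStarProjection (v * star v) := by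
  refine ⟨?_, ?_⟩
  · change v * star v * (v * star v) = v * star v
    rw [show v * star v * (v * star v) = v * (star v * v) * star v by simp only [mul_assoc], h,
      mul_eq_self_of_star_mul_self hq h]
  · change star (v * star v) = _
    rw [star_mul, star_star]

theorem mul_eq_self_of_mul_star {v q : B} (hq : IsStarProjection q) (h : v * star v = q) :
    q * v = v := by
  have := mul_eq_self_of_star_mul_self (v := star v) hq (by rwa [star_star])
  have := congrArg star this
  rwa [star_mul, star_star, hq.isSelfAdjoint.star_eq] at this

/-- A minimal projection `g`: a nonzero projection with `gEg = ℂg`. -/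
structure IsMinProj (g : B) : Prop where
  proj : IsStarProjection g
  ne_zero : g ≠ 0
  scalar : ∀ x, ∃ c : ℂ, g * x * g = c • g

/-- Minimality makes x*x = g(x*x)g a scalar multiple of g; the scalar is real by self-adjointness
and non-negative because it is a spectral value of x*x. -/
theorem IsMinProj.star_mul_self_eq {g x : B} (hg : IsMinProj g) (hx : x * g = x) (hx0 : x ≠ 0) :
    ∃ r : ℝ, 0 < r ∧ star x * x = r • g := by
  have gg : g * g = g := hg.proj.isIdempotentElem
  have gs : star g = g := hg.proj.isSelfAdjoint
  obtain ⟨c, hc⟩ := hg.scalar (star x * x)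
  have h1 : star x * x = c • g := by
    rw [← hc]
    conv_lhs => rw [← hx, star_mul, gs]
    simp only [mul_assoc]
  have hcc : star c = c := by
    have h2 : star (c • g) = c • g := by rw [← h1, star_mul, star_star]
    rw [star_smul, gs] at h2
    exact smul_left_injective ℂ hg.ne_zero h2
  obtain ⟨r, rfl⟩ := Complex.conj_eq_iff_real.1 hcc
  have h2 : star x * x = r • g := by rw [h1]; simp
  -- The element r - x*x annihilates g ≠ 0, so it is not invertible.
  have hr : r ∈ spectrum ℝ (star x * x) := by
    rw [spectrum.mem_iff, h2]
    rintro ⟨u, hu⟩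
    have : (u : B) * g = 0 := by
      rw [hu, sub_mul, smul_mul_assoc, gg, Algebra.algebraMap_eq_smul_one, smul_mul_assoc, one_mul,
        sub_self]
    exact hg.ne_zero (by rwa [Units.mul_right_eq_zero] at this)
  have hr0 := spectrum_star_mul_self_nonneg r hr
  refine ⟨r, lt_of_le_of_ne hr0 ?_, h2⟩
  rintro rfl
  rw [zero_smul, CStarRing.star_mul_self_eq_zero_iff] at h2
  exact hx0 h2

/-- A nonzero element of `pEg`, for a minimal projection `g`, can be rescaled to a partial
isometry with initial projection `g`. -/
theorem IsMinProj.projLE {g p x : B} (hg : IsMinProj g) (hp : IsStarProjection p)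
    (hx : p * x * g ≠ 0) : ∃ v c, v = (c : ℂ) • (p * x * g) ∧ star v * v = g ∧ p * v = v := by
  have gg : g * g = g := hg.proj.isIdempotentElem
  have pp : p * p = p := hp.isIdempotentElem
  obtain ⟨r, hr, hrx⟩ := hg.star_mul_self_eq (x := p * x * g) (by rw [mul_assoc, gg]) hx
  refine ⟨_, ((Real.sqrt r)⁻¹ : ℝ), rfl, ?_, ?_⟩
  · rw [star_smul, smul_mul_smul_comm, hrx, ← Complex.coe_smul r, smul_smul]
    have : star (((Real.sqrt r)⁻¹ : ℝ) : ℂ) * (((Real.sqrt r)⁻¹ : ℝ) : ℂ) * (r : ℂ) = 1 := by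
      rw [Complex.star_def, Complex.conj_ofReal]
      norm_cast
      rw [← mul_inv, Real.mul_self_sqrt hr.le, inv_mul_cancel₀ hr.ne']
    rw [this, one_smul]
  · rw [mul_smul_comm, ← mul_assoc, ← mul_assoc, pp]

end CStar

/-! ### Finite-dimensional C⋆-algebras -/

section FiniteDim

variable {E : Type*} [CStarAlgebra E] [FiniteDimensional ℂ E]

/-- Spectral values are roots of the minimal polynomial over ℝ. Finiteness makes every function
continuous on the spectrum, so indicator functions may be used in the functional calculus. -/
theorem finite_spectrum (a : E) : (spectrum ℝ a).Finite := by
  nontriviality E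
  have hfin : FiniteDimensional ℝ E := FiniteDimensional.complexToReal E
  have hint : IsIntegral ℝ a := Algebra.IsIntegral.isIntegral a
  have hne : minpoly ℝ a ≠ 0 := minpoly.ne_zero hint
  refine ((minpoly ℝ a).roots.toFinset.finite_toSet).subset fun x hx => ?_
  have := spectrum.subset_polynomial_aeval a (minpoly ℝ a) ⟨x, hx, rfl⟩
  rw [minpoly.aeval, spectrum.zero_eq] at this
  simpa [hne] using this

theorem continuousOn_spectrum (f : ℝ → ℝ) (a : E) : ContinuousOn f (spectrum ℝ a) :=
  (finite_spectrum a).continuousOn f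

/-- The spectral projection of `h` for the set `s` of real numbers. -/
noncomputable def specProj (h : E) (s : Set ℝ) : E := cfc (s.indicator (1 : ℝ → ℝ)) h

theorem specProj_isStarProjection (h : E) (s : Set ℝ) : IsStarProjection (specProj h s) := by
  refine ⟨?_, cfc_predicate _ _⟩
  change specProj h s * specProj h s = _
  rw [specProj, ← cfc_mul _ _ h (continuousOn_spectrum _ _) (continuousOn_spectrum _ _)]
  congr 1
  ext x
  by_cases hx : x ∈ s <;> simp [hx]

theorem mul_specProj_singleton {h : E} (hh : IsSelfAdjoint h) (c : ℝ) :
    h * specProj h {c} = c • specProj h {c} := by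
  have h1 : h * specProj h {c} = cfc (fun x => id x * ({c} : Set ℝ).indicator (1 : ℝ → ℝ) x) h := by
    rw [cfc_mul _ _ h (continuousOn_spectrum _ _) (continuousOn_spectrum _ _), cfc_id ℝ h hh]; rfl
  rw [h1, specProj, ← cfc_smul c _ h (continuousOn_spectrum _ _)]
  congr 1
  ext x
  by_cases hx : x = c <;> simp [hx]

theorem eq_sum_specProj {h : E} (hh : IsSelfAdjoint h) :
    h = ∑ c ∈ (finite_spectrum h).toFinset, c • specProj h {c} := by
  have : ∀ c, c • specProj h {c} = cfc (fun x => c • ({c} : Set ℝ).indicator (1 : ℝ → ℝ) x) h :=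
    fun c => by rw [specProj, ← cfc_smul c _ h (continuousOn_spectrum _ _)]
  simp_rw [this]
  rw [← cfc_sum _ h _ (fun i _ => continuousOn_spectrum _ _)]
  conv_lhs => rw [← cfc_id ℝ h hh]
  refine cfc_congr fun x hx => ?_
  rw [Finset.sum_apply, Finset.sum_eq_single x]
  · simp
  · intro b _ hb
    simp [Ne.symm hb]
  · intro h'
    exact absurd ((finite_spectrum h).mem_toFinset.2 hx) h'

theorem specProj_ne_zero {h : E} (hh : IsSelfAdjoint h) {c : ℝ} (hc : c ∈ spectrum ℝ h) :
    specProj h {c} ≠ 0 := by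
  intro h0
  rw [specProj, ← cfc_zero ℝ h, cfc_eq_cfc_iff_eqOn hh (continuousOn_spectrum _ _)
    (continuousOn_spectrum _ _)] at h0
  simpa using h0 hc

/-- The dimension of the right ideal `qE`. -/
noncomputable def rightRank (q : E) : ℕ :=
  Module.finrank ℂ (LinearMap.range (LinearMap.mulLeft ℂ q))

/-- Among the nonzero projections below q take g with gE of least dimension; then g dominates no
other nonzero projection. A spectral projection of a nonzero self-adjoint element of gEg for a
nonzero eigenvalue lies below g, hence equals g, and the element is a multiple of g. Real and
imaginary parts give the general case. -/
theorem exists_isMinProj_le {q : E} (hq : IsStarProjection q) (hq0 : q ≠ 0) :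
    ∃ g, IsMinProj g ∧ q * g = g := by
  classical
  have hex : ∃ n, ∃ g : E, IsStarProjection g ∧ g ≠ 0 ∧ q * g = g ∧ rightRank g = n :=
    ⟨_, q, hq, hq0, hq.isIdempotentElem, rfl⟩
  obtain ⟨g, hg, hg0, hqg, hgn⟩ := Nat.find_spec hex
  have hmin : ∀ e : E, IsStarProjection e → e ≠ 0 → g * e = e → e = g := by
    intro e he he0 hge
    have hle : LinearMap.range (LinearMap.mulLeft ℂ e) ≤ LinearMap.range (LinearMap.mulLeft ℂ g) := by
      rintro _ ⟨x, rfl⟩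
      exact ⟨e * x, by simp [← mul_assoc, hge]⟩
    have hr : rightRank g ≤ rightRank e := by
      rw [hgn]
      exact Nat.find_min' hex ⟨e, he, he0, by rw [← hge, ← mul_assoc, hqg], rfl⟩
    have heq := Submodule.eq_of_le_of_finrank_le hle hr
    have : g ∈ LinearMap.range (LinearMap.mulLeft ℂ e) := by
      rw [heq]; exact ⟨1, by simp⟩
    obtain ⟨x, hx⟩ := this
    have h1 : e * g = g := by
      rw [← hx, LinearMap.mulLeft_apply, ← mul_assoc]
      congr 1
      exact he.isIdempotentElem
    rw [← h1, mul_comm_of_le hg he hge]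
  have hsa : ∀ y : E, IsSelfAdjoint y → g * y = y → y * g = y → ∃ c : ℂ, y = c • g := by
    intro y hy h1 h2
    by_cases hy0 : y = 0
    · exact ⟨0, by simp [hy0]⟩
    obtain ⟨c, hc, hc0⟩ : ∃ c ∈ spectrum ℝ y, c ≠ 0 := by
      by_contra! hcon
      apply hy0
      rw [← cfc_id ℝ y hy, ← cfc_zero ℝ y]
      exact cfc_congr fun x hx => by simp [hcon x hx]
    have he := mul_specProj_singleton hy c
    have hge : g * specProj y {c} = specProj y {c} := by
      have : specProj y {c} = c⁻¹ • (y * specProj y {c}) := by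
        rw [he, smul_smul, inv_mul_cancel₀ hc0, one_smul]
      rw [this, mul_smul_comm, ← mul_assoc, h1]
    have heg := hmin _ (specProj_isStarProjection y {c}) (specProj_ne_zero hy hc) hge
    rw [heg, h2] at he
    exact ⟨c, by rw [he]; simp⟩
  refine ⟨g, ⟨hg, hg0, fun x => ?_⟩, hqg⟩
  have gg : g * g = g := hg.isIdempotentElem
  have gs : star g = g := hg.isSelfAdjoint
  have key : ∀ z : selfAdjoint E, ∃ c : ℂ, g * z * g = c • g := by
    intro z
    refine hsa _ ?_ ?_ ?_
    · change star _ = _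
      rw [star_mul, star_mul, gs, z.2.star_eq, mul_assoc]
    · rw [← mul_assoc, ← mul_assoc, gg]
    · rw [mul_assoc, gg]
  obtain ⟨c, hc⟩ := key (realPart x)
  obtain ⟨d, hd⟩ := key (imaginaryPart x)
  refine ⟨c + Complex.I * d, ?_⟩
  conv_lhs => rw [← realPart_add_I_smul_imaginaryPart x]
  rw [mul_add, add_mul, hc, mul_smul_comm, smul_mul_assoc, hd, add_smul, smul_smul]

end FiniteDim

/-! ### Ranks of projections and comparison in finite dimensions. -/

section CornerTrace

variable {E : Type*} [CStarAlgebra E]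

/-- The endomorphism `x ↦ y x g` of `E`. -/
noncomputable def twoSidedMul (g y : E) : Module.End ℂ E :=
  LinearMap.mul ℂ E y * LinearMap.mulRight ℂ g

theorem twoSidedMul_apply (g y x : E) : twoSidedMul g y x = y * (x * g) := rfl

/-- The tracial functional `y ↦ Tr (x ↦ y x g)`. -/
noncomputable def cornerTrace (g : E) : E →ₗ[ℂ] ℂ where
  toFun y := LinearMap.trace ℂ E (twoSidedMul g y)
  map_add' x y := by simp [twoSidedMul, add_mul]
  map_smul' c x := by simp [twoSidedMul]

theorem cornerTrace_mul_comm (g x y : E) : cornerTrace g (x * y) = cornerTrace g (y * x) := by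
  change LinearMap.trace ℂ E (twoSidedMul g (x * y)) = LinearMap.trace ℂ E (twoSidedMul g (y * x))
  have h1 : twoSidedMul g (x * y) = LinearMap.mul ℂ E x * twoSidedMul g y := by
    ext z; simp [twoSidedMul, mul_assoc]
  have h2 : twoSidedMul g (y * x) = twoSidedMul g y * LinearMap.mul ℂ E x := by
    ext z; simp [twoSidedMul, mul_assoc]
  rw [h1, h2, LinearMap.trace_mul_comm]

/-- The dimension of `qEg`. -/
noncomputable def cornerRank (g q : E) : ℕ :=
  Module.finrank ℂ (LinearMap.range (twoSidedMul g q))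

variable [FiniteDimensional ℂ E]

/-- The map x ↦ qxg is idempotent, so its trace is the dimension of its range. Linearity and
traciality of `cornerTrace` thereby make the rank additive and invariant under equivalence. -/
theorem cornerTrace_eq_rank {g q : E} (hg : IsStarProjection g) (hq : IsStarProjection q) :
    cornerTrace g q = cornerRank g q := by
  have gg : g * g = g := hg.isIdempotentElem
  have qq : q * q = q := hq.isIdempotentElem
  refine (LinearMap.IsIdempotentElem.isProj_range (twoSidedMul g q) ?_).trace
  ext x
  simp only [Module.End.mul_apply, twoSidedMul_apply]
  rw [mul_assoc, mul_assoc, gg, ← mul_assoc, qq]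

theorem cornerRank_eq_of_equiv {g p q : E} (hg : IsStarProjection g) (hp : IsStarProjection p)
    (hq : IsStarProjection q) (h : ProjEquiv p q) : cornerRank g p = cornerRank g q := by
  obtain ⟨v, h1, h2⟩ := h
  have : (cornerRank g p : ℂ) = cornerRank g q := by
    rw [← cornerTrace_eq_rank hg hp, ← cornerTrace_eq_rank hg hq, ← h1, ← h2,
      cornerTrace_mul_comm]
  exact_mod_cast this

theorem cornerRank_add_sub {g p q : E} (hg : IsStarProjection g) (hp : IsStarProjection p)
    (hq : IsStarProjection q) (h : p * q = q) :
    cornerRank g q + cornerRank g (p - q) = cornerRank g p := by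
  have : (cornerRank g q : ℂ) + cornerRank g (p - q) = cornerRank g p := by
    rw [← cornerTrace_eq_rank hg hp, ← cornerTrace_eq_rank hg hq,
      ← cornerTrace_eq_rank hg (isStarProjection_sub_of_le hp hq h), map_sub]
    ring
  exact_mod_cast this

theorem cornerRank_pos {g q x : E} (h : q * (x * g) ≠ 0) : 0 < cornerRank g q := by
  rw [cornerRank, Module.finrank_pos_iff_exists_ne_zero]
  exact ⟨⟨_, x, rfl⟩, fun h0 => h (congrArg Subtype.val h0)⟩

theorem exists_ne_zero_of_cornerRank_pos {g q : E} (h : 0 < cornerRank g q) :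
    ∃ x, q * x * g ≠ 0 := by
  rw [cornerRank, Module.finrank_pos_iff_exists_ne_zero] at h
  obtain ⟨⟨_, x, rfl⟩, hx⟩ := h
  refine ⟨x, fun h0 => hx (Subtype.ext ?_)⟩
  rw [mul_assoc] at h0
  exact h0

theorem cornerRank_self_pos {f q : E} (hf : IsStarProjection f) (hf0 : f ≠ 0) (h : q * f = f) :
    0 < cornerRank f q := by
  have ff : f * f = f := hf.isIdempotentElem
  exact cornerRank_pos (x := f) (by rwa [ff, h])

/-- The spectral decomposition writes y*y as a non-negative combination of projections, whose traces
are ranks. -/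
theorem cornerTrace_star_mul_self_nonneg {g : E} (hg : IsStarProjection g) (y : E) :
    0 ≤ cornerTrace g (star y * y) := by
  rw [eq_sum_specProj (IsSelfAdjoint.star_mul_self y), map_sum]
  refine Finset.sum_nonneg fun c hc => ?_
  have hc' := spectrum_star_mul_self_nonneg c ((finite_spectrum _).mem_toFinset.1 hc)
  rw [← Complex.coe_smul, map_smul, cornerTrace_eq_rank hg (specProj_isStarProjection _ _),
    smul_eq_mul]
  exact mul_nonneg (by exact_mod_cast hc') (by exact_mod_cast Nat.zero_le _)

/-- Comparison of projections by their ranks. -/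
theorem projLE_of_cornerRank_le {p q : E} (hp : IsStarProjection p) (hq : IsStarProjection q)
    (h : ∀ g, IsMinProj g → cornerRank g q ≤ cornerRank g p) : ProjLE q p := by
  induction hn : cornerRank 1 q using Nat.strong_induction_on generalizing p q with
  | _ n ih =>
  by_cases hq0 : q = 0
  · exact ⟨0, by simp [hq0]⟩
  -- Greedy induction on dim qE. The rank inequality at f forces pEf ≠ 0, so some v carries f to a
  -- projection below p. Removing f from q and vv* from p lowers the ranks on both sides equally, so
  -- the hypothesis persists.
  obtain ⟨f, hf, hqf⟩ := exists_isMinProj_le hq hq0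
  obtain ⟨x, hx⟩ := exists_ne_zero_of_cornerRank_pos
    ((cornerRank_self_pos hf.proj hf.ne_zero hqf).trans_le (h f hf))
  obtain ⟨v, c, -, hv, hpv⟩ := hf.projLE hp hx
  have hf' := isStarProjection_mul_star hf.proj hv
  have hpf' : p * (v * star v) = v * star v := by rw [← mul_assoc, hpv]
  have hlt : cornerRank 1 (q - f) < n := by
    have h1 := cornerRank_add_sub (IsStarProjection.one E) hq hf.proj hqf
    have h2 : 0 < cornerRank 1 f := by
      refine cornerRank_pos (x := 1) ?_
      simpa using hf.ne_zero
    omega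
  obtain ⟨w, hw, hpw⟩ := ih _ hlt (isStarProjection_sub_of_le hp hf' hpf')
    (isStarProjection_sub_of_le hq hf.proj hqf) (fun g hg => by
      have h1 := cornerRank_add_sub hg.proj hq hf.proj hqf
      have h2 := cornerRank_add_sub hg.proj hp hf' hpf'
      have h3 := cornerRank_eq_of_equiv hg.proj hf.proj hf' ⟨v, hv, rfl⟩
      have h4 := h g hg
      omega) rfl
  have hvp : star v * p = star v := by
    have := congrArg star hpv
    rwa [star_mul, hp.isSelfAdjoint.star_eq] at this
  have hvf : v * f = v := mul_eq_self_of_star_mul_self hf.proj hv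
  have hfv : f * star v = star v := by
    have := congrArg star hvf
    rwa [star_mul, hf.proj.isSelfAdjoint.star_eq] at this
  have hvw : star v * w = 0 := by
    rw [← hpw, ← mul_assoc, mul_sub, hvp, ← mul_assoc, hv, hfv, sub_self, zero_mul]
  have hwv : star w * v = 0 := by
    have := congrArg star hvw
    rwa [star_mul, star_star, star_zero] at this
  refine ⟨v + w, ?_, ?_⟩
  · rw [star_add, add_mul, mul_add, mul_add, hv, hw, hvw, hwv]
    abel
  · have : p * w = w := by
      rw [← hpw, ← mul_assoc, mul_sub, hpf']
      congr 2
      exact hp.isIdempotentElem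
    rw [mul_add, hpv, this]

/-- Comparison gives v with v*v = p and vv* ≤ q. A nonzero remainder q - vv* would dominate a
minimal g and have positive rank at g, while equality of ranks makes that rank zero. -/
theorem projEquiv_of_cornerRank_eq {p q : E} (hp : IsStarProjection p) (hq : IsStarProjection q)
    (h : ∀ g, IsMinProj g → cornerRank g p = cornerRank g q) : ProjEquiv p q := by
  obtain ⟨v, hv, hqv⟩ := projLE_of_cornerRank_le hq hp fun g hg => (h g hg).le
  have hf := isStarProjection_mul_star hp hv
  have hqf : q * (v * star v) = v * star v := by rw [← mul_assoc, hqv]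
  refine ⟨v, hv, ?_⟩
  by_contra hne
  obtain ⟨g, hg, hgl⟩ := exists_isMinProj_le (isStarProjection_sub_of_le hq hf hqf)
    (fun h0 => hne (sub_eq_zero.1 h0).symm)
  have h1 := cornerRank_self_pos hg.proj hg.ne_zero hgl
  have h2 := cornerRank_add_sub hg.proj hq hf hqf
  have h3 := cornerRank_eq_of_equiv hg.proj hp hf ⟨v, hv, rfl⟩
  have h4 := h g hg
  omega

end CornerTrace

/-! ### Perturbation of projections and partial isometries. -/

section Perturbation

variable {B : Type*} [CStarAlgebra B]

/-- Projections at distance less than `1` are unitarily equivalent. -/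
theorem exists_unitary_of_norm_sub_lt_one {p q : B} (hp : IsStarProjection p)
    (hq : IsStarProjection q) (h : ‖p - q‖ < 1) :
    ∃ u : B, star u * u = 1 ∧ u * star u = 1 ∧ u * p = q * u := by
  have pp : p * p = p := hp.isIdempotentElem
  have ps : star p = p := hp.isSelfAdjoint
  have qq : q * q = q := hq.isIdempotentElem
  have qs : star q = q := hq.isSelfAdjoint
  set d := p - q with hd
  -- This element intertwines p and q, and z*z = zz* = 1 - (p - q)², which is invertible since ‖p -
  -- q‖ < 1. The unitary is the polar part of z, namely z times the inverse square root of z*z.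
  set z := q * p + (1 - q) * (1 - p) with hz
  have zs : star z = p * q + (1 - p) * (1 - q) := by
    simp [hz, ps, qs]
  set k := 1 - d * d with hk
  have e1 : star z * z = k := by
    rw [zs, hz, hk, hd]
    have : (p * q + (1 - p) * (1 - q)) * (q * p + (1 - q) * (1 - p))
      = p * (q * q) * p + p * (q - q * q) * (1 - p) + (1 - p) * (q - q * q) * p
        + (1 - p) * ((1 - q) * (1 - q)) * (1 - p) := by noncomm_ring
    rw [this]
    have h2 : (1 - q) * (1 - q) = 1 - q := by
      rw [sub_mul, one_mul, mul_sub, mul_one, qq]; abel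
    rw [qq, h2, sub_self]
    have : p * q * p + p * 0 * (1 - p) + (1 - p) * 0 * p + (1 - p) * (1 - q) * (1 - p)
      = 1 - p - p + p * p - q + q * p + p * q := by noncomm_ring
    rw [this]
    have : 1 - (p - q) * (p - q) = 1 - p * p + p * q + q * p - q * q := by noncomm_ring
    rw [this, pp, qq]
    abel
  have e2 : z * star z = k := by
    rw [zs, hz, hk, hd]
    have : (q * p + (1 - q) * (1 - p)) * (p * q + (1 - p) * (1 - q))
      = q * (p * p) * q + q * (p - p * p) * (1 - q) + (1 - q) * (p - p * p) * q
        + (1 - q) * ((1 - p) * (1 - p)) * (1 - q) := by noncomm_ring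
    rw [this]
    have h2 : (1 - p) * (1 - p) = 1 - p := by
      rw [sub_mul, one_mul, mul_sub, mul_one, pp]; abel
    rw [pp, h2, sub_self]
    have : q * p * q + q * 0 * (1 - q) + (1 - q) * 0 * q + (1 - q) * (1 - p) * (1 - q)
      = 1 - q - q + q * q - p + p * q + q * p := by noncomm_ring
    rw [this]
    have : 1 - (p - q) * (p - q) = 1 - p * p + p * q + q * p - q * q := by noncomm_ring
    rw [this, pp, qq]
    abel
  have ksa : IsSelfAdjoint k := by rw [← e1]; exact IsSelfAdjoint.star_mul_self z
  have kpos : ∀ x ∈ spectrum ℝ k, 0 < x := by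
    intro x hx
    refine lt_of_le_of_ne (spectrum_star_mul_self_nonneg (b := z) x (by rwa [e1])) ?_
    rintro rfl
    refine (spectrum.zero_notMem_iff ℝ).2 ?_ hx
    refine isUnit_one_sub_of_norm_lt_one ((norm_mul_le d d).trans_lt ?_)
    nlinarith [norm_nonneg d]
  have zp : z * p = q * z := by
    have : z * p = q * (p * p) + (1 - q) * (p - p * p) := by rw [hz]; noncomm_ring
    rw [this, pp]
    have : q * z = (q * q) * p + (q - q * q) * (1 - p) := by rw [hz]; noncomm_ring
    rw [this, qq]
    simp
  have kp : Commute k p := by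
    have h1 : p * star z = star z * q := by
      have := congrArg star zp
      rwa [star_mul, star_mul, ps, qs] at this
    change k * p = p * k
    rw [← e1, mul_assoc, zp, ← mul_assoc, ← mul_assoc, h1]
  have kz : Commute k z := by
    change k * z = z * k
    conv_lhs => rw [← e2, mul_assoc, e1]
  have hcont : ContinuousOn (fun x : ℝ => (√x)⁻¹) (spectrum ℝ k) :=
    (Real.continuous_sqrt.continuousOn).inv₀ fun x hx => (Real.sqrt_pos.2 (kpos x hx)).ne'
  set c := cfc (fun x : ℝ => (√x)⁻¹) k with hc
  have cs : star c = c := cfc_predicate (R := ℝ) (p := IsSelfAdjoint) _ k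
  have ck : Commute c k := IsSelfAdjoint.commute_cfc ksa (Commute.refl k) _
  have cp : Commute c p := IsSelfAdjoint.commute_cfc ksa kp _
  have cz : Commute c z := IsSelfAdjoint.commute_cfc ksa kz _
  have cck : c * c * k = 1 := by
    rw [hc]
    conv_lhs => rw [← cfc_mul _ _ k hcont hcont]
    nth_rewrite 2 [← cfc_id ℝ k ksa]
    rw [← cfc_mul (fun x => (√x)⁻¹ * (√x)⁻¹) id k (hcont.mul hcont) continuousOn_id,
      ← cfc_one ℝ k ksa]
    refine cfc_congr fun x hx => ?_
    have hx := kpos x hx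
    have := Real.sq_sqrt hx.le
    have h2 := Real.sqrt_pos.2 hx
    simp only [id, Pi.one_apply]
    rw [← mul_inv, Real.mul_self_sqrt hx.le, inv_mul_cancel₀ hx.ne']
  refine ⟨z * c, ?_, ?_, ?_⟩
  · rw [star_mul, cs, show c * star z * (z * c) = c * (star z * z) * c by simp only [mul_assoc], e1,
      mul_assoc, ← ck.eq, ← mul_assoc, cck]
  · rw [star_mul, cs, show z * c * (c * star z) = z * (c * c) * star z by simp only [mul_assoc],
      ← (cz.mul_left cz).eq, mul_assoc, e2, cck]
  · rw [mul_assoc, cp.eq, ← mul_assoc, zp, mul_assoc]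

theorem ProjEquiv.of_unitary {p q u : B} (hp : IsStarProjection p)
    (hu : star u * u = 1) (hu' : u * star u = 1) (h : u * p = q * u) : ProjEquiv p q := by
  have pp : p * p = p := hp.isIdempotentElem
  refine ⟨u * p, ?_, ?_⟩
  · rw [star_mul, hp.isSelfAdjoint.star_eq, mul_assoc, ← mul_assoc (star u), hu, one_mul, pp]
  · rw [star_mul, hp.isSelfAdjoint.star_eq,
      show u * p * (p * star u) = u * (p * p) * star u by simp only [mul_assoc], pp, h, mul_assoc,
      hu', mul_one]

theorem ProjEquiv.add {p p' q q' : B} (hp : IsStarProjection p) (hp' : IsStarProjection p')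
    (hq : IsStarProjection q) (hq' : IsStarProjection q') (h0 : p * p' = 0) (h0' : q * q' = 0)
    (h : ProjEquiv p q) (h' : ProjEquiv p' q') : ProjEquiv (p + p') (q + q') := by
  obtain ⟨v, h1, h2⟩ := h
  obtain ⟨w, h3, h4⟩ := h'
  have a1 := mul_eq_self_of_star_mul_self hp h1
  have a2 := mul_eq_self_of_mul_star hq h2
  have a3 := mul_eq_self_of_star_mul_self hp' h3
  have a4 := mul_eq_self_of_mul_star hq' h4
  have b1 : star v * w = 0 := by
    rw [← a2, ← a4, star_mul, hq.isSelfAdjoint.star_eq,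
      show star v * q * (q' * w) = star v * (q * q') * w by simp only [mul_assoc], h0']
    simp
  have b2 : v * star w = 0 := by
    rw [← a1, ← a3, star_mul, hp'.isSelfAdjoint.star_eq,
      show v * p * (p' * star w) = v * (p * p') * star w by simp only [mul_assoc], h0]
    simp
  have b3 : star w * v = 0 := by simpa using congrArg star b1
  have b4 : w * star v = 0 := by simpa using congrArg star b2
  refine ⟨v + w, ?_, ?_⟩
  · rw [star_add, add_mul, mul_add, mul_add, h1, h3, b1, b3]; abel
  · rw [star_add, add_mul, mul_add, mul_add, h2, h4, b2, b4]; abel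

variable {E : Type*} [CStarAlgebra E] [FiniteDimensional ℂ E]

/-- An almost idempotent selfadjoint element is close to a projection. -/
theorem exists_isStarProjection_near {y : E} (hy : IsSelfAdjoint y) {η : ℝ}
    (hη : ‖y * y - y‖ ≤ η) : ∃ p : E, IsStarProjection p ∧ ‖p - y‖ ≤ 2 * η := by
  have hη0 : 0 ≤ η := (norm_nonneg _).trans hη
  refine ⟨specProj y (Set.Ici (1 / 2)), specProj_isStarProjection _ _, ?_⟩
  have h1 : specProj y (Set.Ici (1 / 2)) - y
      = cfc (fun x => (Set.Ici (1 / 2)).indicator (1 : ℝ → ℝ) x - id x) y := by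
    rw [cfc_sub _ _ y (continuousOn_spectrum _ _) (continuousOn_spectrum _ _), cfc_id ℝ y hy]
    rfl
  have h2 : y * y - y = cfc (fun x : ℝ => id x * id x - id x) y := by
    rw [cfc_sub _ _ y (continuousOn_spectrum _ _) (continuousOn_spectrum _ _),
      cfc_mul _ _ y (continuousOn_spectrum _ _) (continuousOn_spectrum _ _), cfc_id ℝ y hy]
  rw [h1]
  refine norm_cfc_le (by positivity) fun x hx => ?_
  have h3 := (norm_apply_le_norm_cfc (fun x : ℝ => id x * id x - id x) y hx
    (continuousOn_spectrum _ _) hy).trans (h2 ▸ hη)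
  simp only [id, Real.norm_eq_abs] at h3 ⊢
  rw [abs_le] at h3
  -- In |x| |x - 1| ≤ η one factor is at least 1/2, so the other is at most 2η.
  by_cases hx2 : 1 / 2 ≤ x
  · rw [Set.indicator_of_mem (Set.mem_Ici.2 hx2), Pi.one_apply, abs_le]
    constructor <;> nlinarith
  · rw [Set.indicator_of_notMem (by simpa using hx2), abs_le]
    constructor <;> nlinarith

/-- Left multiplication by qxp maps pEg injectively into qEg: if it kills y = py, then y = -v*(x -
v)y inside the larger algebra, and ‖x - v‖ < 1 forces y = 0. -/
theorem cornerRank_le_of_norm_sub_lt_one (ι : E →⋆ₐ[ℂ] B) (hι : Function.Injective ι) {p q x : E}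
    {v : B} (hp : IsStarProjection p) (hv : star v * v = ι p) (hv' : v * star v = ι q)
    (hq : IsStarProjection q) (hx : ‖ι x - v‖ < 1) (g : E) :
    cornerRank g p ≤ cornerRank g q := by
  have hιp : IsStarProjection (ι p) := hp.map ι
  have hιq : IsStarProjection (ι q) := hq.map ι
  have vp : v * ι p = v := mul_eq_self_of_star_mul_self hιp hv
  have qv : ι q * v = v := mul_eq_self_of_mul_star hιq hv'
  have pp : p * p = p := hp.isIdempotentElem
  have hvn : ‖star v‖ ≤ 1 := by
    have h1 := CStarRing.norm_star_mul_self (x := v)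
    rw [hv] at h1
    have h2 := IsStarProjection.norm_le _ hιp
    rw [norm_star]
    nlinarith [norm_nonneg v]
  have hmap : ∀ y ∈ LinearMap.range (twoSidedMul g p), LinearMap.mulLeft ℂ (q * x * p) y ∈
      LinearMap.range (twoSidedMul g q) := by
    rintro _ ⟨y, rfl⟩
    refine ⟨x * p * y, ?_⟩
    simp only [twoSidedMul_apply, LinearMap.mulLeft_apply, mul_assoc]
    rw [← mul_assoc p p, pp]
  refine LinearMap.finrank_le_finrank_of_injective
    (f := (LinearMap.mulLeft ℂ (q * x * p)).restrict hmap) ?_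
  rw [← LinearMap.ker_eq_bot, LinearMap.ker_eq_bot']
  rintro ⟨_, y, rfl⟩ h0
  have h0 : q * x * p * (p * (y * g)) = 0 := congrArg Subtype.val h0
  refine Subtype.ext ?_
  change p * (y * g) = 0
  set y' := p * (y * g)
  have hpy : p * y' = y' := by simp only [y', ← mul_assoc, pp]
  have hy : ι y' = - (star v * (ι x - v) * ι y') := by
    have e1 : star v * ι x * ι y' = 0 := by
      have e3 : star v * ι q = star v := by
        have := congrArg star qv
        rwa [star_mul, hιq.isSelfAdjoint.star_eq] at this
      calc star v * ι x * ι y' = star v * ι q * ι x * (ι p * ι y') := by rw [e3, ← map_mul, hpy]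
        _ = star v * ι (q * x * p * y') := by simp only [map_mul, mul_assoc]
        _ = 0 := by rw [h0, map_zero, mul_zero]
    rw [mul_sub, sub_mul, e1, hv, ← map_mul, hpy]
    simp
  have hn : ‖ι y'‖ ≤ ‖ι x - v‖ * ‖ι y'‖ := by
    conv_lhs => rw [hy, norm_neg]
    calc _ ≤ ‖star v‖ * ‖ι x - v‖ * ‖ι y'‖ :=
          (norm_mul_le _ _).trans (mul_le_mul_of_nonneg_right (norm_mul_le _ _) (norm_nonneg _))
      _ ≤ 1 * ‖ι x - v‖ * ‖ι y'‖ := by gcongr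
      _ = _ := by rw [one_mul]
  have : ‖ι y'‖ = 0 := by
    by_contra hne
    have : 0 < ‖ι y'‖ := lt_of_le_of_ne (norm_nonneg _) (Ne.symm hne)
    nlinarith
  rw [norm_eq_zero, map_eq_zero_iff ι hι] at this
  exact this

/-- A partial isometry which is approximated by elements of a finite-dimensional algebra can be
replaced by one in that algebra. -/
theorem projEquiv_of_norm_sub_lt_one (ι : E →⋆ₐ[ℂ] B) (hι : Function.Injective ι) {p q x : E}
    {v : B} (hp : IsStarProjection p) (hq : IsStarProjection q) (hv : star v * v = ι p)
    (hv' : v * star v = ι q) (hx : ‖ι x - v‖ < 1) : ProjEquiv p q := by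
  refine projEquiv_of_cornerRank_eq hp hq fun g _ => le_antisymm
    (cornerRank_le_of_norm_sub_lt_one ι hι hp hv hv' hq hx g)
    (cornerRank_le_of_norm_sub_lt_one (x := star x) ι hι hq (v := star v) (by rwa [star_star])
      (by rwa [star_star]) hp ?_ g)
  rwa [map_star, ← star_sub, norm_star]

/-- The rank of a projection and that of its complement add up to the rank of 1, so ranks determine
the complements up to equivalence. -/
theorem ProjEquiv.one_sub_of_finiteDimensional {p q : E} (hp : IsStarProjection p)
    (hq : IsStarProjection q) (h : ProjEquiv p q) : ProjEquiv (1 - p) (1 - q) := by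
  refine projEquiv_of_cornerRank_eq hp.one_sub hq.one_sub fun g hg => ?_
  have h1 := cornerRank_add_sub hg.proj (IsStarProjection.one E) hp (one_mul p)
  have h2 := cornerRank_add_sub hg.proj (IsStarProjection.one E) hq (one_mul q)
  have h3 := cornerRank_eq_of_equiv hg.proj hp hq h
  omega

end Perturbation

/-! ### AF-algebras -/

section AF

variable {B : Type*} [CStarAlgebra B]

/-- `F` is an increasing sequence of finite-dimensional ⋆-subalgebras with dense union. -/
structure IsAFChain (F : ℕ → StarSubalgebra ℂ B) : Prop where
  mono : Monotone F
  finite : ∀ n, FiniteDimensional ℂ (F n)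
  dense : Dense (⋃ n, (F n : Set B))

/-- Closedness makes the subalgebra a C⋆-algebra in its own right, so the finite-dimensional results
apply to each stage. -/
theorem isClosed_of_finiteDimensional (S : StarSubalgebra ℂ B) (h : FiniteDimensional ℂ S) :
    IsClosed (S : Set B) :=
  have : FiniteDimensional ℂ S.toSubalgebra.toSubmodule := h
  Submodule.closed_of_finiteDimensional S.toSubalgebra.toSubmodule

variable {F : ℕ → StarSubalgebra ℂ B}

theorem IsAFChain.exists_near (hF : IsAFChain F) (x : B) {ε : ℝ} (hε : 0 < ε) (N : ℕ) :
    ∃ n, N ≤ n ∧ ∃ y ∈ F n, ‖y - x‖ < ε := by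
  obtain ⟨y, hy, hxy⟩ := Metric.dense_iff.1 hF.dense x ε hε
  obtain ⟨n, hn⟩ := Set.mem_iUnion.1 hxy
  refine ⟨max N n, le_max_left _ _, y, hF.mono (le_max_right N n) hn, ?_⟩
  rw [← dist_eq_norm]
  exact hy

/-- Every projection of an AF-algebra is unitarily equivalent to one in the dense union. -/
theorem IsAFChain.exists_unitary_conj (hF : IsAFChain F) {p : B} (hp : IsStarProjection p) :
    ∃ n, ∃ q ∈ F n, IsStarProjection q ∧
      ∃ u : B, star u * u = 1 ∧ u * star u = 1 ∧ u * p = q * u := by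
  -- The self-adjoint part y of x is still within 1/16 of p, so ‖y² - y‖ ≤ 3/16 + 1/256 ≤ 1/5. The
  -- projection q near y is then at distance at most 2/5 + 1/16 < 1 from p.
  obtain ⟨n, -, x, hx, hxp⟩ := hF.exists_near p (ε := 1 / 16) (by norm_num) 0
  have := hF.finite n
  have hcl := isClosed_of_finiteDimensional (F n) this
  set x' : F n := ⟨x, hx⟩
  set y : F n := ((1 / 2 : ℝ) : ℂ) • (x' + star x') with hy
  have pp : p * p = p := hp.isIdempotentElem
  have hysa : IsSelfAdjoint y := by
    change star y = y
    rw [hy, star_smul, star_add, star_star, add_comm]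
    simp
  have hyp : ‖(y : B) - p‖ ≤ 1 / 16 := by
    have h1 : (y : B) - p = ((1 / 2 : ℝ) : ℂ) • ((x - p) + star (x - p)) := by
      have h2 : p = ((1 / 2 : ℝ) : ℂ) • (p + p) := by
        rw [← two_smul ℂ p, smul_smul]; norm_num
      conv_lhs => rw [h2]
      rw [star_sub, hp.isSelfAdjoint.star_eq]
      change ((1 / 2 : ℝ) : ℂ) • (x + star x) - _ = _
      rw [← smul_sub]
      congr 1
      abel
    rw [h1, norm_smul, Complex.norm_real]
    have h3 := norm_add_le (x - p) (star (x - p))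
    rw [norm_star] at h3
    rw [show ‖(1 / 2 : ℝ)‖ = 1 / 2 by norm_num]
    linarith
  have hyy : ‖y * y - y‖ ≤ 1 / 5 := by
    change ‖(y : B) * y - y‖ ≤ 1 / 5
    set d := (y : B) - p with hd
    have h1 : (y : B) * y - y = d * d + p * d + d * p - d := by
      have : (y : B) = d + p := by rw [hd]; abel
      rw [this]
      have : (d + p) * (d + p) - (d + p) = d * d + p * d + d * p - d + (p * p - p) := by
        noncomm_ring
      rw [this, pp, sub_self, add_zero]
    have hpn := IsStarProjection.norm_le _ hp
    have a1 := norm_mul_le d d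
    have a2 := norm_mul_le p d
    have a3 := norm_mul_le d p
    have a4 := norm_sub_le (d * d + p * d + d * p) d
    have a5 := norm_add_le (d * d + p * d) (d * p)
    have a6 := norm_add_le (d * d) (p * d)
    rw [h1]
    nlinarith [norm_nonneg d, norm_nonneg p]
  obtain ⟨q, hq, hqy⟩ := exists_isStarProjection_near hysa hyy
  have hqB : IsStarProjection (q : B) := hq.map (F n).subtype
  refine ⟨n, q, q.2, hqB, exists_unitary_of_norm_sub_lt_one hp hqB ?_⟩
  have h1 : ‖(q : B) - y‖ ≤ 2 * (1 / 5) := hqy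
  have h2 := norm_sub_le_norm_sub_add_norm_sub p (y : B) q
  rw [norm_sub_rev p (y : B), norm_sub_rev (y : B) q] at h2
  linarith

theorem isStarProjection_coe_iff {S : StarSubalgebra ℂ B} {p : S} :
    IsStarProjection (p : B) ↔ IsStarProjection p :=
  ⟨fun h => ⟨Subtype.ext h.isIdempotentElem, Subtype.ext h.isSelfAdjoint⟩,
    fun h => h.map S.subtype⟩

/-- Projections of the dense union which are equivalent in an AF-algebra are equivalent at some
finite stage. -/
theorem IsAFChain.exists_projEquiv (hF : IsAFChain F) {n : ℕ} {p q : B} (hpn : p ∈ F n)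
    (hqn : q ∈ F n) (hp : IsStarProjection p) (hq : IsStarProjection q) (h : ProjEquiv p q) :
    ∃ m, ∃ (hpm : p ∈ F m) (hqm : q ∈ F m),
      ProjEquiv (⟨p, hpm⟩ : F m) ⟨q, hqm⟩ := by
  obtain ⟨v, hv, hv'⟩ := h
  obtain ⟨m, hnm, x, hx, hxv⟩ := hF.exists_near v (ε := 1) one_pos n
  have := hF.finite m
  have hcl := isClosed_of_finiteDimensional (F m) this
  refine ⟨m, hF.mono hnm hpn, hF.mono hnm hqn, ?_⟩
  exact projEquiv_of_norm_sub_lt_one (F m).subtype Subtype.val_injective (x := ⟨x, hx⟩) (v := v)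
    (isStarProjection_coe_iff.1 hp) (isStarProjection_coe_iff.1 hq) hv hv' hxv

theorem ProjEquiv.coe {S : StarSubalgebra ℂ B} {p q : S} (h : ProjEquiv p q) :
    ProjEquiv (p : B) (q : B) := by
  obtain ⟨v, h1, h2⟩ := h
  exact ⟨v, congrArg Subtype.val h1, congrArg Subtype.val h2⟩

theorem one_sub_conj {p q u : B} (h : u * p = q * u) : u * (1 - p) = (1 - q) * u := by
  rw [mul_sub, sub_mul, h, mul_one, one_mul]

/-- Unitaries move p and q into finite stages and their complements along with them. The equivalence
is realized at a common finite stage, where complements of equivalent projections are equivalent. -/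
theorem IsAFChain.projEquiv_one_sub (hF : IsAFChain F) {p q : B} (hp : IsStarProjection p)
    (hq : IsStarProjection q) (h : ProjEquiv p q) : ProjEquiv (1 - p) (1 - q) := by
  obtain ⟨n, p', hp'n, hp', u, hu, hu', hup⟩ := hF.exists_unitary_conj hp
  obtain ⟨k, q', hq'k, hq', w, hw, hw', hwq⟩ := hF.exists_unitary_conj hq
  have h1 : ProjEquiv p' q' :=
    ((ProjEquiv.of_unitary hp hu hu' hup).symm.trans hp' hq h).trans hp' hq'
      (ProjEquiv.of_unitary hq hw hw' hwq)
  obtain ⟨m, hpm, hqm, hm⟩ := hF.exists_projEquiv (hF.mono (le_max_left n k) hp'n)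
    (hF.mono (le_max_right n k) hq'k) hp' hq' h1
  have := hF.finite m
  have hcl := isClosed_of_finiteDimensional (F m) this
  have h2 := (hm.one_sub_of_finiteDimensional (isStarProjection_coe_iff.1 hp')
    (isStarProjection_coe_iff.1 hq')).coe
  exact ((ProjEquiv.of_unitary hp.one_sub hu hu' (one_sub_conj hup)).trans hp.one_sub
    hq'.one_sub h2).trans hp.one_sub hq.one_sub
      (ProjEquiv.of_unitary hq.one_sub hw hw' (one_sub_conj hwq)).symm

/-- Cancellation of projections in an AF-algebra. -/
theorem IsAFChain.cancel (hF : IsAFChain F) {p q r s : B} (hp : IsStarProjection p)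
    (hq : IsStarProjection q) (hr : IsStarProjection r) (hs : IsStarProjection s)
    (hpr : p * r = 0) (hqs : q * s = 0) (h : ProjEquiv (p + r) (q + s)) (h' : ProjEquiv r s) :
    ProjEquiv p q := by
  have hpr' := hp.add hr hpr
  have hqs' := hq.add hs hqs
  -- Complement twice: adding r ~ s to 1 - (p + r) ~ 1 - (q + s) gives 1 - p ~ 1 - q, and
  -- complementing again gives p ~ q.
  have h1 := hF.projEquiv_one_sub hpr' hqs' h
  have e : ∀ {a b : B}, IsStarProjection b → a * b = 0 → (1 - (a + b)) * b = 0 := by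
    intro a b hb hab
    have bb : b * b = b := hb.isIdempotentElem
    rw [sub_mul, add_mul, hab, bb]; simp
  have h2 := h1.add hpr'.one_sub hr hqs'.one_sub hs (e hr hpr) (e hs hqs) h'
  have e2 : ∀ a b : B, 1 - (a + b) + b = 1 - a := fun a b => by abel
  rw [e2, e2] at h2
  have h3 := hF.projEquiv_one_sub hp.one_sub hq.one_sub h2
  rwa [sub_sub_cancel, sub_sub_cancel] at h3

end AF

/-! ### Tracial states and comparison in AF-algebras. -/

section States

variable {B : Type*} [CStarAlgebra B]

/-- A positive functional `f` satisfies `|f a| ≤ ‖a‖ f 1`. -/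
theorem norm_apply_le_of_positive (f : B →ₗ[ℂ] ℂ) (hf : ∀ x, 0 ≤ f (star x * x)) (a : B) :
    ‖f a‖ ≤ ‖a‖ * (f 1).re := by
  let _ := CStarAlgebra.spectralOrder B
  have := CStarAlgebra.spectralOrderedRing B
  set P : B →ₚ[ℂ] ℂ := PositiveLinearMap.mk₀ f fun x hx => by
    obtain ⟨b, rfl⟩ := CStarAlgebra.nonneg_iff_eq_star_mul_self.1 hx
    exact hf b with hP
  have hPf : ∀ x, P x = f x := fun x => rfl
  -- In the GNS space f(a) is the inner product of the vectors of 1 and a. Apply Cauchy–Schwarz,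
  -- left multiplication by a being bounded by ‖a‖.
  have h1 : inner ℂ (P.toPreGNS 1) (P.toPreGNS a) = f a := by
    rw [PositiveLinearMap.preGNS_inner_def]
    simp [hPf]
  have h2 : ‖P.toPreGNS a‖ ≤ ‖a‖ * ‖P.toPreGNS 1‖ := by
    have h3 : P.toPreGNS a = P.leftMulMapPreGNS a (P.toPreGNS 1) := by simp
    rw [h3]
    refine ((P.leftMulMapPreGNS a).le_opNorm _).trans ?_
    gcongr
    exact LinearMap.mkContinuous_norm_le _ (norm_nonneg a) _
  have h4 : ‖P.toPreGNS 1‖ ^ 2 = (f 1).re := by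
    have := P.preGNS_norm_sq (P.toPreGNS 1)
    have := congrArg Complex.re this
    rw [← Complex.ofReal_pow, Complex.ofReal_re] at this
    rw [this]
    simp [hPf]
  rw [← h1, ← h4]
  refine (norm_inner_le_norm _ _).trans ?_
  nlinarith [norm_nonneg (P.toPreGNS 1)]

theorem apply_star_mul_self_of_projEquiv (τ : traceSpace B) {p q : B} (h : ProjEquiv p q) :
    τ.1 p = τ.1 q := by
  obtain ⟨v, rfl, rfl⟩ := h
  exact τ.2 _ _

variable {F : ℕ → StarSubalgebra ℂ B}

/-- A sequence of functionals which are asymptotically tracial states on the finite stages has a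
tracial state as a cluster point. -/
theorem IsAFChain.exists_tracialState (hF : IsAFChain F) (N : ℕ) (f : ℕ → B →L[ℂ] ℂ)
    (hnorm : ∀ m x, ‖f m x‖ ≤ ‖x‖) (hone : ∀ m, f m 1 = 1)
    (hpos : ∀ m, N ≤ m → ∀ x ∈ F m, 0 ≤ f m (star x * x))
    (htr : ∀ m, N ≤ m → ∀ x ∈ F m, ∀ y ∈ F m, f m (x * y) = f m (y * x)) :
    ∃ τ ∈ tracialStates B, ∀ x, ∀ c : ℝ, (∀ m, N ≤ m → c ≤ (f m x).re) → c ≤ (τ.1 x).re := by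
  -- Limits along a free ultrafilter exist because the values at x stay in the ball of radius ‖x‖.
  -- Each element of the dense union eventually lies in the stages, so positivity and traciality
  -- hold in the limit there and extend by continuity.
  set U : Ultrafilter ℕ := Filter.hyperfilter ℕ
  have hU : ∀ n, ∀ᶠ m in (U : Filter ℕ), n ≤ m := fun n =>
    Nat.hyperfilter_le_atTop (Filter.eventually_ge_atTop n)
  have hlim : ∀ x, ∃ l : ℂ, Filter.Tendsto (fun m => f m x) U (nhds l) := by
    intro x
    obtain ⟨l, -, hl⟩ := (isCompact_closedBall (0 : ℂ) ‖x‖).ultrafilter_le_nhds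
      (U.map fun m => f m x) (by
        rw [Filter.le_principal_iff]
        exact Filter.Eventually.of_forall (f := (U : Filter ℕ)) fun m => by simpa using hnorm m x)
    exact ⟨l, hl⟩
  choose t ht using hlim
  let L : B →ₗ[ℂ] ℂ :=
    { toFun := t
      map_add' := fun x y => tendsto_nhds_unique (ht (x + y)) (by
        simpa using (ht x).add (ht y))
      map_smul' := fun c x => tendsto_nhds_unique (ht (c • x)) (by
        simpa using (ht x).const_mul c) }
  have hL : ∀ x, L x = t x := fun _ => rfl
  have hLn : ∀ x, ‖L x‖ ≤ 1 * ‖x‖ := fun x => by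
    rw [one_mul]
    exact le_of_tendsto (ht x).norm (Filter.Eventually.of_forall fun m => hnorm m x)
  let T : B →L[ℂ] ℂ := L.mkContinuous 1 hLn
  have hTt : ∀ x, T x = t x := fun _ => rfl
  have hdense : ∀ n x, x ∈ F n → ∀ᶠ m in (U : Filter ℕ), N ≤ m ∧ x ∈ F m := fun n x hx =>
    ((hU N).and (hU n)).mono fun m hm => ⟨hm.1, hF.mono hm.2 hx⟩
  have htrace : ∀ x y, T (x * y) = T (y * x) := by
    have h1 : ∀ x ∈ ⋃ n, (F n : Set B), ∀ y ∈ ⋃ n, (F n : Set B), T (x * y) = T (y * x) := by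
      intro x hx y hy
      obtain ⟨n, hn⟩ := Set.mem_iUnion.1 hx
      obtain ⟨k, hk⟩ := Set.mem_iUnion.1 hy
      refine tendsto_nhds_unique (ht (x * y)) ((ht (y * x)).congr' ?_)
      filter_upwards [hdense n x hn, hdense k y hk] with m hm hm'
      exact (htr m hm.1 x hm.2 y hm'.2).symm
    have h2 : ∀ x ∈ ⋃ n, (F n : Set B), ∀ y, T (x * y) = T (y * x) := by
      intro x hx y
      exact hF.dense.induction (P := fun y => T (x * y) = T (y * x)) (h1 x hx)
        (isClosed_eq (by fun_prop) (by fun_prop)) y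
    intro x y
    exact hF.dense.induction (P := fun x => T (x * y) = T (y * x)) (fun x hx => h2 x hx y)
      (isClosed_eq (by fun_prop) (by fun_prop)) x
  refine ⟨⟨T, htrace⟩, ⟨?_, ?_⟩, ?_⟩
  · intro x
    have hcl : IsClosed {x : B | 0 ≤ T (star x * x)} :=
      isClosed_le continuous_const (by fun_prop)
    refine hF.dense.induction (P := fun x => 0 ≤ T (star x * x)) ?_ hcl x
    intro x hx
    obtain ⟨n, hn⟩ := Set.mem_iUnion.1 hx
    refine ge_of_tendsto (ht (star x * x)) ?_
    filter_upwards [hdense n x hn] with m hm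
    exact hpos m hm.1 x hm.2
  · refine tendsto_nhds_unique (ht 1) ?_
    simp [hone]
  · intro x c hc
    refine ge_of_tendsto ((Complex.continuous_re.tendsto _).comp (ht x)) ?_
    filter_upwards [hU N] with m hm
    exact hc m hm

/-- Restricting the trace `y ↦ Tr (x ↦ y x g)` of a finite-dimensional subalgebra and extending it
to the whole algebra. -/
theorem exists_extension_cornerTrace (S : StarSubalgebra ℂ B) [FiniteDimensional ℂ S]
    [IsClosed (S : Set B)] {g : S} (hg : IsMinProj g) :
    ∃ f : B →L[ℂ] ℂ, (∀ x, ‖f x‖ ≤ ‖x‖) ∧ f 1 = 1 ∧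
      ∃ c : ℝ, 0 < c ∧ ∀ x : S, f x = c * cornerTrace g x := by
  have h1 : cornerTrace g 1 = cornerRank g 1 :=
    cornerTrace_eq_rank hg.proj (IsStarProjection.one S)
  have h2 : 0 < cornerRank g (1 : S) := cornerRank_self_pos hg.proj hg.ne_zero (one_mul g)
  have h2' : (0 : ℝ) < cornerRank g (1 : S) := by exact_mod_cast h2
  -- This constant normalizes the trace at 1. The normalized trace is positive, so its norm is at
  -- most 1, and Hahn–Banach extends it without increasing the norm.
  set c : ℝ := (cornerRank g (1 : S) : ℝ)⁻¹ with hc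
  have hbound : ∀ x : S, ‖((c : ℂ) • cornerTrace g) x‖ ≤ 1 * ‖x‖ := by
    intro x
    have h3 := norm_apply_le_of_positive (cornerTrace g) (cornerTrace_star_mul_self_nonneg hg.proj) x
    rw [LinearMap.smul_apply, norm_smul, Complex.norm_real, Real.norm_of_nonneg (by positivity),
      one_mul]
    rw [h1, Complex.natCast_re] at h3
    calc c * ‖cornerTrace g x‖ ≤ c * (‖x‖ * cornerRank g (1 : S)) := by gcongr
      _ = ‖x‖ := by rw [hc]; field_simp
  let s : StrongDual ℂ S.toSubalgebra.toSubmodule :=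
    LinearMap.mkContinuous ((c : ℂ) • cornerTrace g : S →ₗ[ℂ] ℂ) 1 hbound
  obtain ⟨f, hf, hfn⟩ := exists_extension_norm_eq S.toSubalgebra.toSubmodule s
  have hs : ‖s‖ ≤ 1 := LinearMap.mkContinuous_norm_le _ zero_le_one _
  have hfs : ∀ x : S, f x = c * cornerTrace g x := fun x => hf x
  refine ⟨f, fun x => ?_, ?_, c, by positivity, hfs⟩
  · calc ‖f x‖ ≤ ‖f‖ * ‖x‖ := f.le_opNorm x
      _ ≤ 1 * ‖x‖ := by gcongr; rw [hfn]; exact hs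
      _ = ‖x‖ := one_mul _
  · have := hfs 1
    rw [h1] at this
    refine this.trans ?_
    rw [hc]
    push_cast
    exact inv_mul_cancel₀ (by exact_mod_cast h2.ne')

/-- Comparison of projections of an AF-algebra by tracial states. -/
theorem IsAFChain.projLE_of_forall_lt (hF : IsAFChain F) {p q : B} (hp : IsStarProjection p)
    (hq : IsStarProjection q) (h : ∀ τ ∈ tracialStates B, (τ.1 q).re < (τ.1 p).re) :
    ProjLE q p := by
  obtain ⟨n, p', hp'n, hp', u, hu, hu', hup⟩ := hF.exists_unitary_conj hp
  obtain ⟨k, q', hq'k, hq', w, hw, hw', hwq⟩ := hF.exists_unitary_conj hq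
  have ep := ProjEquiv.of_unitary hp hu hu' hup
  have eq := ProjEquiv.of_unitary hq hw hw' hwq
  suffices hsuff : ProjLE q' p' by
    obtain ⟨v, hv, hpv⟩ := hsuff
    have qq : q * q = q := hq.isIdempotentElem
    have pu : p * star u = star u * p' := by
      calc p * star u = star u * (u * p) * star u := by rw [← mul_assoc, hu, one_mul]
        _ = star u * p' * (u * star u) := by rw [hup]; simp only [mul_assoc]
        _ = _ := by rw [hu', mul_one]
    refine ⟨star u * v * (w * q), ?_, ?_⟩
    · have a1 : star q * star w = star w * q' := by
        have := congrArg star hwq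
        rwa [star_mul, star_mul, hq'.isSelfAdjoint.star_eq] at this
      calc star (star u * v * (w * q)) * (star u * v * (w * q))
          = star q * star w * (star v * (u * star u) * v) * (w * q) := by
            simp only [star_mul, star_star, mul_assoc]
        _ = star q * star w * q' * (w * q) := by rw [hu', mul_one, hv]
        _ = star w * (q' * q') * (w * q) := by rw [a1]; simp only [mul_assoc]
        _ = star w * (q' * w) * q := by
            rw [show q' * q' = q' from hq'.isIdempotentElem]; simp only [mul_assoc]
        _ = star w * w * (q * q) := by rw [← hwq]; simp only [mul_assoc]
        _ = q := by rw [hw, one_mul, qq]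
    · simp only [← mul_assoc]
      rw [pu, mul_assoc (star u), hpv]
  have h' : ∀ τ ∈ tracialStates B, (τ.1 q').re < (τ.1 p').re := fun τ hτ => by
    rw [← apply_star_mul_self_of_projEquiv τ ep, ← apply_star_mul_self_of_projEquiv τ eq]
    exact h τ hτ
  by_contra hnot
  -- If q' is not below p', then at each late stage some minimal projection gives p' at most the
  -- rank of q'. The corresponding normalized traces accumulate at a tracial state τ with τ(p') ≤
  -- τ(q'), contrary to hypothesis.
  have key : ∀ m, ∃ f : B →L[ℂ] ℂ, (∀ x, ‖f x‖ ≤ ‖x‖) ∧ f 1 = 1 ∧ (max n k ≤ m →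
      (∀ x ∈ F m, 0 ≤ f (star x * x)) ∧ (∀ x ∈ F m, ∀ y ∈ F m, f (x * y) = f (y * x)) ∧
      0 ≤ (f (q' - p')).re) := by
    intro m
    have := hF.finite m
    have hcl := isClosed_of_finiteDimensional (F m) this
    have hP : ∃ g : F m, IsMinProj g ∧ ∀ hm : max n k ≤ m,
        cornerRank g ⟨p', hF.mono ((le_max_left n k).trans hm) hp'n⟩ ≤
          cornerRank g ⟨q', hF.mono ((le_max_right n k).trans hm) hq'k⟩ := by
      by_cases hm : max n k ≤ m
      · have hpm := hF.mono ((le_max_left n k).trans hm) hp'n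
        have hqm := hF.mono ((le_max_right n k).trans hm) hq'k
        by_contra! hcon
        apply hnot
        obtain ⟨v, hv, hpv⟩ := projLE_of_cornerRank_le (p := (⟨p', hpm⟩ : F m)) (q := ⟨q', hqm⟩)
          (isStarProjection_coe_iff.1 hp') (isStarProjection_coe_iff.1 hq')
          (fun g hg => ((hcon g hg).2).le)
        exact ⟨v, congrArg Subtype.val hv, congrArg Subtype.val hpv⟩
      -- Before p' and q' have both appeared, any minimal projection serves. One exists unless 1 =
      -- 0, and in that case q' = 0 lies below p' trivially.
      · have hne : (1 : F m) ≠ 0 := by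
          intro h10
          have h10' : (1 : B) = 0 := congrArg Subtype.val h10
          exact hnot ⟨0, by rw [← mul_one q', h10']; simp, by simp⟩
        obtain ⟨g, hg, -⟩ := exists_isMinProj_le (IsStarProjection.one (F m)) hne
        exact ⟨g, hg, fun h => absurd h hm⟩
    obtain ⟨g, hg, hgr⟩ := hP
    obtain ⟨f, hf1, hf2, c, hc, hfc⟩ := exists_extension_cornerTrace (F m) hg
    refine ⟨f, hf1, hf2, fun hm => ⟨fun x hx => ?_, fun x hx y hy => ?_, ?_⟩⟩
    · have := hfc (star ⟨x, hx⟩ * ⟨x, hx⟩)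
      rw [show f (star x * x) = _ from this]
      exact mul_nonneg (by exact_mod_cast hc.le) (cornerTrace_star_mul_self_nonneg hg.proj _)
    · have e1 := hfc (⟨x, hx⟩ * ⟨y, hy⟩)
      have e2 := hfc (⟨y, hy⟩ * ⟨x, hx⟩)
      rw [cornerTrace_mul_comm, ← e2] at e1
      exact e1
    · have hpm := hF.mono ((le_max_left n k).trans hm) hp'n
      have hqm := hF.mono ((le_max_right n k).trans hm) hq'k
      have e1 : f q' = c * cornerTrace g ⟨q', hqm⟩ := hfc ⟨q', hqm⟩
      have e2 : f p' = c * cornerTrace g ⟨p', hpm⟩ := hfc ⟨p', hpm⟩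
      rw [cornerTrace_eq_rank hg.proj (isStarProjection_coe_iff.1 hq')] at e1
      rw [cornerTrace_eq_rank hg.proj (isStarProjection_coe_iff.1 hp')] at e2
      rw [map_sub, e1, e2]
      have e3 : ((cornerRank g ⟨p', hpm⟩ : ℕ) : ℝ) ≤ cornerRank g ⟨q', hqm⟩ := by
        exact_mod_cast hgr hm
      simp only [Complex.sub_re, Complex.re_ofReal_mul, Complex.natCast_re]
      nlinarith
  choose f hf1 hf2 hf3 using key
  obtain ⟨τ, hτ, hc⟩ := hF.exists_tracialState (max n k) f hf1 hf2 (fun m hm => (hf3 m hm).1)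
    (fun m hm => (hf3 m hm).2.1)
  have h1 := hc (q' - p') 0 fun m hm => (hf3 m hm).2.2
  have h2 := h' τ hτ
  rw [map_sub, Complex.sub_re] at h1
  linarith

theorem convex_tracialStates : Convex ℝ (tracialStates B) := by
  rintro x ⟨hx1, hx2⟩ y ⟨hy1, hy2⟩ s t hs ht hst
  refine ⟨fun z => ?_, ?_⟩
  · change 0 ≤ s • x.1 (star z * z) + t • y.1 (star z * z)
    exact add_nonneg (smul_nonneg hs (hx1 z)) (smul_nonneg ht (hy1 z))
  · change s • x.1 1 + t • y.1 1 = 1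
    rw [hx2, hy2, ← add_smul, hst, one_smul]

/-- Positivity and normalization are closed conditions, a positive functional with value 1 at the
unit has norm at most 1, and a finite-dimensional space is proper. -/
theorem isCompact_tracialStates [FiniteDimensional ℂ (traceSpace B)] :
    IsCompact (tracialStates B) := by
  have hproper : ProperSpace (traceSpace B) := FiniteDimensional.proper ℂ (traceSpace B)
  refine Metric.isCompact_of_isClosed_isBounded ?_ ?_
  · have h1 : tracialStates B = (⋂ x : B, {τ : traceSpace B | 0 ≤ τ.1 (star x * x)}) ∩
        {τ : traceSpace B | τ.1 1 = 1} := by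
      ext τ; simp [tracialStates]
    rw [h1]
    have hev : ∀ x : B, Continuous fun τ : traceSpace B => τ.1 x := fun x =>
      (ContinuousLinearMap.apply ℂ ℂ x).continuous.comp continuous_subtype_val
    exact (isClosed_iInter fun x => isClosed_le continuous_const (hev _)).inter
      (isClosed_eq (hev 1) continuous_const)
  · refine (isBounded_iff_forall_norm_le (E := traceSpace B)).2 ⟨1, ?_⟩
    rintro τ ⟨h1, h2⟩
    change ‖τ.1‖ ≤ 1
    refine ContinuousLinearMap.opNorm_le_bound _ zero_le_one fun x => ?_
    have := norm_apply_le_of_positive (τ.1 : B →ₗ[ℂ] ℂ) h1 x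
    have h2' : ((τ.1 : B →ₗ[ℂ] ℂ) 1).re = 1 := by
      change (τ.1 1).re = 1
      rw [h2]; simp
    rw [h2', mul_comm] at this
    exact this

/-- A compact convex set with two extreme points is a segment. -/
theorem eq_segment_of_extremePoints {V : Type*} [AddCommGroup V] [Module ℝ V] [TopologicalSpace V]
    [T2Space V] [IsTopologicalAddGroup V] [ContinuousSMul ℝ V] [LocallyConvexSpace ℝ V] {K : Set V}
    (hK : IsCompact K) (hc : Convex ℝ K) {x y : V} (h : K.extremePoints ℝ = {x, y}) :
    K = segment ℝ x y := by
  have hKM := closure_convexHull_extremePoints hK hc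
  have hcl : IsClosed (convexHull ℝ {x, y}) :=
    (Set.Finite.isCompact_convexHull ℝ (by simp)).isClosed
  rw [h, hcl.closure_eq, convexHull_pair] at hKM
  exact hKM.symm

/-- If there are exactly two extremal tracial states and the trace space is finite-dimensional,
each tracial state is a convex combination of them. -/
theorem exists_convex_combination [FiniteDimensional ℂ (traceSpace B)] {φ : Fin 2 → traceSpace B}
    (hφ : EnumeratesExtremalTraces φ) {τ : traceSpace B} (hτ : τ ∈ tracialStates B) :
    ∃ s t : ℝ, 0 ≤ s ∧ 0 ≤ t ∧ s + t = 1 ∧ τ = s • φ 0 + t • φ 1 := by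
  have hsmul : ContinuousSMul ℝ (traceSpace B) := by
    refine ⟨continuous_induced_rng.2 ?_⟩
    change Continuous fun p : ℝ × traceSpace B => p.1 • p.2.1
    exact continuous_fst.smul (continuous_subtype_val.comp continuous_snd)
  have hlc : LocallyConvexSpace ℝ (traceSpace B) :=
    Topology.IsInducing.locallyConvexSpace (f := (traceSpace B).subtype.restrictScalars ℝ)
      Topology.IsInducing.subtypeVal
  have hrange : Set.range φ = {φ 0, φ 1} := by
    ext x
    simp [Fin.exists_fin_two, eq_comm]
  have hKM := eq_segment_of_extremePoints isCompact_tracialStates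
    (convex_tracialStates (B := B)) (hφ.2.symm.trans hrange)
  rw [hKM] at hτ
  obtain ⟨s, t, hs, ht, hst, h⟩ := hτ
  exact ⟨s, t, hs, ht, hst, h.symm⟩

end States

/-! ### Matrices over AF-algebras -/

section Embed

/-- The isometry `Aᵃ → Aᵐ` given by an injective map of index sets. -/
def indexIsometry (A : Type*) [Ring A] {a m : Type*} [DecidableEq m] (e : a → m) : Matrix m a A :=
  (1 : Matrix m m A).submatrix id e

theorem indexIsometry_apply {A : Type*} [Ring A] {a m : Type*} [DecidableEq m] (e : a → m) (i : m)
    (j : a) : indexIsometry A e i j = if i = e j then 1 else 0 := by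
  simp [indexIsometry, Matrix.one_apply]

variable {A : Type*} [Ring A] [StarRing A] {a c m : Type*} [Fintype m] [DecidableEq m]

theorem indexIsometry_conjTranspose_mul [DecidableEq a] {e : a → m} (he : Function.Injective e) :
    (indexIsometry A e)ᴴ * indexIsometry A e = 1 := by
  ext i j
  simp only [Matrix.mul_apply, Matrix.conjTranspose_apply, indexIsometry_apply, Matrix.one_apply]
  rw [Finset.sum_eq_single (e i)]
  · simp [he.eq_iff]
  · intro b _ hb; simp [hb]
  · simp

theorem indexIsometry_conjTranspose_mul_of_disjoint {e : a → m} {e' : c → m}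
    (h : ∀ i j, e i ≠ e' j) : (indexIsometry A e)ᴴ * indexIsometry A e' = 0 := by
  ext i j
  simp only [Matrix.mul_apply, Matrix.conjTranspose_apply, indexIsometry_apply, Matrix.zero_apply]
  refine Finset.sum_eq_zero fun x _ => ?_
  by_cases hx : x = e i
  · subst hx; simp [h i j]
  · simp [hx]

variable [Fintype a] [Fintype c]

/-- The matrix `p`, placed in the rows and columns given by an injective map of index sets. -/
def embedMatrix (e : a → m) (p : Matrix a a A) : Matrix m m A :=
  indexIsometry A e * p * (indexIsometry A e)ᴴ

theorem mvN_embedMatrix [DecidableEq a] {e : a → m} (he : Function.Injective e) {p : Matrix a a A}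
    (hp : IsStarProjection p) : MvN p (embedMatrix e p) := by
  have h1 : p * p = p := hp.isIdempotentElem
  have h2 : pᴴ = p := hp.isSelfAdjoint
  refine ⟨indexIsometry A e * p, ?_, ?_⟩
  · rw [Matrix.conjTranspose_mul, h2, Matrix.mul_assoc, ← Matrix.mul_assoc _ _ p,
      indexIsometry_conjTranspose_mul he, Matrix.one_mul, h1]
  · rw [Matrix.conjTranspose_mul, h2, embedMatrix, Matrix.mul_assoc, ← Matrix.mul_assoc p, h1,
      Matrix.mul_assoc]

theorem isStarProjection_embedMatrix [DecidableEq a] {e : a → m} (he : Function.Injective e)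
    {p : Matrix a a A} (hp : IsStarProjection p) : IsStarProjection (embedMatrix e p) := by
  have h1 : p * p = p := hp.isIdempotentElem
  have h2 : pᴴ = p := hp.isSelfAdjoint
  refine ⟨?_, ?_⟩
  · change embedMatrix e p * embedMatrix e p = _
    rw [embedMatrix, show indexIsometry A e * p * (indexIsometry A e)ᴴ *
      (indexIsometry A e * p * (indexIsometry A e)ᴴ) = indexIsometry A e * p *
      ((indexIsometry A e)ᴴ * indexIsometry A e) * p * (indexIsometry A e)ᴴ by
        simp only [Matrix.mul_assoc], indexIsometry_conjTranspose_mul he, Matrix.mul_one,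
      Matrix.mul_assoc _ p p, h1]
  · change (embedMatrix e p)ᴴ = _
    rw [embedMatrix, Matrix.conjTranspose_mul, Matrix.conjTranspose_mul, h2,
      Matrix.conjTranspose_conjTranspose, Matrix.mul_assoc]

theorem embedMatrix_mul_of_disjoint {e : a → m} {e' : c → m} (h : ∀ i j, e i ≠ e' j)
    (p : Matrix a a A) (q : Matrix c c A) : embedMatrix e p * embedMatrix e' q = 0 := by
  rw [embedMatrix, embedMatrix, show indexIsometry A e * p * (indexIsometry A e)ᴴ *
      (indexIsometry A e' * q * (indexIsometry A e')ᴴ) = indexIsometry A e * p *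
      ((indexIsometry A e)ᴴ * indexIsometry A e') * q * (indexIsometry A e')ᴴ by
        simp only [Matrix.mul_assoc], indexIsometry_conjTranspose_mul_of_disjoint h]
  simp

/-- This replaces an external block sum by a sum of orthogonal projections inside one matrix
algebra, the setting of cancellation. -/
theorem mvN_fromBlocks_embedMatrix [DecidableEq a] [DecidableEq c] {e : a → m} {e' : c → m}
    (he : Function.Injective e) (he' : Function.Injective e') (h : ∀ i j, e i ≠ e' j)
    {p : Matrix a a A} {q : Matrix c c A} (hp : IsStarProjection p) (hq : IsStarProjection q) :
    MvN (Matrix.fromBlocks p 0 0 q) (embedMatrix e p + embedMatrix e' q) := by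
  have p1 : p * p = p := hp.isIdempotentElem
  have p2 : pᴴ = p := hp.isSelfAdjoint
  have q1 : q * q = q := hq.isIdempotentElem
  have q2 : qᴴ = q := hq.isSelfAdjoint
  have h' : ∀ i j, e' i ≠ e j := fun i j hij => h j i hij.symm
  refine ⟨Matrix.fromCols (indexIsometry A e * p) (indexIsometry A e' * q), ?_, ?_⟩
  · rw [Matrix.conjTranspose_fromCols_eq_fromRows_conjTranspose, Matrix.fromRows_mul_fromCols]
    simp only [Matrix.conjTranspose_mul, p2, q2]
    congr 1
    · rw [Matrix.mul_assoc, ← Matrix.mul_assoc _ _ p, indexIsometry_conjTranspose_mul he,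
        Matrix.one_mul, p1]
    · rw [Matrix.mul_assoc, ← Matrix.mul_assoc _ _ q,
        indexIsometry_conjTranspose_mul_of_disjoint h]
      simp
    · rw [Matrix.mul_assoc, ← Matrix.mul_assoc _ _ p,
        indexIsometry_conjTranspose_mul_of_disjoint h']
      simp
    · rw [Matrix.mul_assoc, ← Matrix.mul_assoc _ _ q, indexIsometry_conjTranspose_mul he',
        Matrix.one_mul, q1]
  · rw [Matrix.conjTranspose_fromCols_eq_fromRows_conjTranspose, Matrix.fromCols_mul_fromRows]
    simp only [Matrix.conjTranspose_mul, p2, q2, embedMatrix]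
    congr 1
    · rw [Matrix.mul_assoc, ← Matrix.mul_assoc p, p1, Matrix.mul_assoc]
    · rw [Matrix.mul_assoc, ← Matrix.mul_assoc q, q1, Matrix.mul_assoc]

end Embed

/-! ### Elements and equality in the Grothendieck group. -/

section K0

variable {A : Type*} [Ring A] [StarRing A]

theorem K0.exists_eq_sub (g : K0 A) : ∃ p q : MatProj A, g = K0.mk p - K0.mk q := by
  obtain ⟨⟨x, y⟩, h⟩ := (AddLocalization.addMonoidOf (⊤ : AddSubmonoid (V A))).surj g
  obtain ⟨p, hp⟩ := Quotient.exists_rep x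
  obtain ⟨q, hq⟩ := Quotient.exists_rep y.1
  refine ⟨p, q, eq_sub_of_add_eq ?_⟩
  rw [K0.mk, K0.mk, V.mk, V.mk, hp, hq]
  exact h

theorem K0.exists_mvN_sum {p q : MatProj A} (h : K0.mk p = K0.mk q) :
    ∃ r : MatProj A, MvN (p.sum r).2.1 (q.sum r).2.1 := by
  obtain ⟨⟨x, hx⟩, hc⟩ :=
    (AddLocalization.addMonoidOf (⊤ : AddSubmonoid (V A))).exists_of_eq h
  obtain ⟨r, hr⟩ := Quotient.exists_rep x
  refine ⟨r, ?_⟩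
  have h1 : V.mk p + V.mk r = V.mk q + V.mk r := by
    rw [add_comm, add_comm (V.mk q), V.mk, V.mk, V.mk, hr]
    exact hc
  exact Quotient.exact h1

end K0

/-! ### Matrix algebras over AF-algebras and cancellation. -/

section MatChain

variable {A : Type*} [CStarAlgebra A] {m : Type*} [Fintype m]

/-- The ⋆-subalgebra of the matrices with entries in `S`. -/
def matSubalgebra (m : Type*) [Fintype m] [DecidableEq m] (S : StarSubalgebra ℂ A) :
    StarSubalgebra ℂ (CStarMatrix m m A) where
  carrier := {M | ∀ i j, M i j ∈ S}
  mul_mem' := fun {M N} hM hN i j => by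
    rw [CStarMatrix.mul_apply]
    exact sum_mem fun k _ => mul_mem (hM i k) (hN k j)
  add_mem' := fun hM hN i j => add_mem (hM i j) (hN i j)
  algebraMap_mem' := fun r i j => by
    rw [CStarMatrix.algebraMap_apply]
    split_ifs
    · exact algebraMap_mem S r
    · exact zero_mem S
  star_mem' := fun {M} hM i j => by
    rw [CStarMatrix.star_apply]
    exact star_mem (hM j i)

/-- The topology of `CStarMatrix` is the entrywise one, and the finitely many entries of a matrix
over the union lie in a common stage. -/
theorem IsAFChain.matSubalgebra [DecidableEq m] [PartialOrder A] [StarOrderedRing A]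
    {F : ℕ → StarSubalgebra ℂ A} (hF : IsAFChain F) :
    IsAFChain fun n => matSubalgebra m (F n) where
  mono := fun k l hkl M hM i j => hF.mono hkl (hM i j)
  finite := fun n => by
    have := hF.finite n
    let f : AFFundamental.matSubalgebra m (F n) →ₗ[ℂ] (m → m → F n) :=
      { toFun := fun M i j => ⟨M.1 i j, M.2 i j⟩
        map_add' := fun _ _ => rfl
        map_smul' := fun _ _ => rfl }
    refine Module.Finite.of_injective f fun M N h => Subtype.ext ?_
    ext i j
    exact congrArg Subtype.val (congrFun (congrFun h i) j)
  dense := by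
    set D := ⋃ n, (F n : Set A) with hD
    have h1 : Dense (Set.univ.pi fun _ : m => Set.univ.pi fun _ : m => D) :=
      dense_pi _ fun _ _ => dense_pi _ fun _ _ => hF.dense
    have h2 : Dense ({M | ∀ i j, M i j ∈ D} : Set (CStarMatrix m m A)) := by
      have : ({M | ∀ i j, M i j ∈ D} : Set (CStarMatrix m m A)) =
          (Set.univ.pi fun _ : m => Set.univ.pi fun _ : m => D) := by
        ext M
        exact ⟨fun h i _ j _ => h i j, fun h i j => h i trivial j trivial⟩
      rw [this]
      exact h1
    refine h2.mono fun M hM => ?_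
    choose n hn using fun i j => Set.mem_iUnion.1 (hM i j)
    refine Set.mem_iUnion.2 ⟨Finset.univ.sup fun i => Finset.univ.sup fun j => n i j, fun i j => ?_⟩
    refine hF.mono ?_ (hn i j)
    exact (Finset.le_sup (f := fun j => n i j) (Finset.mem_univ j)).trans
      (Finset.le_sup (f := fun i => Finset.univ.sup fun j => n i j) (Finset.mem_univ i))

theorem IsAF.exists_chain {A : Type*} [CStarAlgebra A] (h : IsAF A) :
    ∃ F : ℕ → StarSubalgebra ℂ A, IsAFChain F := by
  obtain ⟨F, h1, h2, h3⟩ := h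
  exact ⟨F, h1, h2, h3⟩

theorem isStarProjection_ofMatrix {p : Matrix m m A} :
    IsStarProjection (CStarMatrix.ofMatrix p : CStarMatrix m m A) ↔ IsStarProjection p :=
  ⟨fun h => ⟨h.1, h.2⟩, fun h => ⟨h.1, h.2⟩⟩

variable [DecidableEq m]

/-- `CStarMatrix` is a synonym of `Matrix`, so for square matrices of one size both equivalences
unfold to the same statement. -/
theorem projEquiv_of_mvN {p q : Matrix m m A} (h : MvN p q) :
    ProjEquiv (CStarMatrix.ofMatrix p) (CStarMatrix.ofMatrix q) := h

theorem mvN_of_projEquiv {p q : Matrix m m A}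
    (h : ProjEquiv (CStarMatrix.ofMatrix p) (CStarMatrix.ofMatrix q)) : MvN p q := h

/-- In an AF-algebra, projections with the same class in `K₀` are equivalent. -/
theorem mvN_of_K0_eq (hA : IsAF A) {p q : MatProj A} (h : K0.mk p = K0.mk q) :
    MvN p.2.1 q.2.1 := by
  let _ := CStarAlgebra.spectralOrder A
  have := CStarAlgebra.spectralOrderedRing A
  obtain ⟨F, hF⟩ := hA.exists_chain
  obtain ⟨r, hr⟩ := K0.exists_mvN_sum h
  -- Disjoint index blocks for p, q and r turn p ⊕ r and q ⊕ r into orthogonal sums in one algebra,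
  -- with the same copy of r to be cancelled.
  let M := (Fin p.1 ⊕ Fin q.1) ⊕ Fin r.1
  let e1 : Fin p.1 → M := fun i => .inl (.inl i)
  let e2 : Fin q.1 → M := fun i => .inl (.inr i)
  let e3 : Fin r.1 → M := fun i => .inr i
  have i1 : Function.Injective e1 := Sum.inl_injective.comp Sum.inl_injective
  have i2 : Function.Injective e2 := Sum.inl_injective.comp Sum.inr_injective
  have i3 : Function.Injective e3 := Sum.inr_injective
  have d1 : ∀ i j, e1 i ≠ e3 j := fun i j h => by simp [e1, e3] at h
  have d2 : ∀ i j, e2 i ≠ e3 j := fun i j h => by simp [e2, e3] at h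
  have hp := isStarProjection_embedMatrix i1 p.2.2
  have hq := isStarProjection_embedMatrix i2 q.2.2
  have hr' := isStarProjection_embedMatrix i3 r.2.2
  have pr := isStarProjection_fromBlocks p.2.2 r.2.2
  have qr := isStarProjection_fromBlocks q.2.2 r.2.2
  have s1 := hp.add hr' (embedMatrix_mul_of_disjoint d1 _ _)
  have s2 := hq.add hr' (embedMatrix_mul_of_disjoint d2 _ _)
  have h1 : MvN (embedMatrix e1 p.2.1 + embedMatrix e3 r.2.1)
      (embedMatrix e2 q.2.1 + embedMatrix e3 r.2.1) := by
    refine MvN.trans s1 s2 (mvN_fromBlocks_embedMatrix i1 i3 d1 p.2.2 r.2.2).symm ?_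
    refine MvN.trans pr s2 (p.mvN_sum r) ?_
    refine MvN.trans (p.sum r).2.2 s2 hr ?_
    exact MvN.trans (q.sum r).2.2 s2 (q.mvN_sum r).symm
      (mvN_fromBlocks_embedMatrix i2 i3 d2 q.2.2 r.2.2)
  have h2 : MvN (embedMatrix e1 p.2.1) (embedMatrix e2 q.2.1) :=
    mvN_of_projEquiv ((hF.matSubalgebra (m := M)).cancel (isStarProjection_ofMatrix.2 hp)
      (isStarProjection_ofMatrix.2 hq) (isStarProjection_ofMatrix.2 hr')
      (isStarProjection_ofMatrix.2 hr') (embedMatrix_mul_of_disjoint d1 _ _)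
      (embedMatrix_mul_of_disjoint d2 _ _) (projEquiv_of_mvN h1)
      (ProjEquiv.refl (isStarProjection_ofMatrix.2 hr')))
  exact MvN.trans p.2.2 q.2.2 (mvN_embedMatrix i1 p.2.2)
    (MvN.trans hp q.2.2 h2 (mvN_embedMatrix i2 q.2.2).symm)

end MatChain

/-! ### Tracial states on matrix algebras -/

section MatTrace

variable {A : Type*} [CStarAlgebra A] {m : Type*} [Fintype m] [DecidableEq m]

/-- Matrix units show that T vanishes on off-diagonal entries and takes the same value on a in each
diagonal position. Hence a constant diagonal matrix with entry a has value `Fintype.card m` times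
that of a in one position. -/
theorem card_mul_eq_of_tracial (T : Matrix m m A →ₗ[ℂ] ℂ) (hT : ∀ x y, T (x * y) = T (y * x))
    (Y : Matrix m m A) :
    (Fintype.card m : ℂ) * T Y = ∑ i, T (Matrix.diagonal fun _ => Y i i) := by
  have h1 : ∀ i j (a : A), T (Matrix.single j j a) = T (Matrix.single i i a) := by
    intro i j a
    have e1 : Matrix.single j i (1 : A) * Matrix.single i j a = Matrix.single j j a := by simp
    have e2 : Matrix.single i j a * Matrix.single j i (1 : A) = Matrix.single i i a := by simp
    rw [← e1, hT, e2]
  have h2 : ∀ i j (a : A), i ≠ j → T (Matrix.single i j a) = 0 := by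
    intro i j a hij
    have e1 : Matrix.single i i (1 : A) * Matrix.single i j a = Matrix.single i j a := by simp
    have e2 : Matrix.single i j a * Matrix.single i i (1 : A) = 0 := by
      rw [Matrix.single_mul_single_of_ne]
      exact hij.symm
    rw [← e1, hT, e2, map_zero]
  have h3 : ∀ i (a : A), T (Matrix.diagonal fun _ => a) =
      (Fintype.card m : ℂ) * T (Matrix.single i i a) := by
    intro i a
    have : Matrix.diagonal (fun _ : m => a) = ∑ j, Matrix.single j j a := by
      rw [Matrix.matrix_eq_sum_single (Matrix.diagonal fun _ => a)]
      refine Finset.sum_congr rfl fun j _ => ?_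
      rw [Finset.sum_eq_single j]
      · simp
      · intro b _ hb
        simp [Matrix.diagonal_apply_ne _ hb.symm]
      · simp
    rw [this, map_sum, Finset.sum_congr rfl fun j _ => h1 i j a]
    simp
  simp_rw [fun i => h3 i (Y i i)]
  rw [← Finset.mul_sum]
  congr 1
  conv_lhs => rw [Matrix.matrix_eq_sum_single Y]
  rw [map_sum]
  refine Finset.sum_congr rfl fun i _ => ?_
  rw [map_sum, Finset.sum_eq_single i]
  · intro b _ hb
    exact h2 _ _ _ hb.symm
  · simp

/-- A tracial state on a matrix algebra is the normalized matrix trace of a tracial state. -/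
theorem exists_tracialState_of_matrix [PartialOrder A] [StarOrderedRing A]
    {τ : traceSpace (CStarMatrix m m A)}
    (hτ : τ ∈ tracialStates (CStarMatrix m m A)) :
    ∃ σ ∈ tracialStates A, ∀ Y : Matrix m m A,
      (Fintype.card m : ℂ) * τ.1 (CStarMatrix.ofMatrix Y) = matTrace σ Y := by
  let d : A →L[ℂ] CStarMatrix m m A :=
    { toFun := fun a => CStarMatrix.ofMatrix (Matrix.diagonal fun _ => a)
      map_add' := fun a b => by
        rw [CStarMatrix.of_add_of, Matrix.diagonal_add]
      map_smul' := fun c a => by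
        rw [RingHom.id_apply, CStarMatrix.smul_of, ← Matrix.diagonal_smul]; rfl
      cont := by
        change Continuous fun a : A => (Matrix.diagonal fun _ : m => a : Matrix m m A)
        exact Continuous.matrix_diagonal (continuous_pi fun _ => continuous_id) }
  have hd : ∀ a, d a = CStarMatrix.ofMatrix (Matrix.diagonal fun _ => a) := fun _ => rfl
  have hmul : ∀ a b, d (a * b) = d a * d b := fun a b => by
    change (Matrix.diagonal fun _ : m => a * b) =
      (Matrix.diagonal fun _ : m => a) * (Matrix.diagonal fun _ : m => b)
    rw [Matrix.diagonal_mul_diagonal]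
  have hstar : ∀ a, d (star a) = star (d a) := fun a => by
    change (Matrix.diagonal fun _ : m => star a) = (Matrix.diagonal fun _ : m => a)ᴴ
    rw [Matrix.diagonal_conjTranspose]; rfl
  have hone : d 1 = 1 := by
    change (Matrix.diagonal fun _ : m => (1 : A)) = 1
    exact Matrix.diagonal_one
  refine ⟨⟨τ.1.comp d, fun a b => ?_⟩, ⟨fun a => ?_, ?_⟩, fun Y => ?_⟩
  · change τ.1 (d (a * b)) = τ.1 (d (b * a))
    rw [hmul, hmul]
    exact τ.2 _ _
  · change 0 ≤ τ.1 (d (star a * a))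
    rw [hmul, hstar]
    exact hτ.1 _
  · change τ.1 (d 1) = 1
    rw [hone]
    exact hτ.2
  · exact card_mul_eq_of_tracial (A := A) (m := m)
      ((τ.1 : CStarMatrix m m A →ₗ[ℂ] ℂ).comp
        (CStarMatrix.ofMatrixₗ : Matrix m m A ≃ₗ[ℂ] CStarMatrix m m A).toLinearMap)
      (fun x y => τ.2 x y) Y

end MatTrace

/-! ### Systems of matrix units -/

section UnitSystem

variable {B : Type*} [CStarAlgebra B] {N : ℕ}

/-- A system of partial isometries `v i` from `g (r i)` to `g i`, where the `g i` are orthogonal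
projections with sum `1`. The products `v i * star (v j)` with `r i = r j` are the matrix units of
a finite-dimensional subalgebra. -/
structure IsUnitSystem (r : Fin N → Fin N) (g v : Fin N → B) : Prop where
  proj : ∀ i, IsStarProjection (g i)
  orth : ∀ i j, i ≠ j → g i * g j = 0
  sum_eq : ∑ i, g i = 1
  star_mul : ∀ i, star (v i) * v i = g (r i)
  mul_star : ∀ i, v i * star (v i) = g i

namespace IsUnitSystem

variable {r : Fin N → Fin N} {g v : Fin N → B}

theorem mul_right (h : IsUnitSystem r g v) (i : Fin N) : v i * g (r i) = v i :=
  mul_eq_self_of_star_mul_self (h.proj _) (h.star_mul i)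

theorem mul_left (h : IsUnitSystem r g v) (i : Fin N) : g i * v i = v i :=
  mul_eq_self_of_mul_star (h.proj _) (h.mul_star i)

theorem star_mul_right (h : IsUnitSystem r g v) (i : Fin N) : star (v i) * g i = star (v i) := by
  have := congrArg star (h.mul_left i)
  rwa [StarMul.star_mul, (h.proj i).isSelfAdjoint.star_eq] at this

theorem star_mul_left (h : IsUnitSystem r g v) (i : Fin N) :
    g (r i) * star (v i) = star (v i) := by
  have := congrArg star (h.mul_right i)
  rwa [StarMul.star_mul, (h.proj _).isSelfAdjoint.star_eq] at this

theorem star_mul_of_ne (h : IsUnitSystem r g v) {i j : Fin N} (hij : i ≠ j) :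
    star (v i) * v j = 0 := by
  rw [← h.star_mul_right i, ← h.mul_left j, mul_assoc, ← mul_assoc (g i), h.orth i j hij]
  simp

/-- The matrix units. -/
noncomputable def unit (r : Fin N → Fin N) (v : Fin N → B) (i j : Fin N) : B :=
  if r i = r j then v i * star (v j) else 0

theorem unit_mul (h : IsUnitSystem r g v) (i j k l : Fin N) :
    unit r v i j * unit r v k l = if j = k ∧ r i = r j then unit r v i l else 0 := by
  unfold unit
  by_cases hij : r i = r j
  · by_cases hkl : r k = r l
    · by_cases hjk : j = k
      · subst hjk
        rw [if_pos hij, if_pos hkl, if_pos ⟨rfl, hij⟩, if_pos (hij.trans hkl),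
          show v i * star (v j) * (v j * star (v l)) = v i * (star (v j) * v j) * star (v l) by
            simp only [mul_assoc], h.star_mul, ← hij, h.mul_right]
      · rw [if_pos hij, if_pos hkl, if_neg (fun h => hjk h.1),
          show v i * star (v j) * (v k * star (v l)) = v i * (star (v j) * v k) * star (v l) by
            simp only [mul_assoc], h.star_mul_of_ne hjk]
        simp
    · rw [if_neg hkl, mul_zero]
      split_ifs with h1 h2
      · exact absurd (h1.1 ▸ h1.2.symm.trans h2) hkl
      · rfl
      · rfl
  · rw [if_neg hij, zero_mul, if_neg (fun h => hij h.2)]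

theorem star_unit (r : Fin N → Fin N) (v : Fin N → B) (i j : Fin N) :
    star (unit r v i j) = unit r v j i := by
  unfold unit
  by_cases h : r i = r j
  · rw [if_pos h, if_pos h.symm, StarMul.star_mul, star_star]
  · rw [if_neg h, if_neg (Ne.symm h), star_zero]

theorem sum_unit (h : IsUnitSystem r g v) : ∑ i, unit r v i i = 1 := by
  rw [← h.sum_eq]
  exact Finset.sum_congr rfl fun i _ => by rw [unit, if_pos rfl, h.mul_star]

theorem trace_unit (h : IsUnitSystem r g v) (τ : B →L[ℂ] ℂ) (hτ : ∀ x y, τ (x * y) = τ (y * x))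
    (i j : Fin N) : τ (unit r v i j) = if i = j then τ (g i) else 0 := by
  by_cases hij : i = j
  · subst hij
    rw [if_pos rfl, unit, if_pos rfl, h.mul_star]
  · rw [if_neg hij, unit]
    split_ifs
    · rw [hτ, h.star_mul_of_ne (Ne.symm hij), map_zero]
    · exact map_zero _

end IsUnitSystem

end UnitSystem

/-! ### Matrix units spanning a finite-dimensional C⋆-algebra. -/

section Spanning

variable {E : Type*} [CStarAlgebra E] {N : ℕ} {r : Fin N → Fin N} {g v : Fin N → E}

/-- A unit system which spans. -/
structure IsSpanningSystem (r : Fin N → Fin N) (g v : Fin N → E) : Prop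
    extends IsUnitSystem r g v where
  ne_zero : ∀ i, g i ≠ 0
  span : ∀ x, ∃ c : Fin N → Fin N → ℂ, x = ∑ i, ∑ j, c i j • IsUnitSystem.unit r v i j

/-- Compressing the sum by v i * on the left and v j on the right isolates the coefficient c i j
times the nonzero projection g (r i). -/
theorem IsSpanningSystem.coeff_eq_zero (h : IsSpanningSystem r g v) {c : Fin N → Fin N → ℂ}
    (h0 : ∑ i, ∑ j, c i j • IsUnitSystem.unit r v i j = 0) {i j : Fin N} (hij : r i = r j) :
    c i j = 0 := by
  have h1 : star (v i) * (∑ k, ∑ l, c k l • IsUnitSystem.unit r v k l) * v j = c i j • g (r i) := by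
    rw [Finset.mul_sum, Finset.sum_mul, Finset.sum_eq_single i]
    · rw [Finset.mul_sum, Finset.sum_mul, Finset.sum_eq_single j]
      · rw [IsUnitSystem.unit, if_pos hij, mul_smul_comm, smul_mul_assoc, mul_assoc, mul_assoc,
          h.star_mul, ← mul_assoc, h.star_mul, hij, (h.proj _).isIdempotentElem.eq]
      · intro l _ hl
        rw [IsUnitSystem.unit]
        split_ifs
        · rw [mul_smul_comm, smul_mul_assoc, mul_assoc, mul_assoc, h.star_mul_of_ne hl]
          simp
        · simp
      · simp
    · intro k _ hk
      rw [Finset.mul_sum, Finset.sum_mul]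
      refine Finset.sum_eq_zero fun l _ => ?_
      rw [IsUnitSystem.unit]
      split_ifs
      · rw [mul_smul_comm, smul_mul_assoc, ← mul_assoc, h.star_mul_of_ne (Ne.symm hk)]
        simp
      · simp
    · simp
  rw [h0, mul_zero, zero_mul] at h1
  exact (smul_eq_zero.1 h1.symm).resolve_right (h.ne_zero _)

/-- A spanning unit system determines a homomorphism into any algebra with a unit system of the
same shape. -/
theorem IsSpanningSystem.exists_hom {B : Type*} [CStarAlgebra B] (h : IsSpanningSystem r g v)
    {f w : Fin N → B} (hw : IsUnitSystem r f w) :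
    ∃ β : E →⋆ₐ[ℂ] B, ∀ i j, β (IsUnitSystem.unit r v i j) = IsUnitSystem.unit r w i j := by
  choose c hc using h.span
  -- The chosen coefficients are unique where r i = r j. Elsewhere they are arbitrary, but the
  -- target unit is zero, so the image of x does not depend on the choice.
  have huniq : ∀ (x : E) (d : Fin N → Fin N → ℂ),
      x = ∑ i, ∑ j, d i j • IsUnitSystem.unit r v i j →
      ∀ i j, c x i j • IsUnitSystem.unit r w i j = d i j • IsUnitSystem.unit r w i j := by
    intro x d hd i j
    by_cases hij : r i = r j
    · have h0 : ∑ i, ∑ j, (c x i j - d i j) • IsUnitSystem.unit r v i j = 0 := by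
        simp_rw [sub_smul, Finset.sum_sub_distrib]
        rw [← hd, ← hc, sub_self]
      rw [sub_eq_zero.1 (h.coeff_eq_zero h0 hij)]
    · simp [IsUnitSystem.unit, hij]
  let b : E → B := fun x => ∑ i, ∑ j, c x i j • IsUnitSystem.unit r w i j
  have hb : ∀ (x : E) (d : Fin N → Fin N → ℂ),
      x = ∑ i, ∑ j, d i j • IsUnitSystem.unit r v i j →
      b x = ∑ i, ∑ j, d i j • IsUnitSystem.unit r w i j := fun x d hd =>
    Finset.sum_congr rfl fun i _ => Finset.sum_congr rfl fun j _ => huniq x d hd i j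
  let L : E →ₗ[ℂ] B :=
    { toFun := b
      map_add' := fun x y => by
        rw [hb (x + y) (fun i j => c x i j + c y i j) (by
          simp_rw [add_smul, Finset.sum_add_distrib]; rw [← hc, ← hc])]
        simp_rw [add_smul, Finset.sum_add_distrib]; rfl
      map_smul' := fun a x => by
        rw [hb (a • x) (fun i j => a * c x i j) (by
          simp_rw [mul_smul, ← Finset.smul_sum]; rw [← hc])]
        simp_rw [mul_smul, ← Finset.smul_sum]; rfl }
  have hLu : ∀ k l, L (IsUnitSystem.unit r v k l) = IsUnitSystem.unit r w k l := by
    intro k l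
    have e : ∀ {D : Type _} [AddCommGroup D] [Module ℂ D] (s : Fin N → Fin N → D),
        ∑ i, ∑ j, (if i = k ∧ j = l then (1 : ℂ) else 0) • s i j = s k l := by
      intro D _ _ s
      rw [Finset.sum_eq_single k, Finset.sum_eq_single l]
      · simp
      · intro j _ hj; simp [hj]
      · simp
      · intro i _ hi; simp [hi]
      · simp
    change b _ = _
    rw [hb _ (fun i j => if i = k ∧ j = l then (1 : ℂ) else 0)]
    · exact (by
        rw [Finset.sum_eq_single k, Finset.sum_eq_single l]
        · simp
        · intro j _ hj; simp [hj]
        · simp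
        · intro i _ hi; simp [hi]
        · simp)
    · exact (e _).symm
  have hmulu : ∀ i j k l, L (IsUnitSystem.unit r v i j * IsUnitSystem.unit r v k l) =
      IsUnitSystem.unit r w i j * IsUnitSystem.unit r w k l := by
    intro i j k l
    rw [h.unit_mul, hw.unit_mul]
    split_ifs
    · exact hLu i l
    · exact map_zero _
  have hone : L 1 = 1 := by
    rw [← h.sum_unit, map_sum, ← hw.sum_unit]
    exact Finset.sum_congr rfl fun i _ => hLu i i
  have hmul : ∀ x y, L (x * y) = L x * L y := by
    intro x y
    rw [hc x, hc y]
    simp only [Finset.sum_mul, Finset.mul_sum, map_sum, map_smul, smul_mul_assoc, mul_smul_comm,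
      hmulu, hLu]
  have hstar : ∀ x, L (star x) = star (L x) := by
    intro x
    rw [hc x]
    simp only [star_sum, star_smul, map_sum, map_smul, IsUnitSystem.star_unit, hLu]
  exact ⟨{ AlgHom.ofLinearMap L hone hmul with map_star' := hstar }, hLu⟩

variable [FiniteDimensional ℂ E]

/-- Peel off a minimal projection below q and induct on dim qE. -/
theorem exists_minProj_family {q : E} (hq : IsStarProjection q) :
    ∃ (N : ℕ) (g : Fin N → E), (∀ i, IsMinProj (g i)) ∧ (∀ i j, i ≠ j → g i * g j = 0) ∧
      ∑ i, g i = q := by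
  induction hn : cornerRank 1 q using Nat.strong_induction_on generalizing q with
  | _ n ih =>
  by_cases hq0 : q = 0
  · exact ⟨0, Fin.elim0, fun i => i.elim0, fun i => i.elim0, by simp [hq0]⟩
  obtain ⟨f, hf, hqf⟩ := exists_isMinProj_le hq hq0
  have hlt : cornerRank 1 (q - f) < n := by
    have h1 := cornerRank_add_sub (IsStarProjection.one E) hq hf.proj hqf
    have h2 : 0 < cornerRank 1 f := by
      refine cornerRank_pos (x := 1) ?_
      simpa using hf.ne_zero
    omega
  obtain ⟨N, g, hg, horth, hsum⟩ := ih _ hlt (isStarProjection_sub_of_le hq hf.proj hqf) rfl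
  have ff : f * f = f := hf.proj.isIdempotentElem
  have hfg : ∀ i, f * g i = 0 := by
    intro i
    have h1 : (q - f) * g i = g i := by
      rw [← hsum, Finset.sum_mul, Finset.sum_eq_single i]
      · exact (hg i).proj.isIdempotentElem
      · intro j _ hj; exact horth j i hj
      · simp
    rw [← h1, ← mul_assoc, mul_sub, mul_comm_of_le hq hf.proj hqf, ff, sub_self, zero_mul]
  have hgf : ∀ i, g i * f = 0 := by
    intro i
    have := congrArg star (hfg i)
    rwa [star_mul, (hg i).proj.isSelfAdjoint.star_eq, hf.proj.isSelfAdjoint.star_eq,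
      star_zero] at this
  refine ⟨N + 1, Fin.cons f g, fun i => ?_, fun i j => ?_, ?_⟩
  · refine Fin.cases ?_ (fun i => ?_) i
    · simpa using hf
    · simpa using hg i
  · refine Fin.cases ?_ (fun i => ?_) i <;> refine Fin.cases ?_ (fun j => ?_) j
    · simp
    · simp [hfg]
    · simp [hgf]
    · intro hij
      simpa using horth i j (fun h => hij (by rw [h]))
  · rw [Fin.sum_univ_succ]
    simp [hsum]

/-- A finite-dimensional C⋆-algebra is spanned by a system of matrix units. -/
theorem exists_isSpanningSystem (E : Type*) [CStarAlgebra E] [FiniteDimensional ℂ E] :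
    ∃ (N : ℕ) (r : Fin N → Fin N) (g v : Fin N → E), IsSpanningSystem r g v := by
  obtain ⟨N, g, hg, horth, hsum⟩ := exists_minProj_family (IsStarProjection.one E)
  let st : Setoid (Fin N) :=
    { r := fun i j => ProjEquiv (g i) (g j)
      iseqv :=
        { refl := fun i => ProjEquiv.refl (hg i).proj
          symm := ProjEquiv.symm
          trans := fun {i _ k} => ProjEquiv.trans (hg i).proj (hg k).proj } }
  let r : Fin N → Fin N := fun i => (Quotient.mk st i).out
  have hr : ∀ i, ProjEquiv (g (r i)) (g i) := fun i => Quotient.mk_out (s := st) i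
  have hr' : ∀ i j, ProjEquiv (g i) (g j) → r i = r j := fun i j h =>
    congrArg Quotient.out (Quotient.sound (s := st) h)
  choose v hv hv' using hr
  have hsys : IsUnitSystem r g v := ⟨fun i => (hg i).proj, horth, hsum, hv, hv'⟩
  -- A nonzero element of g i E g j rescales to a partial isometry u with u*u = g j. Minimality of g
  -- i makes uu* all of g i, so g i and g j are equivalent and share their representative.
  have hzero : ∀ i j x, r i ≠ r j → g i * x * g j = 0 := by
    intro i j x hij
    by_contra hne
    obtain ⟨u, c, -, hu, hgu⟩ := (hg j).projLE (hg i).proj hne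
    have hpr := isStarProjection_mul_star (hg j).proj hu
    apply hij
    apply hr'
    refine ProjEquiv.symm ⟨u, hu, ?_⟩
    obtain ⟨d, hd⟩ := (hg i).scalar (u * star u)
    have h1 : u * star u = d • g i := by
      rw [← hd, ← mul_assoc, hgu]
      have : star u * g i = star u := by
        have := congrArg star hgu
        rwa [star_mul, (hg i).proj.isSelfAdjoint.star_eq] at this
      rw [mul_assoc, this]
    have h2 : (d * d) • g i = d • g i := by
      have := hpr.isIdempotentElem.eq
      rwa [h1, smul_mul_smul_comm, (hg i).proj.isIdempotentElem.eq] at this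
    have h3 := smul_left_injective ℂ (hg i).ne_zero h2
    have h4 : d ≠ 0 := by
      rintro rfl
      rw [zero_smul, CStarRing.mul_star_self_eq_zero_iff] at h1
      rw [h1, mul_zero] at hu
      exact (hg j).ne_zero hu.symm
    rw [h1, mul_left_cancel₀ h4 (h3.trans (mul_one d).symm), one_smul]
  refine ⟨N, r, g, v, hsys, fun i => (hg i).ne_zero, fun x => ?_⟩
  -- Within a class, transport g i x g j back to the corner of the representative, which is
  -- one-dimensional. Since the g i sum to 1, these pieces add up to x.
  have hcoef : ∀ i j, ∃ c : ℂ, g i * x * g j = c • IsUnitSystem.unit r v i j := by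
    intro i j
    by_cases hij : r i = r j
    · obtain ⟨c, hc⟩ := (hg (r i)).scalar (star (v i) * x * v j)
      refine ⟨c, ?_⟩
      have h1 : star (v i) * x * v j = c • g (r i) := by
        rw [← hc]
        conv_lhs => rw [← hsys.star_mul_left i, ← hsys.mul_right j, ← hij]
        simp only [mul_assoc]
      rw [← hv' i, ← hv' j, IsUnitSystem.unit, if_pos hij,
        show v i * star (v i) * x * (v j * star (v j)) =
          v i * (star (v i) * x * v j) * star (v j) by simp only [mul_assoc], h1, mul_smul_comm,
        smul_mul_assoc, hsys.mul_right]
    · exact ⟨0, by rw [zero_smul]; exact hzero i j x hij⟩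
  choose c hc using hcoef
  refine ⟨c, ?_⟩
  simp_rw [← hc]
  simp_rw [← Finset.mul_sum, hsum, mul_one, ← Finset.sum_mul, hsum, one_mul]

end Spanning

/-! ### Classification of AF-algebras by traces -/

section Elliott

variable {A B ι : Type*} [CStarAlgebra A] [CStarAlgebra B]

/-- The union of an increasing sequence of ⋆-subalgebras. -/
def unionSubalgebra (F : ℕ → StarSubalgebra ℂ A) (hF : Monotone F) : StarSubalgebra ℂ A where
  carrier := {x | ∃ n, x ∈ F n}
  mul_mem' := fun ⟨n, hn⟩ ⟨k, hk⟩ =>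
    ⟨max n k, mul_mem (hF (le_max_left n k) hn) (hF (le_max_right n k) hk)⟩
  add_mem' := fun ⟨n, hn⟩ ⟨k, hk⟩ =>
    ⟨max n k, add_mem (hF (le_max_left n k) hn) (hF (le_max_right n k) hk)⟩
  algebraMap_mem' := fun c => ⟨0, algebraMap_mem _ c⟩
  star_mem' := fun ⟨n, hn⟩ => ⟨n, star_mem hn⟩

/-- Projections of `U` with the same traces are equivalent in `U`. -/
def CancelsTraces (U : StarSubalgebra ℂ B) (ψ : ι → B →L[ℂ] ℂ) : Prop :=
  ∀ p ∈ U, ∀ q ∈ U, IsStarProjection p → IsStarProjection q → (∀ i, ψ i p = ψ i q) →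
    ∃ v ∈ U, star v * v = p ∧ v * star v = q

/-- Orthogonal decompositions of the trace vector of a projection of `W` into trace vectors of
projections of `U` lift to orthogonal decompositions of the projection. -/
def SplitsTraces (U : StarSubalgebra ℂ A) (φ : ι → A →L[ℂ] ℂ) (W : StarSubalgebra ℂ B)
    (ψ : ι → B →L[ℂ] ℂ) : Prop :=
  ∀ e ∈ U, ∀ e' ∈ U, IsStarProjection e → IsStarProjection e' → e * e' = 0 →
    ∀ q ∈ W, IsStarProjection q → (∀ i, ψ i q = φ i (e + e')) →
      ∃ f ∈ W, IsStarProjection f ∧ q * f = f ∧ ∀ i, ψ i f = φ i e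

theorem isStarProjection_sum {N : ℕ} {g : Fin N → A} (hg : ∀ i, IsStarProjection (g i))
    (horth : ∀ i j, i ≠ j → g i * g j = 0) : IsStarProjection (∑ i, g i) := by
  refine ⟨?_, ?_⟩
  · change (∑ i, g i) * (∑ i, g i) = _
    rw [Finset.sum_mul]
    refine Finset.sum_congr rfl fun i _ => ?_
    rw [Finset.mul_sum, Finset.sum_eq_single i]
    · exact (hg i).isIdempotentElem
    · intro j _ hj; exact horth i j (Ne.symm hj)
    · simp
  · change star (∑ i, g i) = _
    rw [star_sum]
    exact Finset.sum_congr rfl fun i _ => (hg i).isSelfAdjoint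

variable {U : StarSubalgebra ℂ A} {φ : ι → A →L[ℂ] ℂ} {W : StarSubalgebra ℂ B}
  {ψ : ι → B →L[ℂ] ℂ}

/-- Split the traces of g 0 off q, with the sum of the remaining g i as the complementary summand,
and induct. For the empty family q has the traces of 0, and cancellation forces q = 0. -/
theorem exists_family_of_traces (hC : CancelsTraces W ψ) (hD : SplitsTraces U φ W ψ) {N : ℕ}
    {g : Fin N → A} (hgU : ∀ i, g i ∈ U) (hg : ∀ i, IsStarProjection (g i))
    (horth : ∀ i j, i ≠ j → g i * g j = 0) {q : B} (hqW : q ∈ W) (hq : IsStarProjection q)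
    (hqg : ∀ i, ψ i q = φ i (∑ j, g j)) :
    ∃ f : Fin N → B, (∀ i, f i ∈ W) ∧ (∀ i, IsStarProjection (f i)) ∧
      (∀ i j, i ≠ j → f i * f j = 0) ∧ ∑ i, f i = q ∧ ∀ i j, ψ i (f j) = φ i (g j) := by
  induction N generalizing q with
  | zero =>
    obtain ⟨v, -, hv, hv'⟩ := hC q hqW 0 (zero_mem W) hq (IsStarProjection.zero B)
      (fun i => by rw [hqg]; simp)
    rw [CStarRing.mul_star_self_eq_zero_iff] at hv'
    rw [hv', mul_zero] at hv
    exact ⟨Fin.elim0, fun i => i.elim0, fun i => i.elim0, fun i => i.elim0, by simp [← hv],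
      fun _ i => i.elim0⟩
  | succ N ih =>
    have hs := isStarProjection_sum (g := fun i : Fin N => g i.succ) (fun i => hg i.succ)
      (fun i j hij => horth _ _ (fun h => hij (Fin.succ_injective _ h)))
    obtain ⟨f0, hf0W, hf0, hqf0, hψ0⟩ := hD (g 0) (hgU 0) (∑ i : Fin N, g i.succ)
      (sum_mem fun i _ => hgU _) (hg 0) hs (by
        rw [Finset.mul_sum]
        exact Finset.sum_eq_zero fun i _ => horth _ _ (Fin.succ_ne_zero i).symm) q hqW hq
      (fun i => by rw [hqg, Fin.sum_univ_succ])
    have hqf := isStarProjection_sub_of_le hq hf0 hqf0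
    have ff : f0 * f0 = f0 := hf0.isIdempotentElem
    obtain ⟨f, hfW, hf, hfo, hfs, hψ⟩ := ih (g := fun i => g i.succ) (fun i => hgU _)
      (fun i => hg _) (fun i j hij => horth _ _ (fun h => hij (Fin.succ_injective _ h)))
      (sub_mem hqW hf0W) hqf (fun i => by
        rw [map_sub, hqg, hψ0, Fin.sum_univ_succ, map_add, add_sub_cancel_left])
    have h0f : ∀ i, f0 * f i = 0 := by
      intro i
      have h1 : (q - f0) * f i = f i := by
        rw [← hfs, Finset.sum_mul, Finset.sum_eq_single i]
        · exact (hf i).isIdempotentElem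
        · intro j _ hj; exact hfo j i hj
        · simp
      rw [← h1, ← mul_assoc, mul_sub, mul_comm_of_le hq hf0 hqf0, ff, sub_self, zero_mul]
    have hf0' : ∀ i, f i * f0 = 0 := by
      intro i
      have := congrArg star (h0f i)
      rwa [star_mul, (hf i).isSelfAdjoint.star_eq, hf0.isSelfAdjoint.star_eq,
        star_zero] at this
    refine ⟨Fin.cons f0 f, fun i => ?_, fun i => ?_, fun i j => ?_, ?_, fun k i => ?_⟩
    · refine Fin.cases ?_ (fun i => ?_) i
      · simpa using hf0W
      · simpa using hfW i
    · refine Fin.cases ?_ (fun i => ?_) i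
      · simpa using hf0
      · simpa using hf i
    · refine Fin.cases ?_ (fun i => ?_) i <;> refine Fin.cases ?_ (fun j => ?_) j
      · simp
      · simp [h0f]
      · simp [hf0']
      · intro hij
        simpa using hfo i j (fun h => hij (by rw [h]))
    · rw [Fin.sum_univ_succ]
      simp [hfs]
    · refine Fin.cases ?_ (fun i => ?_) i
      · simpa using hψ0 k
      · simpa using hψ k i

variable {E : Type*} [CStarAlgebra E] [FiniteDimensional ℂ E]

/-- Existence: a finite-dimensional subalgebra maps with prescribed traces. -/
theorem exists_hom_of_traces (hφ : ∀ i x y, φ i (x * y) = φ i (y * x))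
    (hψ : ∀ i x y, ψ i (x * y) = ψ i (y * x)) (hone : ∀ i, ψ i 1 = φ i 1)
    (hC : CancelsTraces W ψ) (hD : SplitsTraces U φ W ψ) (κ : E →⋆ₐ[ℂ] A) (hκ : ∀ x, κ x ∈ U) :
    ∃ β : E →⋆ₐ[ℂ] B, (∀ x, β x ∈ W) ∧ ∀ i x, ψ i (β x) = φ i (κ x) := by
  obtain ⟨N, r, g, v, hs⟩ := exists_isSpanningSystem E
  obtain ⟨f, hfW, hf, hfo, hfs, hψf⟩ := exists_family_of_traces hC hD (g := fun i => κ (g i))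
    (fun i => hκ _) (fun i => (hs.proj i).map κ)
    (fun i j hij => by rw [← map_mul, hs.orth i j hij, map_zero]) (one_mem W)
    (IsStarProjection.one B) (fun i => by rw [← map_sum, hs.sum_eq, map_one κ, hone])
  -- The images of g (r i) and g i have equal traces because g (r i) and g i are equivalent in E;
  -- cancellation supplies the partial isometries of the target system.
  have hw : ∀ i, ∃ w ∈ W, star w * w = f (r i) ∧ w * star w = f i := fun i =>
    hC _ (hfW _) _ (hfW _) (hf _) (hf _) fun k => by
      rw [hψf, hψf, ← hs.star_mul, ← hs.mul_star, map_mul κ, map_mul κ, hφ]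
  choose w hwW hw1 hw2 using hw
  have hsys : IsUnitSystem r f w := ⟨hf, hfo, hfs, hw1, hw2⟩
  have hκsys : IsUnitSystem r (fun i => κ (g i)) (fun i => κ (v i)) :=
    ⟨fun i => (hs.proj i).map κ, fun i j hij => by rw [← map_mul, hs.orth i j hij, map_zero],
      by rw [← map_sum, hs.sum_eq, map_one], fun i => by rw [← map_star, ← map_mul, hs.star_mul],
      fun i => by rw [← map_star, ← map_mul, hs.mul_star]⟩
  obtain ⟨β, hβ⟩ := hs.exists_hom hsys
  have hκu : ∀ i j, κ (IsUnitSystem.unit r v i j) =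
      IsUnitSystem.unit r (fun i => κ (v i)) i j := by
    intro i j
    unfold IsUnitSystem.unit
    split_ifs
    · rw [map_mul, map_star]
    · exact map_zero κ
  refine ⟨β, fun x => ?_, fun k x => ?_⟩
  · obtain ⟨c, hc⟩ := hs.span x
    rw [hc]
    simp only [map_sum, map_smul, hβ]
    refine sum_mem fun i _ => sum_mem fun j _ => SMulMemClass.smul_mem _ ?_
    unfold IsUnitSystem.unit
    split_ifs
    · exact mul_mem (hwW i) (star_mem (hwW j))
    · exact zero_mem W
  · obtain ⟨c, hc⟩ := hs.span x
    rw [hc]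
    simp only [map_sum, map_smul, hβ, hκu, hsys.trace_unit (ψ k) (hψ k),
      hκsys.trace_unit (φ k) (hφ k), hψf]

/-- Uniqueness: homomorphisms with the same traces are unitarily equivalent. -/
theorem exists_unitary_of_traces (hC : CancelsTraces W ψ) (α β : E →⋆ₐ[ℂ] B)
    (hα : ∀ x, α x ∈ W) (hβ : ∀ x, β x ∈ W) (h : ∀ i x, ψ i (α x) = ψ i (β x)) :
    ∃ u ∈ W, star u * u = 1 ∧ u * star u = 1 ∧ ∀ x, u * β x = α x * u := by
  obtain ⟨N, r, g, v, hs⟩ := exists_isSpanningSystem E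
  have hw : ∀ i, ∃ w ∈ W, star w * w = β (g i) ∧ w * star w = α (g i) := fun i =>
    hC _ (hβ _) _ (hα _) ((hs.proj i).map β) ((hs.proj i).map α) fun k => (h k _).symm
  choose w hwW hw1 hw2 using hw
  have hwβ : ∀ i, w i * β (g i) = w i := fun i =>
    mul_eq_self_of_star_mul_self ((hs.proj i).map β) (hw1 i)
  have hwα : ∀ i, α (g i) * w i = w i := fun i =>
    mul_eq_self_of_mul_star ((hs.proj i).map α) (hw2 i)
  -- Each t i leads from β (g i) to α (g i) through the representative. Using only w (r i), rather
  -- than w i, makes the sum intertwine the off-diagonal units as well.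
  let t : Fin N → B := fun i => α (v i) * w (r i) * β (star (v i))
  have ht : ∀ i, t i = α (v i) * w (r i) * β (star (v i)) := fun _ => rfl
  have hts : ∀ i, star (t i) = β (v i) * star (w (r i)) * α (star (v i)) := fun i => by
    rw [ht, star_mul, star_mul, ← map_star, ← map_star, star_star]; simp only [mul_assoc]
  have hβo : ∀ i j, i ≠ j → β (star (v i)) * β (v j) = 0 := fun i j hij => by
    rw [← map_mul, hs.star_mul_of_ne hij, map_zero]
  have hαo : ∀ i j, i ≠ j → α (star (v i)) * α (v j) = 0 := fun i j hij => by
    rw [← map_mul, hs.star_mul_of_ne hij, map_zero]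
  refine ⟨∑ i, t i, sum_mem fun i _ => mul_mem (mul_mem (hα _) (hwW _)) (hβ _), ?_, ?_, ?_⟩
  · have h1 : ∀ i j, star (t i) * t j = if i = j then β (g i) else 0 := by
      intro i j
      rw [hts, ht, show β (v i) * star (w (r i)) * α (star (v i)) *
        (α (v j) * w (r j) * β (star (v j))) = β (v i) * star (w (r i)) *
        (α (star (v i)) * α (v j)) * w (r j) * β (star (v j)) by simp only [mul_assoc]]
      split_ifs with hij
      · subst hij
        rw [← map_mul, hs.star_mul, mul_assoc _ (α _), hwα, mul_assoc (β (v i)), hw1, ← map_mul,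
          hs.mul_right, ← map_mul, hs.mul_star]
      · rw [hαo i j hij]; simp
    simp only [star_sum, Finset.sum_mul, Finset.mul_sum, h1]
    simp [← map_sum, hs.sum_eq]
  · have h1 : ∀ i j, t i * star (t j) = if i = j then α (g i) else 0 := by
      intro i j
      rw [hts, ht, show α (v i) * w (r i) * β (star (v i)) *
        (β (v j) * star (w (r j)) * α (star (v j))) = α (v i) * w (r i) *
        (β (star (v i)) * β (v j)) * star (w (r j)) * α (star (v j)) by simp only [mul_assoc]]
      split_ifs with hij
      · subst hij
        rw [← map_mul, hs.star_mul, mul_assoc _ (w _), hwβ, mul_assoc (α (v i)), hw2, ← map_mul,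
          hs.mul_right, ← map_mul, hs.mul_star]
      · rw [hβo i j hij]; simp
    simp only [star_sum, Finset.sum_mul, Finset.mul_sum, h1]
    simp [← map_sum, hs.sum_eq]
  · have key : ∀ k l, (∑ i, t i) * β (IsUnitSystem.unit r v k l) =
        α (IsUnitSystem.unit r v k l) * ∑ i, t i := by
      intro k l
      by_cases hkl : r k = r l
      · rw [IsUnitSystem.unit, if_pos hkl, map_mul, map_mul, Finset.sum_mul, Finset.mul_sum,
          Finset.sum_eq_single k, Finset.sum_eq_single l]
        · rw [ht, ht, show α (v k) * w (r k) * β (star (v k)) * (β (v k) * β (star (v l))) =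
            α (v k) * w (r k) * (β (star (v k)) * β (v k)) * β (star (v l)) by
              simp only [mul_assoc],
            show α (v k) * α (star (v l)) * (α (v l) * w (r l) * β (star (v l))) =
            α (v k) * ((α (star (v l)) * α (v l)) * w (r l)) * β (star (v l)) by
              simp only [mul_assoc], ← map_mul, ← map_mul, hs.star_mul, hs.star_mul, hwα,
            mul_assoc (α (v k)), hwβ, hkl]
        · intro i _ hi
          rw [ht, show α (v k) * α (star (v l)) * (α (v i) * w (r i) * β (star (v i))) =
            α (v k) * (α (star (v l)) * α (v i)) * w (r i) * β (star (v i)) by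
              simp only [mul_assoc], hαo l i (Ne.symm hi)]
          simp
        · simp
        · intro i _ hi
          rw [ht, show α (v i) * w (r i) * β (star (v i)) * (β (v k) * β (star (v l))) =
            α (v i) * w (r i) * (β (star (v i)) * β (v k)) * β (star (v l)) by
              simp only [mul_assoc], hβo i k hi]
          simp
        · simp
      · rw [IsUnitSystem.unit, if_neg hkl]
        simp
    intro x
    obtain ⟨c, hc⟩ := hs.span x
    have e1 : β x = ∑ i, ∑ j, c i j • β (IsUnitSystem.unit r v i j) := by
      conv_lhs => rw [hc]
      simp only [map_sum, map_smul]
    have e2 : α x = ∑ i, ∑ j, c i j • α (IsUnitSystem.unit r v i j) := by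
      conv_lhs => rw [hc]
      simp only [map_sum, map_smul]
    rw [e1, e2, Finset.mul_sum, Finset.sum_mul]
    refine Finset.sum_congr rfl fun i _ => ?_
    rw [Finset.mul_sum, Finset.sum_mul]
    refine Finset.sum_congr rfl fun j _ => ?_
    rw [mul_smul_comm, key, smul_mul_assoc]

theorem exists_stage {F : ℕ → StarSubalgebra ℂ B} (hF : Monotone F) (β : E →⋆ₐ[ℂ] B)
    (hβ : ∀ x, β x ∈ unionSubalgebra F hF) : ∃ n, ∀ x, β x ∈ F n := by
  let b := Module.finBasis ℂ E
  choose n hn using fun i => hβ (b i)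
  refine ⟨Finset.univ.sup n, fun x => ?_⟩
  rw [← b.sum_repr x, map_sum]
  refine sum_mem fun i _ => ?_
  rw [map_smul]
  exact SMulMemClass.smul_mem _ (hF (Finset.le_sup (Finset.mem_univ i)) (hn i))

end Elliott

/-! ### Elliott's intertwining argument. -/

section Intertwining

variable {A B ι : Type*} [CStarAlgebra A] [CStarAlgebra B]
  {F : ℕ → StarSubalgebra ℂ A} {G : ℕ → StarSubalgebra ℂ B}
  {φ : ι → A →L[ℂ] ℂ} {ψ : ι → B →L[ℂ] ℂ}

/-- A trace preserving homomorphism of a finite stage has a trace preserving left inverse on a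
finite stage containing its range. -/
theorem exists_left_inverse (hF : IsAFChain F) (hG : IsAFChain G)
    (hφ : ∀ i x y, φ i (x * y) = φ i (y * x)) (hψ : ∀ i x y, ψ i (x * y) = ψ i (y * x))
    (hone : ∀ i, ψ i 1 = φ i 1) (hC : CancelsTraces (unionSubalgebra F hF.mono) φ)
    (hD : SplitsTraces (unionSubalgebra G hG.mono) ψ (unionSubalgebra F hF.mono) φ)
    {n m : ℕ} (k : ℕ) (α : F n →⋆ₐ[ℂ] B) (hα : ∀ x, α x ∈ G m)
    (hαφ : ∀ i x, ψ i (α x) = φ i x) :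
    ∃ n', k ≤ n' ∧ ∃ β : G m →⋆ₐ[ℂ] A, (∀ y, β y ∈ F n') ∧ (∀ i y, φ i (β y) = ψ i y) ∧
      ∀ x, β ⟨α x, hα x⟩ = x := by
  have := hF.finite n
  have := isClosed_of_finiteDimensional (F n) this
  have := hG.finite m
  have := isClosed_of_finiteDimensional (G m) this
  obtain ⟨β₀, hβ₀, hβφ⟩ := exists_hom_of_traces (E := G m) hψ hφ (fun i => (hone i).symm) hC hD
    (G m).subtype (fun x => ⟨m, x.2⟩)
  let γ : F n →⋆ₐ[ℂ] A := β₀.comp (α.codRestrict (G m) hα)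
  have hγ : ∀ x, γ x = β₀ ⟨α x, hα x⟩ := fun _ => rfl
  -- β₀ ∘ α and the inclusion have the same traces, so a unitary u of the union conjugates one to
  -- the other. Conjugating β₀ by u gives the left inverse; as u lies in the union, the range stays
  -- in a finite stage.
  obtain ⟨u, huU, hu1, hu2, hu⟩ := exists_unitary_of_traces (E := F n) hC (F n).subtype γ
    (fun x => ⟨n, x.2⟩) (fun x => hβ₀ _) (fun i x => by
      rw [hγ, hβφ]
      exact (hαφ i x).symm)
  let w : unitary A := ⟨u, hu1, hu2⟩
  let β : G m →⋆ₐ[ℂ] A := (Unitary.conjStarAlgAut ℂ A w : A →⋆ₐ[ℂ] A).comp β₀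
  have hβ : ∀ y, β y = u * β₀ y * star u := fun _ => rfl
  obtain ⟨n', hn'⟩ := exists_stage (E := G m) hF.mono β fun y => by
    rw [hβ]
    exact mul_mem (mul_mem huU (hβ₀ y)) (star_mem huU)
  refine ⟨max k n', le_max_left _ _, β, fun y => hF.mono (le_max_right k n') (hn' y), ?_, ?_⟩
  · intro i y
    rw [hβ, mul_assoc, hφ, mul_assoc, hu1, mul_one, hβφ]
    rfl
  · intro x
    rw [hβ, ← hγ, hu, mul_assoc, hu2, mul_one]
    rfl

/-- A trace preserving homomorphism from a finite stage of `A` to the union of the stages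
of `B`. -/
structure StageHom (F : ℕ → StarSubalgebra ℂ A) (G : ℕ → StarSubalgebra ℂ B)
    (φ : ι → A →L[ℂ] ℂ) (ψ : ι → B →L[ℂ] ℂ) where
  stage : ℕ
  hom : F stage →⋆ₐ[ℂ] B
  mem : ∃ m, ∀ x, hom x ∈ G m
  trace : ∀ i x, ψ i (hom x) = φ i x

/-- `t` extends `s` to a larger stage, and its range is larger, too. -/
structure StageHom.Extends (s t : StageHom F G φ ψ) : Prop where
  lt : s.stage < t.stage
  injective : Function.Injective s.hom
  eq : ∀ x (h : x ∈ F s.stage) (h' : x ∈ F t.stage), t.hom ⟨x, h'⟩ = s.hom ⟨x, h⟩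
  range : ∀ y ∈ G s.stage, ∃ x, t.hom x = y

/-- Let β be a left inverse of `s.hom` and α' a left inverse of β. Then α' extends `s.hom` because x
= β (s.hom x), and its range contains the domain stage of β because α' ∘ β is the identity there. -/
theorem StageHom.exists_extends (hF : IsAFChain F) (hG : IsAFChain G)
    (hφ : ∀ i x y, φ i (x * y) = φ i (y * x)) (hψ : ∀ i x y, ψ i (x * y) = ψ i (y * x))
    (hone : ∀ i, ψ i 1 = φ i 1) (hCA : CancelsTraces (unionSubalgebra F hF.mono) φ)
    (hCB : CancelsTraces (unionSubalgebra G hG.mono) ψ)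
    (hAB : SplitsTraces (unionSubalgebra F hF.mono) φ (unionSubalgebra G hG.mono) ψ)
    (hBA : SplitsTraces (unionSubalgebra G hG.mono) ψ (unionSubalgebra F hF.mono) φ)
    (s : StageHom F G φ ψ) : ∃ t : StageHom F G φ ψ, s.Extends t := by
  obtain ⟨m₀, hm₀⟩ := s.mem
  obtain ⟨m, hnm, hm⟩ : ∃ m, s.stage ≤ m ∧ ∀ x, s.hom x ∈ G m :=
    ⟨max s.stage m₀, le_max_left _ _, fun x => hG.mono (le_max_right _ _) (hm₀ x)⟩
  obtain ⟨n', hn', β, hβF, hβφ, hβα⟩ := exists_left_inverse hF hG hφ hψ hone hCA hBA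
    (s.stage + 1) s.hom hm s.trace
  obtain ⟨m', -, α', hα'G, hα'ψ, hαβ⟩ := exists_left_inverse hG hF hψ hφ (fun i => (hone i).symm)
    hCB hAB 0 β hβF hβφ
  refine ⟨⟨n', α', ⟨m', hα'G⟩, hα'ψ⟩, hn', ?_, ?_, ?_⟩
  · intro x y hxy
    refine Subtype.ext ?_
    rw [← hβα x, ← hβα y]
    congr 2
  · intro x h h'
    have e : (⟨x, h'⟩ : F n') = ⟨β ⟨s.hom ⟨x, h⟩, hm _⟩, hβF _⟩ := Subtype.ext (hβα ⟨x, h⟩).symm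
    change α' ⟨x, h'⟩ = _
    rw [e, hαβ]
  · intro y hy
    exact ⟨⟨β ⟨y, hG.mono hnm hy⟩, hβF _⟩, hαβ _⟩

/-- **Elliott's theorem for AF-algebras whose projections are classified by traces.** -/
theorem exists_bijective_hom_of_traces (hF : IsAFChain F) (hG : IsAFChain G)
    (hφ : ∀ i x y, φ i (x * y) = φ i (y * x)) (hψ : ∀ i x y, ψ i (x * y) = ψ i (y * x))
    (hone : ∀ i, ψ i 1 = φ i 1) (hCA : CancelsTraces (unionSubalgebra F hF.mono) φ)
    (hCB : CancelsTraces (unionSubalgebra G hG.mono) ψ)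
    (hAB : SplitsTraces (unionSubalgebra F hF.mono) φ (unionSubalgebra G hG.mono) ψ)
    (hBA : SplitsTraces (unionSubalgebra G hG.mono) ψ (unionSubalgebra F hF.mono) φ) :
    ∃ Φ : A →⋆ₐ[ℂ] B, Function.Bijective Φ ∧ ∀ i x, ψ i (Φ x) = φ i x := by
  set U := unionSubalgebra F hF.mono with hU
  have hstart : ∃ _s : StageHom F G φ ψ, True := by
    have := hF.finite 0
    have := isClosed_of_finiteDimensional (F 0) this
    obtain ⟨β, hβ, hβφ⟩ := exists_hom_of_traces (E := F 0) hφ hψ hone hCB hAB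
      (F 0).subtype (fun x => ⟨0, x.2⟩)
    exact ⟨⟨0, β, exists_stage (E := F 0) hG.mono β hβ, hβφ⟩, trivial⟩
  obtain ⟨s₀, -⟩ := hstart
  choose next hnext using
    StageHom.exists_extends hF hG hφ hψ hone hCA hCB hAB hBA
  let s : ℕ → StageHom F G φ ψ := fun k => Nat.rec s₀ (fun _ t => next t) k
  have hs : ∀ k, (s k).Extends (s (k + 1)) := fun k => hnext (s k)
  have hmono : StrictMono fun k => (s k).stage := strictMono_nat_of_lt_succ fun k => (hs k).lt
  have hcoh : ∀ k l, k ≤ l → ∀ x (h : x ∈ F (s k).stage) (h' : x ∈ F (s l).stage),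
      (s l).hom ⟨x, h'⟩ = (s k).hom ⟨x, h⟩ := by
    intro k l hkl
    induction l, hkl using Nat.le_induction with
    | base => intro x h h'; rfl
    | succ l hkl ih =>
      intro x h h'
      have hl : x ∈ F (s l).stage := hF.mono (hmono.monotone hkl) h
      rw [(hs l).eq x hl h', ih x h hl]
  have hmem : ∀ x : U, ∃ k, x.1 ∈ F (s k).stage := fun x => by
    obtain ⟨n, hn⟩ := x.2
    exact ⟨n, hF.mono (hmono.id_le n) hn⟩
  choose d hd using hmem
  let f : U → B := fun x => (s (d x)).hom ⟨x, hd x⟩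
  have hf : ∀ (x : U) k (h : x.1 ∈ F (s k).stage), f x = (s k).hom ⟨x, h⟩ := by
    intro x k h
    rcases le_total (d x) k with hle | hle
    · exact (hcoh _ _ hle x (hd x) h).symm
    · exact hcoh _ _ hle x h (hd x)
  have hmem2 : ∀ x y : U, ∃ k, x.1 ∈ F (s k).stage ∧ y.1 ∈ F (s k).stage := fun x y =>
    ⟨max (d x) (d y), hF.mono (hmono.monotone (le_max_left _ _)) (hd x),
      hF.mono (hmono.monotone (le_max_right _ _)) (hd y)⟩
  have fmul : ∀ x y, f (x * y) = f x * f y := by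
    intro x y
    obtain ⟨k, hx, hy⟩ := hmem2 x y
    rw [hf x k hx, hf y k hy, hf (x * y) k (mul_mem hx hy), ← map_mul]
    rfl
  have fadd : ∀ x y, f (x + y) = f x + f y := by
    intro x y
    obtain ⟨k, hx, hy⟩ := hmem2 x y
    rw [hf x k hx, hf y k hy, hf (x + y) k (add_mem hx hy), ← map_add]
    rfl
  have fsmul : ∀ (c : ℂ) x, f (c • x) = c • f x := by
    intro c x
    rw [hf (c • x) (d x) (SMulMemClass.smul_mem c (hd x)), hf x _ (hd x), ← map_smul]
    rfl
  have fstar : ∀ x, f (star x) = star (f x) := by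
    intro x
    rw [hf (star x) (d x) (star_mem (hd x)), hf x _ (hd x), ← map_star]
    rfl
  have fone : f 1 = 1 := by
    rw [hf 1 0 (one_mem _), ← map_one (s 0).hom]
    rfl
  -- Each homomorphism of the sequence is injective, since it has a left inverse, and injective
  -- ⋆-homomorphisms of C⋆-algebras are isometric. Hence f extends to A by continuity.
  have fnorm : ∀ x : U, ‖f x‖ = ‖(x : A)‖ := by
    intro x
    have := hF.finite (s (d x)).stage
    have := isClosed_of_finiteDimensional (F (s (d x)).stage) this
    exact NonUnitalStarAlgHom.norm_map (s (d x)).hom (hs (d x)).injective ⟨x, hd x⟩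
  let L : U →ₗ[ℂ] B := { toFun := f, map_add' := fadd, map_smul' := fsmul }
  let J : U →ₗ[ℂ] A := U.toSubalgebra.toSubmodule.subtype
  have hJ : DenseRange J := by
    have : Set.range J = ⋃ n, (F n : Set A) := by
      ext x
      constructor
      · rintro ⟨y, rfl⟩
        exact Set.mem_iUnion.2 y.2
      · intro hx
        exact ⟨⟨x, Set.mem_iUnion.1 hx⟩, rfl⟩
    rw [DenseRange, this]
    exact hF.dense
  have hLJ : ∃ C, ∀ x, ‖L x‖ ≤ C * ‖J x‖ := ⟨1, fun x => by rw [one_mul]; exact (fnorm x).le⟩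
  let Φ : A →L[ℂ] B := L.extendOfNorm J
  have hΦ : ∀ x : U, Φ x = f x := fun x => LinearMap.extendOfNorm_eq hJ hLJ x
  have hind : ∀ P : A → Prop, IsClosed {x | P x} → (∀ x : U, P x) → ∀ x, P x := by
    intro P hP h x
    exact hJ.induction_on (p := P) x hP h
  have hΦnorm : ∀ x, ‖Φ x‖ = ‖x‖ := hind _ (isClosed_eq (by fun_prop) (by fun_prop))
    fun x => by rw [hΦ, fnorm]
  have hΦmul : ∀ x y, Φ (x * y) = Φ x * Φ y := by
    have h1 : ∀ (x : U) y, Φ (x * y) = Φ x * Φ y := fun x =>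
      hind _ (isClosed_eq (by fun_prop) (by fun_prop)) fun y => by
        rw [hΦ, hΦ, ← fmul, ← hΦ]; rfl
    intro x y
    exact hind (fun x => Φ (x * y) = Φ x * Φ y) (isClosed_eq (by fun_prop) (by fun_prop))
      (fun x => h1 x y) x
  have hΦstar : ∀ x, Φ (star x) = star (Φ x) := hind _ (isClosed_eq (by fun_prop) (by fun_prop))
    fun x => by rw [hΦ, ← fstar, ← hΦ]; rfl
  have hΦone : Φ 1 = 1 := by rw [← fone, ← hΦ]; rfl
  let Ψ : A →⋆ₐ[ℂ] B :=
    { AlgHom.ofLinearMap (Φ : A →ₗ[ℂ] B) hΦone hΦmul with map_star' := hΦstar }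
  have hΨ : ∀ x, Ψ x = Φ x := fun _ => rfl
  have hiso : Isometry Φ := AddMonoidHomClass.isometry_of_norm Φ hΦnorm
  refine ⟨Ψ, ⟨hiso.injective, ?_⟩, ?_⟩
  -- An isometric image of a complete space is closed, and this one contains every stage of B.
  · have hcl : IsClosed (Set.range Φ) := hiso.isClosedEmbedding.isClosed_range
    have hsub : (⋃ n, (G n : Set B)) ⊆ Set.range Φ := by
      intro y hy
      obtain ⟨n, hn⟩ := Set.mem_iUnion.1 hy
      obtain ⟨x, hx⟩ := (hs n).range y (hG.mono (hmono.id_le n) hn)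
      refine ⟨x, ?_⟩
      rw [← hx]
      exact (hΦ ⟨x, ⟨_, x.2⟩⟩).trans (hf ⟨x, ⟨_, x.2⟩⟩ (n + 1) x.2)
    have := hG.dense.closure_eq ▸ closure_minimal hsub hcl
    exact fun y => this (Set.mem_univ y)
  · intro i
    refine hind (fun x => ψ i (Ψ x) = φ i x) ?_ ?_
    · exact isClosed_eq ((ψ i).continuous.comp Φ.continuous) (φ i).continuous
    · intro x
      rw [hΨ, hΦ]
      exact (s (d x)).trace i ⟨x, hd x⟩

end Intertwining

/-! ### Corners -/

section Corner

variable {A : Type*} [CStarAlgebra A] {p : A}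

/-- The corner `p A p`, as a non-unital ⋆-subalgebra. -/
def cornerSubalgebra (hp : IsStarProjection p) : NonUnitalStarSubalgebra ℂ A where
  carrier := {x | p * x = x ∧ x * p = x}
  mul_mem' := fun {x y} hx hy => ⟨by rw [← mul_assoc, hx.1], by rw [mul_assoc, hy.2]⟩
  add_mem' := fun {x y} hx hy => ⟨by rw [mul_add, hx.1, hy.1], by rw [add_mul, hx.2, hy.2]⟩
  zero_mem' := ⟨mul_zero _, zero_mul _⟩
  smul_mem' := fun c x hx => ⟨by rw [mul_smul_comm, hx.1], by rw [smul_mul_assoc, hx.2]⟩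
  star_mem' := fun {x} hx => by
    have hs : star p = p := hp.isSelfAdjoint
    constructor
    · have := congrArg star hx.2
      rwa [star_mul, hs] at this
    · have := congrArg star hx.1
      rwa [star_mul, hs] at this

instance isClosed_cornerSubalgebra (hp : IsStarProjection p) :
    IsClosed (cornerSubalgebra hp : Set A) :=
  (isClosed_eq (continuous_const_mul p) continuous_id).inter
    (isClosed_eq (continuous_mul_const p) continuous_id)

/-- The corner `p A p`, with unit `p`. -/
def Corner (hp : IsStarProjection p) : Type _ := cornerSubalgebra hp

variable (hp : IsStarProjection p)

noncomputable instance : NonUnitalCStarAlgebra (Corner hp) :=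
  inferInstanceAs (NonUnitalCStarAlgebra (cornerSubalgebra hp))

noncomputable instance : One (Corner hp) :=
  ⟨⟨p, hp.isIdempotentElem, hp.isIdempotentElem⟩⟩

noncomputable instance : NormedRing (Corner hp) where
  __ := (inferInstance : NonUnitalNormedRing (Corner hp))
  __ := (inferInstance : One (Corner hp))
  one_mul := fun x => Subtype.ext x.2.1
  mul_one := fun x => Subtype.ext x.2.2

noncomputable instance : Algebra ℂ (Corner hp) :=
  Algebra.ofModule (fun c x y => smul_mul_assoc c x y) (fun c x y => mul_smul_comm c x y)

noncomputable instance : NormedAlgebra ℂ (Corner hp) where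
  norm_smul_le := fun c x => norm_smul_le c (x : cornerSubalgebra hp)

noncomputable instance : CStarAlgebra (Corner hp) where
  star_mul := fun x y => star_mul x y
  star_add := fun x y => star_add x y
  star_involutive := fun x => star_star x
  norm_mul_self_le := fun x => CStarRing.norm_mul_self_le x
  star_smul := fun c x => star_smul c x

/-- The inclusion of a corner. -/
def Corner.incl : Corner hp →⋆ₙₐ[ℂ] A where
  toFun x := x.1
  map_smul' _ _ := rfl
  map_zero' := rfl
  map_add' _ _ := rfl
  map_mul' _ _ := rfl
  map_star' _ := rfl

variable {hp}

theorem Corner.incl_injective : Function.Injective (Corner.incl hp) := Subtype.val_injective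

theorem Corner.incl_one : Corner.incl hp 1 = p := rfl

theorem Corner.mul_incl (x : Corner hp) : p * Corner.incl hp x = Corner.incl hp x := x.2.1

theorem Corner.incl_mul (x : Corner hp) : Corner.incl hp x * p = Corner.incl hp x := x.2.2

theorem Corner.exists_incl_eq {x : A} (h : p * x = x) (h' : x * p = x) :
    ∃ y : Corner hp, Corner.incl hp y = x := ⟨⟨x, h, h'⟩, rfl⟩

theorem Corner.range_incl : Set.range (Corner.incl hp) = {x | p * x * p = x} := by
  have pp : p * p = p := hp.isIdempotentElem
  ext x
  constructor
  · rintro ⟨y, rfl⟩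
    change p * _ * p = _
    rw [Corner.mul_incl, Corner.incl_mul]
  · intro (h : p * x * p = x)
    refine Corner.exists_incl_eq ?_ ?_
    · rw [← h, ← mul_assoc, ← mul_assoc, pp]
    · rw [← h, mul_assoc, pp]

theorem Corner.continuous_incl : Continuous (Corner.incl hp) := continuous_subtype_val

theorem Corner.isStarProjection_incl_iff {x : Corner hp} :
    IsStarProjection (Corner.incl hp x) ↔ IsStarProjection x :=
  ⟨fun h => ⟨Corner.incl_injective (by rw [map_mul]; exact h.1),
    Corner.incl_injective (by rw [map_star]; exact h.2)⟩, fun h => h.map _⟩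

variable (hp) in
/-- The ⋆-subalgebra of a corner cut out by a ⋆-subalgebra which contains the unit `p`. -/
noncomputable def cornerRestrict (S : StarSubalgebra ℂ A) (hpS : p ∈ S) :
    StarSubalgebra ℂ (Corner hp) where
  carrier := {x | Corner.incl hp x ∈ S}
  mul_mem' := fun {x y} hx hy => by
    change Corner.incl hp (x * y) ∈ S
    rw [map_mul]; exact mul_mem hx hy
  add_mem' := fun {x y} hx hy => by
    change Corner.incl hp (x + y) ∈ S
    rw [map_add]; exact add_mem hx hy
  algebraMap_mem' := fun c => by
    change Corner.incl hp (algebraMap ℂ _ c) ∈ S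
    rw [Algebra.algebraMap_eq_smul_one, map_smul]
    exact S.smul_mem hpS c
  star_mem' := fun {x} hx => by
    change Corner.incl hp (star x) ∈ S
    rw [map_star]; exact star_mem hx

/-- Start the chain where p appears. The compression x ↦ pxp is continuous, maps A onto the corner
and preserves the later stages, so density carries over. -/
theorem IsAFChain.corner {F : ℕ → StarSubalgebra ℂ A} (hF : IsAFChain F) {n₀ : ℕ}
    (hpF : p ∈ F n₀) :
    IsAFChain fun n => cornerRestrict hp (F (n₀ + n)) (hF.mono (Nat.le_add_right n₀ n) hpF) where
  mono := fun k l hkl x hx => hF.mono (Nat.add_le_add_left hkl n₀) hx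
  finite := fun n => by
    have := hF.finite (n₀ + n)
    let f : cornerRestrict hp (F (n₀ + n)) (hF.mono (Nat.le_add_right n₀ n) hpF) →ₗ[ℂ]
        F (n₀ + n) :=
      { toFun := fun x => ⟨Corner.incl hp x.1, x.2⟩
        map_add' := fun _ _ => rfl
        map_smul' := fun _ _ => rfl }
    refine Module.Finite.of_injective f fun x y h => Subtype.ext ?_
    have h' : Corner.incl hp x.1 = Corner.incl hp y.1 :=
      congrArg (fun z : F (n₀ + n) => (z : A)) h
    exact Corner.incl_injective h'
  dense := by
    have pp : p * p = p := hp.isIdempotentElem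
    let c : A → Corner hp := fun x => ⟨p * x * p, by rw [← mul_assoc, ← mul_assoc, pp],
      by rw [mul_assoc, pp]⟩
    have hc : Continuous c :=
      Continuous.subtype_mk ((continuous_const_mul p).mul continuous_const) _
    have hs : Function.Surjective c := fun y => by
      refine ⟨Corner.incl hp y, Corner.incl_injective ?_⟩
      change p * Corner.incl hp y * p = _
      rw [Corner.mul_incl, Corner.incl_mul]
    refine (hs.denseRange.dense_image hc hF.dense).mono ?_
    rintro _ ⟨x, hx, rfl⟩
    obtain ⟨n, hn⟩ := Set.mem_iUnion.1 hx
    refine Set.mem_iUnion.2 ⟨n, ?_⟩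
    change p * x * p ∈ F (n₀ + n)
    have h0 := hF.mono (Nat.le_add_right n₀ n) hpF
    exact mul_mem (mul_mem h0 (hF.mono (Nat.le_add_left n n₀) hn)) h0

end Corner

/-! ### Trace vectors of projections -/

section TraceVectors

variable {A : Type*} [CStarAlgebra A] {m n : Type*} [Fintype m] [Fintype n]

theorem matTrace_nonneg {τ : traceSpace A} (hτ : τ ∈ tracialStates A) {p : Matrix m m A}
    (hp : IsStarProjection p) : 0 ≤ matTrace τ p := by
  have h : pᴴ * p = p := by
    rw [show pᴴ = p from hp.isSelfAdjoint]
    exact hp.isIdempotentElem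
  rw [← h]
  simp only [matTrace, Matrix.mul_apply, Matrix.conjTranspose_apply, map_sum]
  exact Finset.sum_nonneg fun i _ => Finset.sum_nonneg fun j _ => hτ.1 _

theorem ofReal_re_matTrace {τ : traceSpace A} (hτ : τ ∈ tracialStates A) {p : Matrix m m A}
    (hp : IsStarProjection p) : ((matTrace τ p).re : ℂ) = matTrace τ p :=
  Complex.ext rfl (Complex.le_def.1 (matTrace_nonneg hτ hp)).2

theorem matTrace_add (τ : traceSpace A) (p q : Matrix m m A) :
    matTrace τ (p + q) = matTrace τ p + matTrace τ q := by
  simp [matTrace, Finset.sum_add_distrib]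

theorem matTrace_fromBlocks (τ : traceSpace A) (p : Matrix m m A) (q : Matrix n n A) :
    matTrace τ (Matrix.fromBlocks p 0 0 q) = matTrace τ p + matTrace τ q := by
  simp [matTrace]

theorem matTrace_diagonal [DecidableEq m] (τ : traceSpace A) (x : A) :
    matTrace τ (Matrix.diagonal fun _ : m => x) = Fintype.card m * τ.1 x := by
  simp [matTrace]

theorem isStarProjection_diagonal [DecidableEq m] {p : A} (hp : IsStarProjection p) :
    IsStarProjection (Matrix.diagonal fun _ : m => p) := by
  refine ⟨?_, ?_⟩
  · change (Matrix.diagonal fun _ : m => p) * (Matrix.diagonal fun _ : m => p) = _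
    rw [Matrix.diagonal_mul_diagonal]
    simp only [hp.isIdempotentElem.eq]
  · change (Matrix.diagonal fun _ : m => p)ᴴ = _
    rw [Matrix.diagonal_conjTranspose]
    congr 1
    exact funext fun _ => hp.isSelfAdjoint

/-- Every projection in a matrix algebra is equivalent to one indexed by `Fin k`. -/
theorem exists_matProj_mvN {p : Matrix m m A} (hp : IsStarProjection p) :
    ∃ q : MatProj A, MvN p q.2.1 :=
  ⟨⟨Fintype.card m, _, isStarProjection_reindex (Fintype.equivFin m) hp⟩,
    MvN.reindex (Fintype.equivFin m) hp⟩

variable {k : ℕ} {φ : Fin k → traceSpace A}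

/-- The vectors `((Tr ⊗ φ₁)(p), …, (Tr ⊗ φₖ)(p))`, for the projections `p` over `A`. -/
def traceVectors (φ : Fin k → traceSpace A) : Set (Fin k → ℝ) :=
  {x | ∃ p : MatProj A, ∀ i, matTrace (φ i) p.2.1 = x i}

theorem mem_traceVectors {p : Matrix m m A} (hp : IsStarProjection p) {x : Fin k → ℝ}
    (h : ∀ i, matTrace (φ i) p = x i) : x ∈ traceVectors φ := by
  obtain ⟨q, hq⟩ := exists_matProj_mvN hp
  exact ⟨q, fun i => (hq.matTrace_eq (φ i)).symm.trans (h i)⟩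

theorem re_matTrace_mem_traceVectors (hφ : ∀ i, φ i ∈ tracialStates A) {p : Matrix m m A}
    (hp : IsStarProjection p) : (fun i => (matTrace (φ i) p).re) ∈ traceVectors φ :=
  mem_traceVectors hp fun i => (ofReal_re_matTrace (hφ i) hp).symm

theorem nonneg_of_mem_traceVectors (hφ : ∀ i, φ i ∈ tracialStates A) {x : Fin k → ℝ}
    (hx : x ∈ traceVectors φ) (i : Fin k) : 0 ≤ x i := by
  obtain ⟨p, hp⟩ := hx
  have := matTrace_nonneg (hφ i) p.2.2
  rw [hp i] at this
  exact_mod_cast this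

theorem one_mem_traceVectors (hφ : ∀ i, φ i ∈ tracialStates A) : 1 ∈ traceVectors φ :=
  mem_traceVectors (IsStarProjection.one (Matrix (Fin 1) (Fin 1) A)) fun i => by
    simp [matTrace, (hφ i).2]

theorem Gam_mk (p : MatProj A) (i : Fin k) :
    Gam φ (K0.mk p) i = (matTrace (φ i) p.2.1).re :=
  congrArg Complex.re (traceK0_mk (φ i) p)

/-- Projections with the same traces are equivalent, if `K₀(A)` embeds on `ℝⁿ`. -/
theorem mvN_of_matTrace_eq (hA : IsAF A) (hφ : HasK0Embedding φ) {p : Matrix m m A}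
    {q : Matrix n n A} (hp : IsStarProjection p) (hq : IsStarProjection q)
    (h : ∀ i, matTrace (φ i) p = matTrace (φ i) q) : MvN p q := by
  obtain ⟨p', hp'⟩ := exists_matProj_mvN hp
  obtain ⟨q', hq'⟩ := exists_matProj_mvN hq
  have key : MvN p'.2.1 q'.2.1 := mvN_of_K0_eq hA <| hφ.1 <| funext fun i => by
    rw [Gam_mk, Gam_mk, ← hp'.matTrace_eq, ← hq'.matTrace_eq, h]
  exact MvN.trans hp hq hp' (MvN.trans p'.2.2 hq key hq'.symm)

/-- Comparison of projections over an AF-algebra with two extremal traces. -/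
theorem exists_partialIsometry_of_matTrace_lt (hA : IsAF A) [FiniteDimensional ℂ (traceSpace A)]
    {φ : Fin 2 → traceSpace A} (hφ : EnumeratesExtremalTraces φ) {p : Matrix m m A}
    {q : Matrix n n A} (hp : IsStarProjection p) (hq : IsStarProjection q)
    (h : ∀ i, (matTrace (φ i) q).re < (matTrace (φ i) p).re) :
    ∃ v : Matrix m n A, vᴴ * v = q ∧ p * v = v ∧ v * q = v := by
  classical
  let _ := CStarAlgebra.spectralOrder A
  have := CStarAlgebra.spectralOrderedRing A
  obtain ⟨F, hF⟩ := hA.exists_chain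
  let J : Matrix (m ⊕ n) m A := indexIsometry A Sum.inl
  let K : Matrix (m ⊕ n) n A := indexIsometry A Sum.inr
  have hJ : Jᴴ * J = 1 := indexIsometry_conjTranspose_mul Sum.inl_injective
  have hK : Kᴴ * K = 1 := indexIsometry_conjTranspose_mul Sum.inr_injective
  have tp := fun τ => (mvN_embedMatrix (A := A) (m := m ⊕ n) Sum.inl_injective hp).matTrace_eq τ
  have tq := fun τ => (mvN_embedMatrix (A := A) (m := m ⊕ n) Sum.inr_injective hq).matTrace_eq τ
  -- Place p and q in disjoint blocks of one matrix algebra. Its tracial states are normalized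
  -- matrix traces of convex combinations of φ 0 and φ 1, so the strict inequalities at the two
  -- extremal traces suffice.
  have hle : ProjLE (CStarMatrix.ofMatrix (embedMatrix (Sum.inr : n → m ⊕ n) q))
      (CStarMatrix.ofMatrix (embedMatrix (Sum.inl : m → m ⊕ n) p)) := by
    refine (hF.matSubalgebra (m := m ⊕ n)).projLE_of_forall_lt
      (isStarProjection_ofMatrix.2 (isStarProjection_embedMatrix Sum.inl_injective hp))
      (isStarProjection_ofMatrix.2 (isStarProjection_embedMatrix Sum.inr_injective hq))
      fun τ hτ => ?_
    obtain ⟨σ, hσ, hτσ⟩ := exists_tracialState_of_matrix hτ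
    obtain ⟨s, t, hs, ht, hst, rfl⟩ := exists_convex_combination hφ hσ
    have e : ∀ Y : Matrix (m ⊕ n) (m ⊕ n) A, (Fintype.card (m ⊕ n) : ℝ) *
        (τ.1 (CStarMatrix.ofMatrix Y)).re =
          s * (matTrace (φ 0) Y).re + t * (matTrace (φ 1) Y).re := by
      intro Y
      have h1 : matTrace (s • φ 0 + t • φ 1) Y = s • matTrace (φ 0) Y + t • matTrace (φ 1) Y := by
        simp only [matTrace, Finset.smul_sum, ← Finset.sum_add_distrib]
        rfl
      have h2 := congrArg Complex.re ((hτσ Y).trans h1)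
      rwa [← Complex.ofReal_natCast, Complex.re_ofReal_mul, Complex.add_re, Complex.smul_re,
        Complex.smul_re, smul_eq_mul, smul_eq_mul] at h2
    have hlt : s * (matTrace (φ 0) q).re + t * (matTrace (φ 1) q).re <
        s * (matTrace (φ 0) p).re + t * (matTrace (φ 1) p).re := by
      rcases hs.eq_or_lt with rfl | hs
      · have : t = 1 := by linarith
        subst this
        have := h 1
        linarith
      · have h0 := mul_lt_mul_of_pos_left (h 0) hs
        have h1 := mul_le_mul_of_nonneg_left (h 1).le ht
        linarith
    have e1 := e (embedMatrix (Sum.inr : n → m ⊕ n) q)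
    have e2 := e (embedMatrix (Sum.inl : m → m ⊕ n) p)
    rw [← tq, ← tq] at e1
    rw [← tp, ← tp] at e2
    rw [← e1, ← e2] at hlt
    exact lt_of_mul_lt_mul_left hlt (Nat.cast_nonneg _)
  obtain ⟨w, hw1, hw2⟩ : ∃ w : Matrix (m ⊕ n) (m ⊕ n) A,
    wᴴ * w = K * q * Kᴴ ∧ J * p * Jᴴ * w = w := hle
  have qq : q * q = q := hq.isIdempotentElem
  have qs : qᴴ = q := hq.isSelfAdjoint
  have hJw : J * (Jᴴ * w) = w := by
    conv_lhs => rw [← hw2]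
    conv_rhs => rw [← hw2]
    simp only [← Matrix.mul_assoc]
    rw [Matrix.mul_assoc J Jᴴ J, hJ, Matrix.mul_one]
  refine ⟨Jᴴ * w * K * q, ?_, ?_, ?_⟩
  · simp only [Matrix.conjTranspose_mul, Matrix.conjTranspose_conjTranspose, qs]
    calc q * (Kᴴ * (wᴴ * J)) * (Jᴴ * w * K * q)
        = q * Kᴴ * (wᴴ * (J * (Jᴴ * w))) * K * q := by simp only [Matrix.mul_assoc]
      _ = q * (Kᴴ * K) * q * (Kᴴ * K) * q := by rw [hJw, hw1]; simp only [Matrix.mul_assoc]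
      _ = q := by rw [hK]; simp only [Matrix.mul_one, qq]
  · have : p * (Jᴴ * w) = Jᴴ * w := by
      conv_rhs => rw [← hw2]
      simp only [← Matrix.mul_assoc, hJ, Matrix.one_mul]
    simp only [← Matrix.mul_assoc] at this ⊢
    rw [this]
  · rw [Matrix.mul_assoc _ q q, qq]

/-- Strict inequality of traces puts a copy of q below p; the difference of p and that copy has the
required traces. -/
theorem sub_mem_traceVectors (hA : IsAF A) [FiniteDimensional ℂ (traceSpace A)]
    {φ : Fin 2 → traceSpace A} (hφ : EnumeratesExtremalTraces φ) {x y : Fin 2 → ℝ}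
    (hx : x ∈ traceVectors φ) (hy : y ∈ traceVectors φ) (h : ∀ i, y i < x i) :
    x - y ∈ traceVectors φ := by
  obtain ⟨p, hp⟩ := hx
  obtain ⟨q, hq⟩ := hy
  obtain ⟨v, h1, h2, h3⟩ := exists_partialIsometry_of_matTrace_lt hA hφ p.2.2 q.2.2
    (fun i => by simpa [hp, hq] using h i)
  have ps : p.2.1ᴴ = p.2.1 := p.2.2.isSelfAdjoint
  have he : IsStarProjection (v * vᴴ) := by
    refine ⟨?_, ?_⟩
    · change v * vᴴ * (v * vᴴ) = _
      rw [Matrix.mul_assoc, ← Matrix.mul_assoc vᴴ, h1, ← Matrix.mul_assoc, h3]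
    · change (v * vᴴ)ᴴ = _
      rw [Matrix.conjTranspose_mul, Matrix.conjTranspose_conjTranspose]
  have hpe : p.2.1 * (v * vᴴ) = v * vᴴ := by rw [← Matrix.mul_assoc, h2]
  have hd := isStarProjection_sub_of_le p.2.2 he hpe
  have hvq : MvN q.2.1 (v * vᴴ) := ⟨v, h1, rfl⟩
  refine mem_traceVectors hd fun i => ?_
  have := matTrace_add (φ i) (p.2.1 - v * vᴴ) (v * vᴴ)
  rw [sub_add_cancel, ← hvq.matTrace_eq, hp, hq] at this
  rw [eq_comm, Pi.sub_apply, Complex.ofReal_sub, this]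
  ring

theorem traceVectors_subset_range_Gam : traceVectors φ ⊆ (Gam φ).range := by
  rintro x ⟨p, hp⟩
  refine ⟨K0.mk p, funext fun i => ?_⟩
  rw [Gam_mk, hp, Complex.ofReal_re]

theorem exists_eq_sub_of_mem_range_Gam (hφ : ∀ i, φ i ∈ tracialStates A) {g : Fin k → ℝ}
    (hg : g ∈ (Gam φ).range) : ∃ x ∈ traceVectors φ, ∃ y ∈ traceVectors φ, g = x - y := by
  obtain ⟨g, rfl⟩ := hg
  obtain ⟨p, q, rfl⟩ := K0.exists_eq_sub g
  refine ⟨_, re_matTrace_mem_traceVectors hφ p.2.2, _, re_matTrace_mem_traceVectors hφ q.2.2, ?_⟩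
  rw [map_sub]
  ext i
  simp only [Pi.sub_apply, Gam_mk]

/-- An element of the range is a difference x - y of trace vectors; strict positivity means y < x in
both coordinates, as comparison requires. -/
theorem mem_traceVectors_of_pos (hA : IsAF A) [FiniteDimensional ℂ (traceSpace A)]
    {φ : Fin 2 → traceSpace A} (hφ : EnumeratesExtremalTraces φ)
    (hφ' : ∀ i, φ i ∈ tracialStates A) {g : Fin 2 → ℝ} (hg : g ∈ (Gam φ).range)
    (hpos : ∀ i, 0 < g i) : g ∈ traceVectors φ := by
  obtain ⟨x, hx, y, hy, rfl⟩ := exists_eq_sub_of_mem_range_Gam hφ' hg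
  exact sub_mem_traceVectors hA hφ hx hy fun i => sub_pos.1 (hpos i)

/-- A diagonal matrix in the fundamental group maps trace vectors to trace vectors. -/
theorem mul_mem_traceVectors_of_mem_fundamentalGroup {θ : Fin k → ℝ}
    (hθ : Matrix.diagonal (fun i => (θ i : ℂ)) ∈ fundamentalGroup φ) {x : Fin k → ℝ}
    (hx : x ∈ traceVectors φ) : θ * x ∈ traceVectors φ := by
  obtain ⟨l, p, Φ, -, -, hΦ⟩ := hθ
  obtain ⟨q, hq⟩ := hx
  have qq : q.2.1 * q.2.1 = q.2.1 := q.2.2.isIdempotentElem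
  have qs : q.2.1ᴴ = q.2.1 := q.2.2.isSelfAdjoint
  -- Applying Φ to each entry of q gives a projection over A, whose traces are those of q multiplied
  -- by θ.
  let Q : Matrix (Fin q.1 × Fin l) (Fin q.1 × Fin l) A :=
    fun i j => Φ (q.2.1 i.1 j.1) i.2 j.2
  have hQ : IsStarProjection Q := by
    refine ⟨?_, ?_⟩
    · change Q * Q = Q
      ext ⟨i, s⟩ ⟨j, t⟩
      rw [Matrix.mul_apply, Fintype.sum_prod_type]
      change ∑ c, ∑ d, Φ (q.2.1 i c) s d * Φ (q.2.1 c j) d t = Φ (q.2.1 i j) s t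
      conv_rhs => rw [← qq, Matrix.mul_apply, map_sum, Matrix.sum_apply]
      refine Finset.sum_congr rfl fun c _ => ?_
      rw [map_mul, Matrix.mul_apply]
    · change Qᴴ = Q
      ext ⟨i, s⟩ ⟨j, t⟩
      change star (Φ (q.2.1 j i) t s) = Φ (q.2.1 i j) s t
      conv_rhs => rw [← qs, Matrix.conjTranspose_apply, map_star]
      rfl
  refine mem_traceVectors hQ fun i => ?_
  have : matTrace (φ i) Q = ∑ c, matTrace (φ i) (Φ (q.2.1 c c)) := by
    simp only [matTrace]
    rw [Fintype.sum_prod_type]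
  rw [this]
  simp only [hΦ, Matrix.diagonal_apply, ite_mul, zero_mul, Finset.sum_ite_eq', Finset.mem_univ,
    if_true]
  rw [← Finset.mul_sum, Pi.mul_apply, Complex.ofReal_mul, ← hq i]
  rfl

end TraceVectors

/-! ### Realizing trace rescalings by corners. -/

section Realization

variable {A : Type*} [CStarAlgebra A] {k : ℕ} {φ : Fin k → traceSpace A}

theorem matTrace_diagonal_fin_one (τ : traceSpace A) (x : A) :
    matTrace τ (Matrix.diagonal fun _ : Fin 1 => x) = τ.1 x := by
  simp [matTrace_diagonal]

/-- The trace vector of a projection splits off any summand which is a trace vector. -/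
theorem exists_subprojection (hA : IsAF A) (hφ : HasK0Embedding φ) {q : A}
    (hq : IsStarProjection q) {x y : Fin k → ℝ} (hx : x ∈ traceVectors φ)
    (hy : y ∈ traceVectors φ) (h : ∀ i, (φ i).1 q = x i + y i) :
    ∃ f : A, IsStarProjection f ∧ q * f = f ∧ ∀ i, (φ i).1 f = x i := by
  obtain ⟨r, hr⟩ := hx
  obtain ⟨s, hs⟩ := hy
  have rr : r.2.1 * r.2.1 = r.2.1 := r.2.2.isIdempotentElem
  have rs : r.2.1ᴴ = r.2.1 := r.2.2.isSelfAdjoint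
  obtain ⟨v, h1, h2⟩ := mvN_of_matTrace_eq hA hφ (isStarProjection_fromBlocks r.2.2 s.2.2)
    (isStarProjection_diagonal (m := Fin 1) hq) fun i => by
      rw [matTrace_fromBlocks, matTrace_diagonal_fin_one, hr, hs, h]
  -- R is the first summand of r ⊕ s. The partial isometry v from r ⊕ s to q carries it to a
  -- subprojection of q.
  let R : Matrix (Fin r.1 ⊕ Fin s.1) (Fin r.1 ⊕ Fin s.1) A := Matrix.fromBlocks r.2.1 0 0 0
  have hR : IsStarProjection R := isStarProjection_fromBlocks r.2.2 (.zero _)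
  have RR : R * R = R := hR.isIdempotentElem
  have Rs : Rᴴ = R := hR.isSelfAdjoint
  have hRv : R * (vᴴ * v) = R := by
    rw [h1]
    simp [R, Matrix.fromBlocks_multiply, rr]
  have hw : MvN R (v * R * vᴴ) := by
    refine ⟨v * R, ?_, ?_⟩
    · rw [Matrix.conjTranspose_mul, Rs, Matrix.mul_assoc, ← Matrix.mul_assoc vᴴ,
        ← Matrix.mul_assoc R, hRv, RR]
    · rw [Matrix.conjTranspose_mul, Rs, Matrix.mul_assoc, ← Matrix.mul_assoc R, RR,
        Matrix.mul_assoc]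
  obtain ⟨f, hf⟩ : ∃ f : A, v * R * vᴴ = Matrix.diagonal fun _ : Fin 1 => f :=
    ⟨(v * R * vᴴ) 0 0, by ext i j; fin_cases i; fin_cases j; simp⟩
  have inj : ∀ {a b : A}, (Matrix.diagonal fun _ : Fin 1 => a) = (Matrix.diagonal fun _ => b) →
      a = b := fun h => by simpa using congrFun (congrFun h 0) 0
  refine ⟨f, ⟨inj ?_, inj ?_⟩, inj ?_, fun i => ?_⟩
  · change (Matrix.diagonal fun _ => f * f) = _
    rw [← Matrix.diagonal_mul_diagonal, ← hf]
    rw [show v * R * vᴴ * (v * R * vᴴ) = v * (R * (vᴴ * v)) * R * vᴴ by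
      simp only [Matrix.mul_assoc], hRv, Matrix.mul_assoc v, RR]
  · rw [show (Matrix.diagonal fun _ : Fin 1 => star f) = (Matrix.diagonal fun _ => f)ᴴ by
      rw [Matrix.diagonal_conjTranspose]; rfl, ← hf]
    rw [Matrix.conjTranspose_mul, Matrix.conjTranspose_mul, Rs,
      Matrix.conjTranspose_conjTranspose, Matrix.mul_assoc]
  · rw [← Matrix.diagonal_mul_diagonal, ← hf, ← h2]
    rw [show v * vᴴ * (v * R * vᴴ) = v * ((vᴴ * v) * R) * vᴴ by simp only [Matrix.mul_assoc]]
    congr 2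
    have := congrArg Matrix.conjTranspose hRv
    rwa [Matrix.conjTranspose_mul, Matrix.conjTranspose_mul, Matrix.conjTranspose_conjTranspose,
      Rs] at this
  · rw [← matTrace_diagonal_fin_one, ← hf, ← hw.matTrace_eq, ← hr]
    simp [R, matTrace]

/-- The subprojection is moved into a finite stage by a unitary of the corner qAq rather than of A,
which keeps it below q. -/
theorem exists_subprojection_mem {F : ℕ → StarSubalgebra ℂ A} (hF : IsAFChain F) (hA : IsAF A)
    (hφ : HasK0Embedding φ) {q : A} (hqF : q ∈ unionSubalgebra F hF.mono)
    (hq : IsStarProjection q) {x y : Fin k → ℝ} (hx : x ∈ traceVectors φ)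
    (hy : y ∈ traceVectors φ) (h : ∀ i, (φ i).1 q = x i + y i) :
    ∃ f ∈ unionSubalgebra F hF.mono, IsStarProjection f ∧ q * f = f ∧
      ∀ i, (φ i).1 f = x i := by
  obtain ⟨f, hf, hqf, hfx⟩ := exists_subprojection hA hφ hq hx hy h
  have hfq : f * q = f := mul_comm_of_le hq hf hqf
  obtain ⟨n₀, hn₀⟩ := hqF
  obtain ⟨f, rfl⟩ := Corner.exists_incl_eq (hp := hq) hqf hfq
  rw [Corner.isStarProjection_incl_iff] at hf
  obtain ⟨n, g, hg, hgp, u, h1, h2, h3⟩ := (hF.corner (hp := hq) hn₀).exists_unitary_conj hf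
  obtain ⟨w, hw1, hw2⟩ := ProjEquiv.of_unitary hf h1 h2 h3
  refine ⟨Corner.incl hq g, ⟨_, hg⟩, hgp.map _, Corner.mul_incl g, fun i => ?_⟩
  rw [← hfx i]
  refine (apply_star_mul_self_of_projEquiv (φ i) ⟨Corner.incl hq w, ?_, ?_⟩).symm
  · rw [← map_star, ← map_mul, hw1]
  · rw [← map_star, ← map_mul, hw2]

/-- Injectivity of Γ together with cancellation gives equivalence in A, which then descends to a
finite stage. -/
theorem cancelsTraces_of_hasK0Embedding {F : ℕ → StarSubalgebra ℂ A} (hF : IsAFChain F)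
    (hA : IsAF A) (hφ : HasK0Embedding φ) :
    CancelsTraces (unionSubalgebra F hF.mono) fun i => (φ i).1 := by
  rintro p ⟨n, hpn⟩ q ⟨m, hqm⟩ hp hq h
  obtain ⟨v, h1, h2⟩ := mvN_of_matTrace_eq hA hφ (isStarProjection_diagonal (m := Fin 1) hp)
    (isStarProjection_diagonal (m := Fin 1) hq) fun i => by
      rw [matTrace_diagonal_fin_one, matTrace_diagonal_fin_one, h]
  have hpq : ProjEquiv p q := by
    refine ⟨v 0 0, ?_, ?_⟩
    · simpa [Matrix.mul_apply] using congrFun (congrFun h1 0) 0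
    · simpa [Matrix.mul_apply] using congrFun (congrFun h2 0) 0
  obtain ⟨l, hpl, hql, w, hw1, hw2⟩ := hF.exists_projEquiv (hF.mono (le_max_left n m) hpn)
    (hF.mono (le_max_right n m) hqm) hp hq hpq
  exact ⟨w, ⟨l, w.2⟩, congrArg Subtype.val hw1, congrArg Subtype.val hw2⟩

theorem exists_mem_traceVectors_eq (hφ' : ∀ i, φ i ∈ tracialStates A) {e : A}
    (he : IsStarProjection e) :
    ∃ x ∈ traceVectors φ, ∀ i, (φ i).1 e = x i := by
  refine ⟨_, re_matTrace_mem_traceVectors hφ' (isStarProjection_diagonal (m := Fin 1) he),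
    fun i => ?_⟩
  rw [ofReal_re_matTrace (hφ' i) (isStarProjection_diagonal he), matTrace_diagonal_fin_one]

/-- A corner of an AF-algebra on which all traces are rescaled by `θ`, where `θ` and `θ⁻¹` preserve
the trace vectors, is isomorphic to the algebra. -/
theorem exists_bijective_hom_corner (hA : IsAF A) (hφ : HasK0Embedding φ)
    (hφ' : ∀ i, φ i ∈ tracialStates A) {θ : Fin k → ℝ} (hθ0 : ∀ i, 0 < θ i)
    (hθ : ∀ x ∈ traceVectors φ, θ * x ∈ traceVectors φ)
    (hθ' : ∀ x ∈ traceVectors φ, θ⁻¹ * x ∈ traceVectors φ) (h1θ : 1 - θ ∈ traceVectors φ) :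
    ∃ (p : A) (hp : IsStarProjection p) (Φ : A →⋆ₐ[ℂ] Corner hp), Function.Bijective Φ ∧
      (∀ i, (φ i).1 p = θ i) ∧ ∀ i x, (φ i).1 (Corner.incl hp (Φ x)) = θ i * (φ i).1 x := by
  obtain ⟨F, hF⟩ := hA.exists_chain
  have hθC : ∀ i, (θ i : ℂ) ≠ 0 := fun i => Complex.ofReal_ne_zero.2 (hθ0 i).ne'
  have h1 := one_mem_traceVectors hφ'
  obtain ⟨p, ⟨n₀, hpn⟩, hp, -, hpθ⟩ := exists_subprojection_mem hF hA hφ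
    (one_mem (unionSubalgebra F hF.mono)) (.one A) (x := θ) (by simpa using hθ 1 h1) h1θ
    fun i => by simp [(hφ' i).2]
  let ι : Corner hp →L[ℂ] A := ⟨(Corner.incl hp : Corner hp →ₗ[ℂ] A), Corner.continuous_incl⟩
  -- Dividing by θ i normalizes the traces at the unit p of the corner, so the required isomorphism
  -- becomes a trace preserving one.
  let ψ : Fin k → Corner hp →L[ℂ] ℂ := fun i => (θ i : ℂ)⁻¹ • (φ i).1.comp ι
  have hψ : ∀ i x, ψ i x = (θ i : ℂ)⁻¹ * (φ i).1 (Corner.incl hp x) := fun _ _ => rfl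
  have hC := hF.corner (hp := hp) hpn
  have hCA := cancelsTraces_of_hasK0Embedding hF hA hφ
  refine ⟨p, hp, ?_⟩
  have hCB : CancelsTraces (unionSubalgebra _ hC.mono) ψ := by
    rintro e ⟨n, hen⟩ f ⟨m, hfm⟩ he hf hef
    have hef' : ∀ i, (φ i).1 (Corner.incl hp e) = (φ i).1 (Corner.incl hp f) := fun i =>
      mul_left_cancel₀ (inv_ne_zero (hθC i)) (hef i)
    have he' : IsStarProjection (Corner.incl hp e) := he.map _
    have hf' : IsStarProjection (Corner.incl hp f) := hf.map _
    obtain ⟨v, ⟨l, hvl⟩, hv1, hv2⟩ := hCA _ ⟨_, hen⟩ _ ⟨_, hfm⟩ he' hf' hef'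
    have e1 := mul_eq_self_of_star_mul_self he' hv1
    have e2 := mul_eq_self_of_mul_star hf' hv2
    obtain ⟨v, rfl⟩ := Corner.exists_incl_eq (hp := hp) (x := v)
      (by rw [← e2, ← mul_assoc, Corner.mul_incl]) (by rw [← e1, mul_assoc, Corner.incl_mul])
    refine ⟨v, ⟨l, hF.mono (Nat.le_add_left l n₀) hvl⟩, Corner.incl_injective ?_,
      Corner.incl_injective ?_⟩
    · rw [map_mul, map_star, hv1]
    · rw [map_mul, map_star, hv2]
  -- Splitting in the corner needs θ to preserve trace vectors; the opposite direction below needs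
  -- the same of θ⁻¹.
  have hAB : SplitsTraces (unionSubalgebra F hF.mono) (fun i => (φ i).1)
      (unionSubalgebra _ hC.mono) ψ := by
    rintro e - e' - he he' - q ⟨n, hqn⟩ hq hqe
    obtain ⟨x, hx, hex⟩ := exists_mem_traceVectors_eq hφ' he
    obtain ⟨y, hy, hey⟩ := exists_mem_traceVectors_eq hφ' he'
    obtain ⟨f, ⟨m, hfm⟩, hf, hqf, hfx⟩ := exists_subprojection_mem hF hA hφ ⟨_, hqn⟩ (hq.map _)
      (hθ x hx) (hθ y hy) fun i => by
        have := hqe i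
        rw [hψ, map_add, hex, hey, inv_mul_eq_iff_eq_mul₀ (hθC i)] at this
        rw [this]
        push_cast [Pi.mul_apply]
        ring
    have hfq := mul_comm_of_le (hq.map (Corner.incl hp)) hf hqf
    obtain ⟨f, rfl⟩ := Corner.exists_incl_eq (hp := hp) (x := f)
      (by rw [← hqf, ← mul_assoc, Corner.mul_incl]) (by rw [← hfq, mul_assoc, Corner.incl_mul])
    refine ⟨f, ⟨m, hF.mono (Nat.le_add_left m n₀) hfm⟩, Corner.isStarProjection_incl_iff.1 hf,
      Corner.incl_injective (by rw [map_mul, hqf]), fun i => ?_⟩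
    rw [hψ, hfx, hex, Pi.mul_apply, Complex.ofReal_mul, inv_mul_cancel_left₀ (hθC i)]
  have hBA : SplitsTraces (unionSubalgebra _ hC.mono) ψ (unionSubalgebra F hF.mono)
      (fun i => (φ i).1) := by
    rintro e - e' - he he' - q hqF hq hqe
    obtain ⟨x, hx, hex⟩ := exists_mem_traceVectors_eq hφ' (he.map (Corner.incl hp))
    obtain ⟨y, hy, hey⟩ := exists_mem_traceVectors_eq hφ' (he'.map (Corner.incl hp))
    obtain ⟨f, hfF, hf, hqf, hfx⟩ := exists_subprojection_mem hF hA hφ hqF hq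
      (hθ' x hx) (hθ' y hy) fun i => by
        have := hqe i
        rw [hψ, map_add, map_add, hex, hey] at this
        rw [this]
        push_cast [Pi.mul_apply, Pi.inv_apply]
        ring
    refine ⟨f, hfF, hf, hqf, fun i => ?_⟩
    rw [hψ, hfx, hex, Pi.mul_apply, Pi.inv_apply, Complex.ofReal_mul, Complex.ofReal_inv]
  obtain ⟨Φ, hΦ, hΦψ⟩ := exists_bijective_hom_of_traces (φ := fun i => (φ i).1) (ψ := ψ) hF hC
    (fun i x y => (φ i).2 x y)
    (fun i x y => by rw [hψ, hψ, map_mul (Corner.incl hp), map_mul (Corner.incl hp), (φ i).2])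
    (fun i => by rw [hψ, Corner.incl_one, hpθ, inv_mul_cancel₀ (hθC i)]; exact (hφ' i).2.symm)
    hCA hCB hAB hBA
  refine ⟨Φ, hΦ, hpθ, fun i x => ?_⟩
  rw [← hΦψ i x, hψ, mul_inv_cancel_left₀ (hθC i)]

/-- A projection which is large in all traces is full. -/
theorem span_diagonal_eq_top (hA : IsAF A) [FiniteDimensional ℂ (traceSpace A)]
    {φ : Fin 2 → traceSpace A} (hφ : EnumeratesExtremalTraces φ)
    (hφ' : ∀ i, φ i ∈ tracialStates A) {p : A} (hp : IsStarProjection p)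
    (hpos : ∀ i, 0 < ((φ i).1 p).re) :
    TwoSidedIdeal.span {(Matrix.diagonal fun _ : Fin 1 => p)} = ⊤ := by
  -- N copies of p exceed 1 in both extremal traces, so 1 is equivalent to a subprojection of their
  -- direct sum. This writes 1 as a sum of terms v i * p v i in the ideal.
  obtain ⟨N, hN⟩ : ∃ N : ℕ, ∀ i, 1 < N * ((φ i).1 p).re := by
    choose N hN using fun i => exists_nat_gt (((φ i).1 p).re)⁻¹
    refine ⟨N 0 + N 1, fun i => ?_⟩
    have h1 := (inv_lt_iff_one_lt_mul₀ (hpos i)).1 (hN i)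
    refine h1.trans_le ?_
    have : N i ≤ N 0 + N 1 := by fin_cases i <;> simp
    exact mul_le_mul_of_nonneg_right (Nat.cast_le.2 this) (hpos i).le
  obtain ⟨v, h1, h2, -⟩ := exists_partialIsometry_of_matTrace_lt hA hφ
    (isStarProjection_diagonal (m := Fin N) hp) (IsStarProjection.one (Matrix (Fin 1) (Fin 1) A))
    fun i => by
      rw [matTrace_diagonal, Fintype.card_fin, ← Complex.ofReal_natCast, Complex.re_ofReal_mul]
      refine lt_of_eq_of_lt ?_ (hN i)
      simp [matTrace, (hφ' i).2]
  have hv : ∀ i, p * v i 0 = v i 0 := fun i => by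
    simpa using congrFun (congrFun h2 i) 0
  set I := TwoSidedIdeal.span {(Matrix.diagonal fun _ : Fin 1 => p)} with hI
  have hpI : (Matrix.diagonal fun _ : Fin 1 => p) ∈ I := TwoSidedIdeal.subset_span rfl
  have h1I : (1 : Matrix (Fin 1) (Fin 1) A) ∈ I := by
    have : (1 : Matrix (Fin 1) (Fin 1) A) = ∑ i, (Matrix.diagonal fun _ : Fin 1 => star (v i 0)) *
        ((Matrix.diagonal fun _ : Fin 1 => p) * (Matrix.diagonal fun _ : Fin 1 => v i 0)) := by
      rw [← h1]
      ext s t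
      fin_cases s
      fin_cases t
      simp [Matrix.mul_apply, hv, Matrix.sum_apply]
    rw [this]
    exact sum_mem fun i _ => I.mul_mem_left _ _ (I.mul_mem_right _ _ hpI)
  exact I.one_mem_iff.1 h1I

/-- Realization of diagonal matrices in the fundamental group. -/
theorem diagonal_mem_fundamentalGroup (hA : IsAF A) [FiniteDimensional ℂ (traceSpace A)]
    {φ : Fin 2 → traceSpace A} (hφE : EnumeratesExtremalTraces φ) (hφ : HasK0Embedding φ)
    (hφ' : ∀ i, φ i ∈ tracialStates A) {θ : Fin 2 → ℝ} (hθ0 : ∀ i, 0 < θ i)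
    (hθ1 : ∀ i, θ i < 1) (hθ : ∀ x ∈ traceVectors φ, θ * x ∈ traceVectors φ)
    (hθ' : ∀ x ∈ traceVectors φ, θ⁻¹ * x ∈ traceVectors φ) :
    Matrix.diagonal (fun i => (θ i : ℂ)) ∈ fundamentalGroup φ := by
  have h1 := one_mem_traceVectors hφ'
  obtain ⟨p, hp, Φ, hΦ, hpθ, hΦθ⟩ := exists_bijective_hom_corner hA hφ hφ' hθ0 hθ hθ'
    (sub_mem_traceVectors hA hφE h1 (by simpa using hθ 1 h1) fun i => hθ1 i)
  -- Since all θ i < 1, the projection lies in A itself, and 1 × 1 matrices suffice.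
  let d : A →⋆ₙₐ[ℂ] Matrix (Fin 1) (Fin 1) A :=
    { toFun := fun x => Matrix.diagonal fun _ => x
      map_smul' := fun c x => Matrix.diagonal_smul c fun _ => x
      map_zero' := Matrix.diagonal_zero
      map_add' := fun x y => (Matrix.diagonal_add _ _).symm
      map_mul' := fun x y => (Matrix.diagonal_mul_diagonal _ _).symm
      map_star' := fun x => (Matrix.diagonal_conjTranspose _).symm }
  have hd : ∀ x, d x = Matrix.diagonal fun _ => x := fun _ => rfl
  have hdb : Function.Bijective d := by
    refine ⟨fun x y h => ?_, fun M => ⟨M 0 0, ?_⟩⟩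
    · simpa [hd] using congrFun (congrFun h 0) 0
    · ext i j; fin_cases i; fin_cases j; simp [hd]
  let Φ' : A →⋆ₙₐ[ℂ] Corner hp := (Φ : A →⋆ₙₐ[ℂ] Corner hp)
  refine ⟨1, d p, (d.comp (Corner.incl hp)).comp Φ', ⟨hp.map d, ?_⟩, ⟨?_, ?_⟩, fun j x => ?_⟩
  · rw [hd, span_diagonal_eq_top hA hφE hφ' hp fun i => by rw [hpθ]; exact hθ0 i]
    exact dense_univ
  · exact (hdb.1.comp Corner.incl_injective).comp hΦ.1
  · ext M
    obtain ⟨x, rfl⟩ := hdb.2 M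
    have hx : p * x * p = x ↔ x ∈ Set.range (Corner.incl hp) := by rw [Corner.range_incl]; rfl
    change _ ↔ d p * d x * d p = d x
    rw [← map_mul, ← map_mul, hdb.1.eq_iff, hx]
    constructor
    · rintro ⟨y, hy⟩
      exact ⟨Φ y, hdb.1 hy⟩
    · rintro ⟨y, rfl⟩
      obtain ⟨z, rfl⟩ := hΦ.2 y
      exact ⟨z, rfl⟩
  · change matTrace (φ j) (Matrix.diagonal fun _ => Corner.incl hp (Φ x)) = _
    rw [matTrace_diagonal_fin_one, hΦθ, Finset.sum_eq_single j]
    · rw [Matrix.diagonal_apply_eq]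
    · intro i _ hij
      rw [Matrix.diagonal_apply_ne _ hij, zero_mul]
    · simp

end Realization

/-! ### Integer polynomials -/

section IntPoly

open Polynomial

/-- The rational minimal polynomial divides ψ, and clearing its denominators gives an integer
polynomial vanishing at x without raising the degree, so ψ has no larger degree. -/
theorem IsMinIntPoly.associated_minpoly {ψ : ℤ[X]} {x : ℝ} (h : IsMinIntPoly ψ x)
    (hx : IsAlgebraic ℚ x) : Associated (minpoly ℚ x) (ψ.map (Int.castRingHom ℚ)) := by
  have hmap0 : ψ.map (Int.castRingHom ℚ) ≠ 0 := by
    rw [Ne, Polynomial.map_eq_zero_iff (Int.cast_injective)]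
    exact h.primitive.ne_zero
  have hdvd : minpoly ℚ x ∣ ψ.map (Int.castRingHom ℚ) := by
    refine minpoly.dvd ℚ x ?_
    have := h.root
    rwa [← Polynomial.aeval_map_algebraMap ℚ] at this
  refine Polynomial.associated_of_dvd_of_natDegree_le hdvd hmap0 ?_
  set N := IsLocalization.integerNormalization (nonZeroDivisors ℤ) (minpoly ℚ x)
  have hN0 : N ≠ 0 := by
    rw [Ne, IsFractionRing.integerNormalization_eq_zero_iff]
    exact minpoly.ne_zero hx.isIntegral
  have hNx : aeval x N = 0 :=
    IsLocalization.integerNormalization_aeval_eq_zero _ _ (minpoly.aeval ℚ x)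
  calc (ψ.map (Int.castRingHom ℚ)).natDegree ≤ ψ.natDegree := natDegree_map_le
    _ ≤ N.natDegree := h.minimal N hN0 hNx
    _ ≤ (minpoly ℚ x).natDegree :=
      natDegree_le_natDegree <| degree_mono
        (IsLocalization.integerNormalization_support (nonZeroDivisors ℤ) (minpoly ℚ x))

/-- By Gauss's lemma, primitive polynomials associated over ℚ are associated over ℤ; the positive
leading coefficients fix the sign. -/
theorem IsMinIntPoly.eq_of_minpoly_eq {ψ₁ ψ₂ : ℤ[X]} {x y : ℝ} (h₁ : IsMinIntPoly ψ₁ x)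
    (h₂ : IsMinIntPoly ψ₂ y) (hx : IsAlgebraic ℚ x) (hy : IsAlgebraic ℚ y)
    (h : minpoly ℚ x = minpoly ℚ y) : ψ₁ = ψ₂ := by
  have hass := (h₁.associated_minpoly hx).symm.trans (h ▸ h₂.associated_minpoly hy)
  have d1 := (IsPrimitive.Int.dvd_iff_map_cast_dvd_map_cast ψ₁ ψ₂ h₁.primitive).2 hass.dvd
  have d2 := (IsPrimitive.Int.dvd_iff_map_cast_dvd_map_cast ψ₂ ψ₁ h₂.primitive).2 hass.symm.dvd
  obtain ⟨u, hu⟩ := associated_of_dvd_dvd d1 d2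
  obtain ⟨r, hr, hru⟩ := Polynomial.isUnit_iff.1 u.isUnit
  have p1 := h₁.leadingCoeff_pos
  have p2 := h₂.leadingCoeff_pos
  rw [← hru] at hu
  rw [← hu, leadingCoeff_mul, leadingCoeff_C] at p2
  rcases Int.isUnit_iff.1 hr with rfl | rfl
  · simpa using hu
  · linarith

/-- Distinct ψ come from distinct monic irreducible polynomials over ℚ, which are coprime; clear
denominators in a Bézout identity. -/
theorem IsMinIntPoly.exists_combination_eq_C {ψ₁ ψ₂ : ℤ[X]} {x y : ℝ} (h₁ : IsMinIntPoly ψ₁ x)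
    (h₂ : IsMinIntPoly ψ₂ y) (hx : IsAlgebraic ℚ x) (hy : IsAlgebraic ℚ y) (hne : ψ₁ ≠ ψ₂) :
    ∃ (u v : ℤ[X]) (d : ℕ), d ≠ 0 ∧ u * ψ₁ + v * ψ₂ = C (d : ℤ) := by
  have hcop : IsCoprime (minpoly ℚ x) (minpoly ℚ y) := by
    refine ((minpoly.irreducible hx.isIntegral).isCoprime_or_dvd _).resolve_right fun hd => hne ?_
    refine h₁.eq_of_minpoly_eq h₂ hx hy ?_
    exact eq_of_monic_of_associated (minpoly.monic hx.isIntegral) (minpoly.monic hy.isIntegral)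
      ((minpoly.irreducible hx.isIntegral).associated_of_dvd (minpoly.irreducible hy.isIntegral) hd)
  obtain ⟨e₁, he₁⟩ := h₁.associated_minpoly hx
  obtain ⟨e₂, he₂⟩ := h₂.associated_minpoly hy
  have hcop' : IsCoprime (ψ₁.map (Int.castRingHom ℚ)) (ψ₂.map (Int.castRingHom ℚ)) := by
    rw [← he₁, ← he₂]
    exact (isCoprime_mul_unit_right_left e₁.isUnit _ _).2
      ((isCoprime_mul_unit_right_right e₂.isUnit _ _).2 hcop)
  obtain ⟨u', v', huv⟩ := hcop'
  obtain ⟨b, hb, hbu⟩ := IsLocalization.integerNormalization_spec (nonZeroDivisors ℤ) u'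
  obtain ⟨c, hc, hcv⟩ := IsLocalization.integerNormalization_spec (nonZeroDivisors ℤ) v'
  set U := IsLocalization.integerNormalization (nonZeroDivisors ℤ) u'
  set W := IsLocalization.integerNormalization (nonZeroDivisors ℤ) v'
  have hb0 : b ≠ 0 := nonZeroDivisors.ne_zero hb
  have hc0 : c ≠ 0 := nonZeroDivisors.ne_zero hc
  have key : C c * U * ψ₁ + C b * W * ψ₂ = C (b * c) := by
    apply Polynomial.map_injective (Int.castRingHom ℚ) Int.cast_injective
    have e1 : U.map (Int.castRingHom ℚ) = C (b : ℚ) * u' := by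
      rw [← Polynomial.smul_eq_C_mul]
      exact hbu.trans (by rw [Int.cast_smul_eq_zsmul])
    have e2 : W.map (Int.castRingHom ℚ) = C (c : ℚ) * v' := by
      rw [← Polynomial.smul_eq_C_mul]
      exact hcv.trans (by rw [Int.cast_smul_eq_zsmul])
    simp only [Polynomial.map_add, Polynomial.map_mul, Polynomial.map_C, e1, e2]
    rw [eq_intCast (Int.castRingHom ℚ), eq_intCast (Int.castRingHom ℚ),
      eq_intCast (Int.castRingHom ℚ), Int.cast_mul, C_mul]
    linear_combination (C (b : ℚ) * C (c : ℚ)) * huv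
  rcases Int.natAbs_eq (b * c) with h | h
  · exact ⟨_, _, (b * c).natAbs, Int.natAbs_ne_zero.2 (mul_ne_zero hb0 hc0), by rw [key, ← h]⟩
  · refine ⟨-(C c * U), -(C b * W), (b * c).natAbs, Int.natAbs_ne_zero.2 (mul_ne_zero hb0 hc0), ?_⟩
    rw [show ((b * c).natAbs : ℤ) = -(b * c) by omega, C_neg, ← key]
    ring

/-- If `ψ₂` is monic and the ideal `(ψ₁, ψ₂)` contains a non-zero integer, then the powers of the
indeterminate are eventually periodic modulo `(ψ₁, ψ₂)`. -/
theorem exists_pow_mul_pow_sub_one_eq {ψ₁ ψ₂ u v : ℤ[X]} {d : ℕ} (hd : d ≠ 0)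
    (h : u * ψ₁ + v * ψ₂ = C (d : ℤ)) (hmonic : ψ₂.Monic) :
    ∃ (N n : ℕ) (U W : ℤ[X]), 0 < n ∧ X ^ N * (X ^ n - 1) = U * ψ₁ + W * ψ₂ := by
  have : NeZero d := ⟨hd⟩
  -- Pigeonhole: the remainders of the powers of X modulo ψ₂, with coefficients reduced modulo d,
  -- take finitely many values. This is where monicity is needed.
  obtain ⟨k, l, hkl, he⟩ := Finite.exists_ne_map_eq_of_infinite
    fun (k : ℕ) (i : Fin (ψ₂.natDegree)) => (((X ^ k %ₘ ψ₂).coeff i : ℤ) : ZMod d)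
  wlog hlt : k < l generalizing k l
  · exact this l k hkl.symm he.symm (lt_of_le_of_ne (not_lt.1 hlt) hkl.symm)
  have hdvd : C (d : ℤ) ∣ X ^ l %ₘ ψ₂ - X ^ k %ₘ ψ₂ := by
    rw [C_dvd_iff_dvd_coeff]
    intro i
    rw [coeff_sub]
    by_cases hi : i < ψ₂.natDegree
    · exact (ZMod.intCast_eq_intCast_iff_dvd_sub _ _ _).1 (congrFun he ⟨i, hi⟩)
    · have h0 : ∀ m : ℕ, (X ^ m %ₘ ψ₂).coeff i = 0 := fun m =>
        coeff_eq_zero_of_degree_lt ((degree_modByMonic_lt _ hmonic).trans_le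
          (degree_le_natDegree.trans (by exact_mod_cast not_lt.1 hi)))
      rw [h0, h0, sub_self]
      exact dvd_zero _
  obtain ⟨s, hs⟩ := hdvd
  refine ⟨k, l - k, u * s, v * s + (X ^ l /ₘ ψ₂) - (X ^ k /ₘ ψ₂), by omega, ?_⟩
  have h1 := modByMonic_add_div (X ^ l : ℤ[X]) ψ₂
  have h2 := modByMonic_add_div (X ^ k : ℤ[X]) ψ₂
  rw [mul_sub, ← pow_add, Nat.add_sub_cancel' hlt.le, mul_one]
  linear_combination hs - h1 + h2 - s * h

end IntPoly

/-! ### Invariant subgroups -/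

section Invariant

theorem isInvariant_diagonal_iff {w : Fin 2 → ℝ} (hw : ∀ i, w i ≠ 0)
    {G : AddSubgroup (Fin 2 → ℝ)} :
    IsInvariant (Matrix.diagonal w) G ↔ (∀ g ∈ G, w * g ∈ G) ∧ ∀ g ∈ G, w⁻¹ * g ∈ G := by
  have h1 : ∀ g, Matrix.diagonal w *ᵥ g = w * g := fun g => funext fun i =>
    Matrix.mulVec_diagonal w g i
  have h2 : w⁻¹ * w = 1 := funext fun i => inv_mul_cancel₀ (hw i)
  have h3 : w * w⁻¹ = 1 := funext fun i => mul_inv_cancel₀ (hw i)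
  simp only [IsInvariant, h1]
  constructor
  · intro h
    refine ⟨fun g hg => ?_, fun g hg => ?_⟩
    · have : w * g ∈ (G : Set (Fin 2 → ℝ)) := h ▸ ⟨g, hg, rfl⟩
      exact this
    · have : g ∈ (fun v => w * v) '' (G : Set (Fin 2 → ℝ)) := h.symm ▸ hg
      obtain ⟨g', hg', rfl⟩ := this
      rwa [← mul_assoc, h2, one_mul]
  · rintro ⟨h, h'⟩
    ext g
    constructor
    · rintro ⟨g', hg', rfl⟩
      exact h g' hg'
    · intro hg
      exact ⟨w⁻¹ * g, h' g hg, by simp only [← mul_assoc, h3, one_mul]⟩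

theorem zpow_mul_mem {ι : Type*} {w : ι → ℝ} {S : Set (ι → ℝ)} (h : ∀ g ∈ S, w * g ∈ S)
    (h' : ∀ g ∈ S, w⁻¹ * g ∈ S) (k : ℤ) : ∀ g ∈ S, w ^ k * g ∈ S := by
  have key : ∀ w : ι → ℝ, (∀ g ∈ S, w * g ∈ S) → ∀ (n : ℕ), ∀ g ∈ S, w ^ n * g ∈ S := by
    intro w h n
    induction n with
    | zero => intro g hg; rwa [pow_zero, one_mul]
    | succ n ih => intro g hg; rw [pow_succ', mul_assoc]; exact h _ (ih g hg)
  rcases k with n | n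
  · rw [Int.ofNat_eq_natCast, zpow_natCast]
    exact key w h n
  · rw [zpow_negSucc, ← inv_pow]
    exact key _ h' _

theorem aeval_mul_mem {ι : Type*} {w : ι → ℝ} {G : AddSubgroup (ι → ℝ)}
    (h : ∀ g ∈ G, w * g ∈ G) (P : ℤ[X]) : ∀ g ∈ G, Polynomial.aeval w P * g ∈ G := by
  induction P using Polynomial.induction_on' with
  | add p q hp hq =>
    intro g hg
    rw [map_add, add_mul]
    exact add_mem (hp g hg) (hq g hg)
  | monomial n c =>
    intro g hg
    rw [Polynomial.aeval_monomial, ← Algebra.smul_def, smul_mul_assoc]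
    refine zsmul_mem ?_ c
    clear c
    induction n with
    | zero => rwa [pow_zero, one_mul]
    | succ n ih => rw [pow_succ', mul_assoc]; exact h _ ih

theorem aeval_pi_apply {ι : Type*} (w : ι → ℝ) (P : ℤ[X]) (i : ι) :
    Polynomial.aeval w P i = Polynomial.aeval (w i) P :=
  (Polynomial.aeval_algHom_apply (Pi.evalAlgHom ℤ (fun _ : ι => ℝ) i) w P).symm

/-- Invariance under `diag(a, b)` implies invariance under `diag(1, bⁿ)`, for a suitable `n`. -/
theorem exists_pow_isInvariant {a b : ℝ} (ha : a ≠ 0) (hb : b ≠ 0) (ha_alg : IsAlgebraic ℚ a)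
    (hb_alg : IsAlgebraic ℚ b) {ψ₁ ψ₂ : ℤ[X]} (hψ₁ : IsMinIntPoly ψ₁ a)
    (hψ₂ : IsMinIntPoly ψ₂ b) (hne : ψ₁ ≠ ψ₂) (hmonic : ψ₂.Monic) :
    ∃ n : ℕ, 0 < n ∧ ∀ G : AddSubgroup (Fin 2 → ℝ), IsInvariant (Matrix.diagonal ![a, b]) G →
      (∀ g ∈ G, ![1, b ^ n] * g ∈ G) ∧ ∀ g ∈ G, (![1, b ^ n])⁻¹ * g ∈ G := by
  obtain ⟨u, v, d, hd, huv⟩ := hψ₁.exists_combination_eq_C hψ₂ ha_alg hb_alg hne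
  obtain ⟨N, n, U, W, hn, hUW⟩ := exists_pow_mul_pow_sub_one_eq hd huv hmonic
  refine ⟨n, hn, fun G hG => ?_⟩
  rw [isInvariant_diagonal_iff (by intro i; fin_cases i <;> simpa)] at hG
  obtain ⟨h1, h2⟩ := hG
  -- This operator is diag(0, b^N (b^n - 1)). Composed with the power -N of diag(a, b) it is diag(0,
  -- b^n - 1), to be added to the identity.
  have hR : ∀ g ∈ G, Polynomial.aeval ![a, b] (U * ψ₁) * g ∈ G := aeval_mul_mem h1 _
  have hR0 : Polynomial.aeval a (U * ψ₁) = 0 := by rw [map_mul, hψ₁.root, mul_zero]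
  have hR1 : Polynomial.aeval b (U * ψ₁) = b ^ N * (b ^ n - 1) := by
    have := congrArg (Polynomial.aeval b) hUW
    rw [map_add, map_mul _ W, hψ₂.root, mul_zero, add_zero] at this
    rw [← this]
    simp
  generalize U * ψ₁ = R at hR hR0 hR1
  have hz := zpow_mul_mem (S := (G : Set (Fin 2 → ℝ))) h1 h2
  constructor
  · intro g hg
    have := add_mem hg (hz (-(N : ℤ)) _ (hR g hg))
    convert this using 1
    ext i
    fin_cases i
    · simp [aeval_pi_apply, hR0]
    · simp [aeval_pi_apply, hR1]
      field_simp
      ring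
  · intro g hg
    -- The further power -n turns the entry into 1 - b^(-n); subtracting from the identity leaves
    -- diag(1, b^(-n)).
    have := sub_mem hg (hz (-((N + n : ℕ) : ℤ)) _ (hR g hg))
    convert this using 1
    ext i
    fin_cases i
    · simp [aeval_pi_apply, hR0]
    · simp only [Pi.mul_apply, Pi.inv_apply, Pi.sub_apply, Pi.pow_apply, aeval_pi_apply,
        zpow_neg, zpow_natCast, Fin.mk_one, Matrix.cons_val_one, Matrix.cons_val_fin_one, hR1]
      rw [pow_add]
      field_simp
      ring

/-- Let `S` be a set of non-negative vectors in a group `G` such that the strictly positive elements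
of `G` lie in `S`. If `S` and `G` are invariant under `diag(a, b)` and `G` is invariant under
`diag(1, bⁿ)`, then `S` is invariant under `diag(aᵐ, bᵐ⁺ⁿˡ)`. -/
theorem mul_mem_of_invariant {a b : ℝ} (ha : 0 < a) (hb : 0 < b) {S : Set (Fin 2 → ℝ)}
    {G : AddSubgroup (Fin 2 → ℝ)} (hSG : S ⊆ G) (hS : ∀ x ∈ S, ∀ i, 0 ≤ x i)
    (hpos : ∀ g ∈ G, (∀ i, 0 < g i) → g ∈ S) (hA : ∀ x ∈ S, ![a, b] * x ∈ S)
    (hA' : ∀ x ∈ S, (![a, b])⁻¹ * x ∈ S) (hGA : IsInvariant (Matrix.diagonal ![a, b]) G) {n : ℕ}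
    (hB : ∀ g ∈ G, ![1, b ^ n] * g ∈ G) (hB' : ∀ g ∈ G, (![1, b ^ n])⁻¹ * g ∈ G) (m l : ℤ)
    {x : Fin 2 → ℝ} (hx : x ∈ S) : ![a ^ m, b ^ (m + n * l)] * x ∈ S := by
  rw [isInvariant_diagonal_iff (by intro i; fin_cases i <;> simp [ha.ne', hb.ne'])] at hGA
  have hb' : b ≠ 0 := hb.ne'
  -- Only strictly positive elements of G are known to lie in S. If a coordinate of x vanishes, its
  -- multiplier is irrelevant, and a power of diag(a, b) with the right exponent in the other
  -- coordinate does the job.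
  rcases (hS x hx 0).eq_or_lt with h0 | h0
  · convert zpow_mul_mem hA hA' (m + n * l) x hx using 1
    ext i
    fin_cases i
    · simp [← h0]
    · simp
  rcases (hS x hx 1).eq_or_lt with h1 | h1
  · convert zpow_mul_mem hA hA' m x hx using 1
    ext i
    fin_cases i
    · simp
    · simp [← h1]
  refine hpos _ ?_ fun i => ?_
  · rw [← SetLike.mem_coe]
    convert zpow_mul_mem (S := (G : Set (Fin 2 → ℝ))) hGA.1 hGA.2 m _
      (zpow_mul_mem (S := (G : Set (Fin 2 → ℝ))) hB hB' l x (hSG hx)) using 1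
    ext i
    fin_cases i
    · simp
    · simp [zpow_add₀ hb', zpow_mul, mul_assoc]
  · fin_cases i
    · exact mul_pos (zpow_pos ha m) h0
    · exact mul_pos (zpow_pos hb _) h1

end Invariant

/-! ### The contradiction with the prescribed fundamental group. -/

section Main

theorem exists_zpow_lt_one {x : ℝ} (hx : 0 < x) (hx1 : x ≠ 1) {n : ℕ} (hn : 0 < n) {m : ℤ}
    (hm : |m| ≤ 1) : ∃ l : ℤ, l ≠ 0 ∧ x ^ (m + n * l) < 1 := by
  have hn' : (1 : ℤ) ≤ n := by exact_mod_cast hn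
  have := abs_le.1 hm
  rcases lt_or_gt_of_ne hx1 with h | h
  -- With |m| ≤ 1 and n ≥ 1, taking |l| = 2 already gives m + nl the sign of l.
  · exact ⟨2, two_ne_zero, zpow_lt_one₀ hx h (by linarith)⟩
  · exact ⟨-2, by norm_num, zpow_lt_one_of_neg₀ h (by linarith)⟩

theorem exists_abs_le_one_zpow_lt_one {x : ℝ} (hx1 : x ≠ 1) :
    ∃ m : ℤ, |m| ≤ 1 ∧ x ^ m < 1 := by
  rcases lt_or_gt_of_ne hx1 with h | h
  · exact ⟨1, by simp, by simpa using h⟩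
  · exact ⟨-1, by simp, zpow_lt_one_of_neg₀ h (by norm_num)⟩

/-- Invariance under diag(1, b^n) produces an additional element diag(a^m, b^(m+nl)) of F(A), with l
≠ 0 and entries less than 1. Were it the r-th power of diag(a, b), injectivity of the powers of a
and of b would give m = r = m + nl. -/
theorem fundamentalGroup_ne_of_pow_isInvariant {a b : ℝ} (ha : 0 < a) (hb : 0 < b) (ha1 : a ≠ 1)
    (hb1 : b ≠ 1) {n : ℕ} (hn : 0 < n)
    (hinv : ∀ G : AddSubgroup (Fin 2 → ℝ), IsInvariant (Matrix.diagonal ![a, b]) G →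
      (∀ g ∈ G, ![1, b ^ n] * g ∈ G) ∧ ∀ g ∈ G, (![1, b ^ n])⁻¹ * g ∈ G)
    {A : Type*} [CStarAlgebra A] (hA : IsAF A) (hdim : Module.finrank ℂ (traceSpace A) = 2)
    {φ : Fin 2 → traceSpace A} (hφE : EnumeratesExtremalTraces φ) (hφ : HasK0Embedding φ) :
    fundamentalGroup φ ≠ {M | ∃ n : ℤ, M = Matrix.diagonal ![(a : ℂ) ^ n, (b : ℂ) ^ n]} := by
  intro hF
  have : FiniteDimensional ℂ (traceSpace A) := FiniteDimensional.of_finrank_pos (by omega)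
  have hφ' : ∀ i, φ i ∈ tracialStates A := fun i =>
    extremePoints_subset (hφE.2 ▸ Set.mem_range_self i)
  have hmem : ∀ k : ℤ, Matrix.diagonal (fun i => ((![a ^ k, b ^ k] i : ℝ) : ℂ)) ∈
      fundamentalGroup φ := by
    intro k
    rw [hF]
    refine ⟨k, congrArg _ (funext fun i => ?_)⟩
    fin_cases i <;> simp
  have hS : ∀ x ∈ traceVectors φ, ![a, b] * x ∈ traceVectors φ := fun x hx => by
    simpa using mul_mem_traceVectors_of_mem_fundamentalGroup (hmem 1) hx
  have hS' : ∀ x ∈ traceVectors φ, (![a, b])⁻¹ * x ∈ traceVectors φ := fun x hx => by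
    convert mul_mem_traceVectors_of_mem_fundamentalGroup (hmem (-1)) hx using 2
    ext i
    fin_cases i <;> simp
  have hG : IsInvariant (Matrix.diagonal ![a, b]) (Gam φ).range := by
    rw [isInvariant_diagonal_iff (by intro i; fin_cases i <;> simp [ha.ne', hb.ne'])]
    constructor <;> intro g hg <;>
      obtain ⟨x, hx, y, hy, rfl⟩ := exists_eq_sub_of_mem_range_Gam hφ' hg <;>
      rw [mul_sub]
    · exact sub_mem (traceVectors_subset_range_Gam (hS x hx))
        (traceVectors_subset_range_Gam (hS y hy))
    · exact sub_mem (traceVectors_subset_range_Gam (hS' x hx))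
        (traceVectors_subset_range_Gam (hS' y hy))
  obtain ⟨hB, hB'⟩ := hinv _ hG
  have key := fun (m l : ℤ) (x : Fin 2 → ℝ) (hx : x ∈ traceVectors φ) =>
    mul_mem_of_invariant ha hb traceVectors_subset_range_Gam
      (fun x hx i => nonneg_of_mem_traceVectors hφ' hx i)
      (fun g hg h => mem_traceVectors_of_pos hA hφE hφ' hg h) hS hS' hG hB hB' m l hx
  obtain ⟨m, hm, ham⟩ := exists_abs_le_one_zpow_lt_one ha1
  obtain ⟨l, hl, hbl⟩ := exists_zpow_lt_one hb hb1 hn hm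
  have hM : Matrix.diagonal (fun i => ((![a ^ m, b ^ (m + n * l)] i : ℝ) : ℂ)) ∈
      fundamentalGroup φ := by
    refine diagonal_mem_fundamentalGroup hA hφE hφ hφ' ?_ ?_ (key m l) fun x hx => ?_
    · intro i
      fin_cases i
      · exact zpow_pos ha _
      · exact zpow_pos hb _
    · intro i
      fin_cases i
      · exact ham
      · exact hbl
    · convert key (-m) (-l) x hx using 2
      ext i
      fin_cases i
      · simp
      · simp [← zpow_neg]
        congr 1
        ring
  rw [hF] at hM
  obtain ⟨r, hr⟩ := hM
  have hr' := Matrix.diagonal_injective hr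
  have h0 : a ^ m = a ^ r := by
    have := congrFun hr' 0
    simp only [Matrix.cons_val_zero] at this
    exact_mod_cast this
  have h1 : b ^ (m + n * l) = b ^ r := by
    have := congrFun hr' 1
    simp only [Matrix.cons_val_one, Matrix.cons_val_fin_one] at this
    exact_mod_cast this
  have e0 : m = r := zpow_right_injective₀ ha ha1 h0
  have e1 : m + n * l = r := zpow_right_injective₀ hb hb1 h1
  have : (n : ℤ) * l = 0 := by linarith
  rcases mul_eq_zero.1 this with h | h
  · exact hn.ne' (by exact_mod_cast h)
  · exact hl h

end Main

end AFFundamental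

theorem mainTheorem5 (a b : ℝ) (ha : 0 < a) (hb : 0 < b) (ha_alg : IsAlgebraic ℚ a)
    (hb_alg : IsAlgebraic ℚ b) (hab : a ≠ b) (ha1 : a ≠ 1) (hb1 : b ≠ 1)
    (ψ₁ ψ₂ : Polynomial ℤ) (hψ₁ : AFFundamental.IsMinIntPoly ψ₁ a)
    (hψ₂ : AFFundamental.IsMinIntPoly ψ₂ b) (hne : ψ₁ ≠ ψ₂) (hmonic : ψ₂.Monic) :
    (∃ n : ℕ, 0 < n ∧ ∀ G : AddSubgroup (Fin 2 → ℝ),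
      AFFundamental.IsInvariant (Matrix.diagonal ![a, b]) G →
        AFFundamental.IsInvariant (Matrix.diagonal ![1, b ^ n]) G ∧
        AFFundamental.IsInvariant (Matrix.diagonal ![1, (b ^ n)⁻¹]) G) ∧
    ∀ (𝒜 : Type*) [CStarAlgebra 𝒜], AFFundamental.IsAF 𝒜 →
      Module.finrank ℂ (AFFundamental.traceSpace 𝒜) = 2 →
      ∀ φ : Fin 2 → AFFundamental.traceSpace 𝒜,
        AFFundamental.EnumeratesExtremalTraces φ → AFFundamental.HasK0Embedding φ →
        AFFundamental.fundamentalGroup φ ≠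
          {M | ∃ n : ℤ, M = Matrix.diagonal ![(a : ℂ) ^ n, (b : ℂ) ^ n]} := by
  obtain ⟨n, hn, h⟩ := AFFundamental.exists_pow_isInvariant ha.ne' hb.ne' ha_alg hb_alg hψ₁ hψ₂
    hne hmonic
  refine ⟨⟨n, hn, fun G hG => ?_⟩, fun 𝒜 _ hA hdim φ hφE hφ =>
    AFFundamental.fundamentalGroup_ne_of_pow_isInvariant ha hb ha1 hb1 hn h hA hdim hφE hφ⟩
  obtain ⟨h1, h2⟩ := h G hG
  have hinv : (![1, b ^ n] : Fin 2 → ℝ)⁻¹ = ![1, (b ^ n)⁻¹] := by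
    ext i
    fin_cases i <;> simp
  have hinv' : (![1, (b ^ n)⁻¹] : Fin 2 → ℝ)⁻¹ = ![1, b ^ n] := by
    rw [← hinv, inv_inv]
  constructor
  · rw [AFFundamental.isInvariant_diagonal_iff (by intro i; fin_cases i <;> simp [hb.ne'])]
    exact ⟨h1, h2⟩
  · rw [AFFundamental.isInvariant_diagonal_iff (by intro i; fin_cases i <;> simp [hb.ne'])]
    rw [hinv', ← hinv]
    exact ⟨h2, h1⟩
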